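/- Conventions. A smooth metric measure space $(M,g,e^{-\phi}\mathrm{dvol},m)$ has $\phi\in C^\infty(M)$ and $m\in[0,\infty]$, with $\phi=0$ if $m=0$; we write $v^m\,\mathrm{dvol}$ for $e^{-\phi}\mathrm{dvol}$ when $\phi=-m\log v$. Put $\mathrm{Ric}_\phi^m=\mathrm{Ric}+\nabla^2\phi-\frac1m d\phi\otimes d\phi$ (no last term for $m=0,\infty$). The weighted mean curvature of a hypersurface with unit normal $\eta$ is $H_\phi=\mathrm{div}\,\eta-d\phi(\eta)$. On $\mathbb R\times S^1\times N$ let $t$ be the first coordinate, $d\theta^2$ the metric of the unit circle, $\Sigma_t=\{t\}\times S^1\times N$ with $\eta=\partial_t$, and $h_t=\inf_{\Sigma_t}\min\{H_\phi,\sqrt{m+n-1}\}$ for finite $m$. A space has two ends if $2$ is the supremum, over compact $K$, of the number of components of its complement that are not relatively compact. Let $n\ge4$ and let $(N^{n-2},h)$ be a complete Riemannian manifold. (A) Let $m\in[0,\infty)$. There is a unique $v:\mathbb R\to(0,\infty)$ with $$(v')^2=\frac{v^2-1}{m+n-1}+\frac{2(m+n-3)^{(m+n-3)/2}}{(m+n-1)^{(m+n+1)/2}}\,v^{3-m-n},\qquad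 v(0)=1,\quad v'>0,$$ and it is smooth. If $\mathrm{Ric}_h\ge-\frac{m+n-3}{m+n-1}h$, then $$\bigl(\mathbb R\times S^1\times N,\ g=dt^2\oplus((m+n-1)v'(t))^2d\theta^2\oplus v(t)^2h,\ v(t)^m\,\mathrm{dvol}\bigr)$$ is complete with $\mathrm{Ric}_\phi^m\ge-g$ (with equality if $\mathrm{Ric}_h=-\frac{m+n-3}{m+n-1}h$). The weighted mean curvature of $\Sigma_t$ is $$H_\phi=\frac{v''}{v'}+(m+n-2)\frac{v'}{v}=\sqrt{m+n-1}-\frac{m+n-3}{2\sqrt{m+n-1}}v^{-2}+o(v^{-2})\quad(t\to\infty),$$ and $\lim_{t\to\infty}(\sqrt{m+n-1}-h_t)e^{2t/\sqrt{m+n-1}}=A$ for some $A\in(0,\infty)$. If moreover $N$ is compact and connected, the decay hypothesis of the splitting theorem (which, in the normalization $\mathrm{Ric}^m_\phi\ge-g$, requires the limit below to be $0$) cannot be weakened to a finite limit: the space has two ends; each $\Sigma_t$ is compact and its complement is the union of two disjoint nonempty connected open sets; for every point $o$, $d(o,\Sigma_t)\to\infty$ and $(\sqrt{m+n-1}-h_t)e^{2d(o,\Sigma_t)/\sqrt{m+n-1}}$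 has a limit in $(0,\infty)$ as $t\to\infty$; but $g$ is not isometric to $(\mathbb R\times N',dt^2\oplus e^{2t/\sqrt{m+n-1}}h')$ for any compact $(N'^{\,n-1},h')$ of nonnegative Ricci curvature. (B) ($m=\infty$.) There is a unique $\phi:\mathbb R\to(-\infty,1)$ with $(\phi')^2=2e^{\phi-1}-2\phi$, $\phi(0)=0$, $\phi'<0$, and it is smooth. If $v_m$ denotes the solution in (A), then for every $t$, as $m\to\infty$, $((m+n-1)v_m'(t))^2\to\phi'(t)^2$, $v_m(t)\to1$ and $v_m(t)^m\to e^{-\phi(t)}$. If $\mathrm{Ric}_h\ge-h$, then $$\bigl(\mathbb R\times S^1\times N,\ g=dt^2\oplus\phi'(t)^2d\theta^2\oplus h,\ e^{-\phi(t)}\mathrm{dvol}\bigr)$$ is complete with $\mathrm{Ric}+\nabla^2\phi\ge-g$, and $\Sigma_t$ has $H_\phi=\frac{\phi''}{\phi'}-\phi'$. If $\mathrm{Ric}_h=-h$, then it is an expanding gradient Ricci soliton, $\mathrm{Ric}+\nabla^2\phi=-g$ with $\phi$ smooth, its scalar curvature is $R=2-n-2e^{\phi-1}$, so that $R>-n$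 everywhere, and $R\to-n$ as $t\to-\infty$. If moreover $N$ is compact and connected, it has two ends and is not isometric to $(\mathbb R\times N',dt^2\oplus h')$ for any compact $(N'^{\,n-1},h')$ with $\mathrm{Ric}_{h'}=-h'$; so in the Munteanu–Wang theorem (a complete expanding gradient Ricci soliton with $R\ge-(n-1)$ and more than one end is such a product) the assumption $R\ge-(n-1)$ cannot be relaxed to $R>-n$. -/

import Mathlib

open Set Filter Topology Asymptotics
open scoped Manifold ContDiff ENNReal

universe u w

set_option maxSynthPendingDepth 3

/-! ### Local Riemannian geometry

Formulas for a metric `G` on (an open subset of) a finite-dimensional space `E`. All of them are the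
usual ones, written without choosing a basis. -/

section LocalGeometry

variable {E : Type*} [NormedAddCommGroup E] [NormedSpace ℝ E]

/-- The Christoffel map `Γ_y(u, v)` of the metric `G`, i.e. the vector with
`G_y(Γ_y(u,v), w) = ½ (D_u G(v,w) + D_v G(u,w) - D_w G(u,v))` for all `w`. -/
noncomputable def localChristoffel (G : E → E →L[ℝ] E →L[ℝ] ℝ) (y : E) : E →L[ℝ] E →L[ℝ] E :=
  let D : E →L[ℝ] E →L[ℝ] (E →L[ℝ] ℝ) := fderiv ℝ G y
  let D₂ : E →L[ℝ] E →L[ℝ] (E →L[ℝ] ℝ) := D.flip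
  let F : (E →L[ℝ] (E →L[ℝ] ℝ)) →L[ℝ] (E →L[ℝ] (E →L[ℝ] ℝ)) :=
    (ContinuousLinearMap.flipₗᵢ ℝ E E ℝ).toContinuousLinearEquiv.toContinuousLinearMap
  let D₃ : E →L[ℝ] E →L[ℝ] (E →L[ℝ] ℝ) := F.comp D₂
  (ContinuousLinearMap.compL ℝ E (E →L[ℝ] ℝ) E (ContinuousLinearMap.inverse (G y))).comp
    ((1 / 2 : ℝ) • (D + D₂ - D₃))

theorem localChristoffel_spec (G : E → E →L[ℝ] E →L[ℝ] ℝ) (y : E) (hG : (G y).IsInvertible)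
    (u v w : E) :
    G y (localChristoffel G y u v) w =
      1 / 2 * (fderiv ℝ G y u v w + fderiv ℝ G y v u w - fderiv ℝ G y w u v) := by
  obtain ⟨e, he⟩ := hG
  simp [localChristoffel, ← he]

/-- The curvature map `u ↦ R(u, v) w`, with
`R(u,v)w = D_uΓ(v,w) - D_vΓ(u,w) + Γ(u,Γ(v,w)) - Γ(v,Γ(u,w))`. -/
noncomputable def localCurvature (G : E → E →L[ℝ] E →L[ℝ] ℝ) (y v w : E) : E →ₗ[ℝ] E where
  toFun u :=
    fderiv ℝ (localChristoffel G) y u v w - fderiv ℝ (localChristoffel G) y v u w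
      + localChristoffel G y u (localChristoffel G y v w)
      - localChristoffel G y v (localChristoffel G y u w)
  map_add' a b := by simp; abel
  map_smul' c a := by simp [smul_sub, smul_add]

/-- The Ricci tensor `Ric(v, w) = tr (u ↦ R(u, v) w)`. -/
noncomputable def localRicci (G : E → E →L[ℝ] E →L[ℝ] ℝ) (y : E) : E →ₗ[ℝ] E →ₗ[ℝ] ℝ :=
  LinearMap.mk₂ ℝ (fun v w => LinearMap.trace ℝ E (localCurvature G y v w))
    (fun a b w => by
      rw [← map_add]; congr 1; ext u; simp [localCurvature]; abel)
    (fun c a w => by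
      rw [← map_smul]; congr 1; ext u; simp [localCurvature, smul_sub, smul_add])
    (fun v a b => by
      rw [← map_add]; congr 1; ext u; simp [localCurvature]; abel)
    (fun c v a => by
      rw [← map_smul]; congr 1; ext u; simp [localCurvature, smul_sub, smul_add])

/-- The scalar curvature: the trace of the Ricci tensor after raising an index with `G`. -/
noncomputable def localScalar [FiniteDimensional ℝ E] (G : E → E →L[ℝ] E →L[ℝ] ℝ) (y : E) : ℝ :=
  LinearMap.trace ℝ E
    ((ContinuousLinearMap.inverse (G y)).toLinearMap ∘ₗ
      (LinearMap.toContinuousLinearMap : (E →ₗ[ℝ] ℝ) ≃ₗ[ℝ] (E →L[ℝ] ℝ)).toLinearMap ∘ₗ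
        localRicci G y)

/-- The Hessian `∇²f(u, v) = D²f(u, v) - Df(Γ(u, v))`. -/
noncomputable def localHessian (G : E → E →L[ℝ] E →L[ℝ] ℝ) (f : E → ℝ) (y u v : E) : ℝ :=
  fderiv ℝ (fderiv ℝ f) y u v - fderiv ℝ f y (localChristoffel G y u v)

/-- The divergence `div X = tr (u ↦ ∇_u X) = tr (u ↦ D_u X + Γ(u, X))`. -/
noncomputable def localDivergence (G : E → E →L[ℝ] E →L[ℝ] ℝ) (X : E → E) (y : E) : ℝ :=
  LinearMap.trace ℝ E
    ((fderiv ℝ X y + (localChristoffel G y).flip (X y) : E →L[ℝ] E) : E →ₗ[ℝ] E)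

end LocalGeometry

/-! ### Riemannian metrics on manifolds -/

section Manifolds

/-- A smooth Riemannian metric on the manifold `M`. -/
abbrev SmoothMetric {E H : Type*} [NormedAddCommGroup E] [NormedSpace ℝ E] [TopologicalSpace H]
    (I : ModelWithCorners ℝ E H) (M : Type*) [TopologicalSpace M] [ChartedSpace H M]
    [IsManifold I ∞ M] :=
  Bundle.ContMDiffRiemannianMetric I ∞ E (fun x : M => TangentSpace I x)

variable {E H M : Type*} [NormedAddCommGroup E] [NormedSpace ℝ E] [TopologicalSpace H]
  {I : ModelWithCorners ℝ E H} [TopologicalSpace M] [ChartedSpace H M] [IsManifold I ∞ M]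

namespace SmoothMetric

/-- The metric read in the preferred chart at `x₀`. -/
noncomputable def inChart (g : SmoothMetric I M) (x₀ : M) (y : E) : E →L[ℝ] E →L[ℝ] ℝ :=
  let p : M := (extChartAt I x₀).symm y
  let A : E →L[ℝ] E := mfderiv 𝓘(ℝ, E) I (extChartAt I x₀).symm y
  let B : E →L[ℝ] E →L[ℝ] ℝ := g.inner p
  B.bilinearComp A A

/-- The differential at `p` of the preferred chart at `x₀`. -/
noncomputable def chartDeriv (I : ModelWithCorners ℝ E H) (x₀ p : M) :
    TangentSpace I p →L[ℝ] E :=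
  mfderiv I 𝓘(ℝ, E) (extChartAt I x₀) p

/-- The Ricci tensor of `g`. -/
noncomputable def ricci (g : SmoothMetric I M) (x : M) (X Y : TangentSpace I x) : ℝ :=
  localRicci (g.inChart x) (extChartAt I x x) (chartDeriv I x x X) (chartDeriv I x x Y)

/-- The scalar curvature of `g`. -/
noncomputable def scalar [FiniteDimensional ℝ E] (g : SmoothMetric I M) (x : M) : ℝ :=
  localScalar (g.inChart x) (extChartAt I x x)

/-- The Hessian `∇²f` of a function. -/
noncomputable def hessian (g : SmoothMetric I M) (f : M → ℝ) (x : M)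
    (X Y : TangentSpace I x) : ℝ :=
  localHessian (g.inChart x) (fun y => f ((extChartAt I x).symm y)) (extChartAt I x x)
    (chartDeriv I x x X) (chartDeriv I x x Y)

/-- The divergence of a vector field. -/
noncomputable def divergence (g : SmoothMetric I M) (X : (x : M) → TangentSpace I x) (x : M) : ℝ :=
  localDivergence (g.inChart x)
    (fun y => chartDeriv I x ((extChartAt I x).symm y) (X ((extChartAt I x).symm y)))
    (extChartAt I x x)

/-- The differential of a real function. -/
noncomputable def differential (I : ModelWithCorners ℝ E H) (f : M → ℝ) (x : M) :
    TangentSpace I x →L[ℝ] ℝ :=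
  mfderiv I 𝓘(ℝ, ℝ) f x

/-- The gradient of a function. -/
noncomputable def gradient (g : SmoothMetric I M) (f : M → ℝ) (x : M) : TangentSpace I x :=
  ContinuousLinearMap.inverse (g.inner x) (differential I f x)

/-- The unit normal `∇f / |∇f|` of the level sets of a function `f` without critical points. -/
noncomputable def unitNormal (g : SmoothMetric I M) (f : M → ℝ) (x : M) : TangentSpace I x :=
  (Real.sqrt (g.inner x (g.gradient f x) (g.gradient f x)))⁻¹ • g.gradient f x

/-- The Bakry-Émery Ricci tensor `Ric + ∇²φ - (1/m) dφ ⊗ dφ` of `(M, g, e^{-φ} dvol, m)`,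
`m ∈ [0, ∞]`. The last term is absent for `m = ∞`, and also for `m = 0` (where `φ = 0`). -/
noncomputable def bakryEmeryRicci (g : SmoothMetric I M) (φ : M → ℝ) (m : ℝ≥0∞) (x : M)
    (X Y : TangentSpace I x) : ℝ :=
  g.ricci x X Y + g.hessian φ x X Y -
    (m⁻¹).toReal * (differential I φ x X * differential I φ x Y)

/-- The weighted divergence `δ_φ X = div X - dφ(X)`, i.e. minus the formal adjoint of the gradient
with respect to `e^{-φ} dvol`. -/
noncomputable def weightedDivergence (g : SmoothMetric I M) (φ : M → ℝ)
    (X : (x : M) → TangentSpace I x) (x : M) : ℝ :=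
  g.divergence X x - differential I φ x (X x)

/-- The weighted mean curvature `H_φ = δ_φ η` at `x` of the level set of `f` through `x`, where the
unit normal `η` points towards larger values of `f`. -/
noncomputable def levelSetMeanCurvature (g : SmoothMetric I M) (φ f : M → ℝ) (x : M) : ℝ :=
  g.weightedDivergence φ (g.unitNormal f) x

/-- The number `h_t = inf_{x ∈ {f = t}} min {H_φ(x), c}`. -/
noncomputable def cappedMeanCurvature (g : SmoothMetric I M) (φ f : M → ℝ) (c t : ℝ) : ℝ :=
  ⨅ x : {x : M // f x = t}, min (g.levelSetMeanCurvature φ f x) c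

section Distance

open scoped Bundle

/-- The Riemannian distance of `g` (infinite between different components). -/
noncomputable def edist (g : SmoothMetric I M) (x y : M) : ℝ≥0∞ :=
  letI : Bundle.RiemannianBundle (fun x : M => TangentSpace I x) := ⟨g.toRiemannianMetric⟩
  Manifold.riemannianEDist I x y

end Distance

/-- The distance from a point to a set. -/
noncomputable def edistSet (g : SmoothMetric I M) (x : M) (S : Set M) : ℝ≥0∞ :=
  ⨅ y ∈ S, g.edist x y

/-- Metric completeness of `(M, g)`. -/
def IsComplete (g : SmoothMetric I M) : Prop :=
  ∀ u : ℕ → M,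
    (∀ ε : ℝ≥0∞, 0 < ε → ∃ K : ℕ, ∀ i ≥ K, ∀ j ≥ K, g.edist (u i) (u j) < ε) →
      ∃ x : M, Tendsto (fun i => g.edist (u i) x) atTop (𝓝 0)

/-- `(M, g)` and `(M', g')` are isometric: there is a diffeomorphism pulling `g'` back to `g`. -/
def IsIsometricTo {E' H' M' : Type*} [NormedAddCommGroup E'] [NormedSpace ℝ E']
    [TopologicalSpace H'] {I' : ModelWithCorners ℝ E' H'} [TopologicalSpace M'] [ChartedSpace H' M']
    [IsManifold I' ∞ M'] (g : SmoothMetric I M) (g' : SmoothMetric I' M') : Prop :=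
  ∃ F : M ≃ₘ^∞⟮I, I'⟯ M', ∀ (x : M) (X Y : TangentSpace I x),
    g'.inner (F x) (mfderiv I I' F x X) (mfderiv I I' F x Y) = g.inner x X Y

end SmoothMetric

end Manifolds

/-- The number of ends of a space: the supremum, over all compact sets `K`, of the number of
connected components of the complement of `K` that are not relatively compact. -/
noncomputable def numberOfEnds (M : Type*) [TopologicalSpace M] : ℕ∞ :=
  ⨆ (K : Set M) (_ : IsCompact K),
    Set.encard {C : Set M | (∃ x ∈ Kᶜ, C = connectedComponentIn Kᶜ x) ∧ ¬ IsCompact (closure C)}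

/-! ### Warped products -/

section WarpedProducts

/-- The model of `ℝ × N`, where `N` is a manifold of dimension `d`. -/
noncomputable abbrev lineModel (d : ℕ) := (𝓘(ℝ, ℝ)).prod (𝓡 d)

/-- The model of `ℝ × S¹ × N`, where `N` is a manifold of dimension `d`. -/
noncomputable abbrev lineCircleModel (d : ℕ) := (𝓘(ℝ, ℝ)).prod ((𝓡 1).prod (𝓡 d))

variable {d : ℕ} {N : Type*} [TopologicalSpace N] [ChartedSpace (EuclideanSpace ℝ (Fin d)) N]
  [IsManifold (𝓡 d) ∞ N]

/-- `g` is the metric `dt² ⊕ β(t)² h` on `ℝ × N`. -/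
def IsLineWarpedMetric (β : ℝ → ℝ) (h : SmoothMetric (𝓡 d) N)
    (g : SmoothMetric (lineModel d) (ℝ × N)) : Prop :=
  ∀ (x : ℝ × N) (X Y : TangentSpace (lineModel d) x),
    g.inner x X Y =
      SmoothMetric.differential (lineModel d) (fun q : ℝ × N => q.1) x X *
        SmoothMetric.differential (lineModel d) (fun q : ℝ × N => q.1) x Y
      + β x.1 ^ 2 *
        h.inner x.2 (mfderiv (lineModel d) (𝓡 d) (fun q : ℝ × N => q.2) x X)
          (mfderiv (lineModel d) (𝓡 d) (fun q : ℝ × N => q.2) x Y)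

/-- The differential of the map `ℝ × S¹ × N → S¹ ⊂ ℂ`. -/
noncomputable def circleDifferential (x : ℝ × Circle × N) :
    TangentSpace (lineCircleModel d) x →L[ℝ] ℂ :=
  mfderiv (lineCircleModel d) 𝓘(ℝ, ℂ) (fun q : ℝ × Circle × N => (q.2.1 : ℂ)) x

/-- `g` is the metric `dt² ⊕ α(t)² dθ² ⊕ β(t)² h` on `ℝ × S¹ × N`, where `dθ²` is the metric
that the unit circle `S¹` inherits from `ℂ`. -/
def IsLineCircleWarpedMetric (α β : ℝ → ℝ) (h : SmoothMetric (𝓡 d) N)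
    (g : SmoothMetric (lineCircleModel d) (ℝ × Circle × N)) : Prop :=
  ∀ (x : ℝ × Circle × N) (X Y : TangentSpace (lineCircleModel d) x),
    g.inner x X Y =
      SmoothMetric.differential (lineCircleModel d) (fun q : ℝ × Circle × N => q.1) x X *
        SmoothMetric.differential (lineCircleModel d) (fun q : ℝ × Circle × N => q.1) x Y
      + α x.1 ^ 2 * inner ℝ (circleDifferential x X) (circleDifferential x Y)
      + β x.1 ^ 2 *
        h.inner x.2.2
          (mfderiv (lineCircleModel d) (𝓡 d) (fun q : ℝ × Circle × N => q.2.2) x X)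
          (mfderiv (lineCircleModel d) (𝓡 d) (fun q : ℝ × Circle × N => q.2.2) x Y)

end WarpedProducts

/-! ### The profile functions -/

/-- `v : ℝ → (0, ∞)` solves
`(v')² = (v² - 1)/(m+n-1) + 2 (m+n-3)^{(m+n-3)/2} (m+n-1)^{-(m+n+1)/2} v^{3-m-n}`,
`v(0) = 1`, `v' > 0`. -/
structure IsBesseProfile (n : ℕ) (m : ℝ) (v : ℝ → ℝ) : Prop where
  pos : ∀ t, 0 < v t
  differentiable : Differentiable ℝ v
  ode : ∀ t, deriv v t ^ 2 = (v t ^ 2 - 1) / (m + n - 1) +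
    2 * (m + n - 3) ^ ((m + n - 3) / 2) / (m + n - 1) ^ ((m + n + 1) / 2) * v t ^ (3 - m - n)
  initial : v 0 = 1
  deriv_pos : ∀ t, 0 < deriv v t

/-- `φ : ℝ → (-∞, 1)` solves `(φ')² = 2 e^{φ-1} - 2 φ`, `φ(0) = 0`, `φ' < 0`. -/
structure IsBesseProfileInfty (φ : ℝ → ℝ) : Prop where
  lt_one : ∀ t, φ t < 1
  differentiable : Differentiable ℝ φ
  ode : ∀ t, deriv φ t ^ 2 = 2 * Real.exp (φ t - 1) - 2 * φ t
  initial : φ 0 = 0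
  deriv_neg : ∀ t, deriv φ t < 0

/-! Put k = m+n-1. With density v^m and a circle of radius proportional to v', the dt² and dθ²
components of `Ric_φ^m = -g` are the same equation v'''/v' + (k-1)v''/v = 1. Along N the equation is
2vv'' + (k-2)(v')² = v² - (k-2)/k, and the tensor left over in `Ric_φ^m + g` is Ric_h + ((k-2)/k)h.
The profile equation is a first integral of this system; its constant makes the right-hand side
vanish to second order at z = sqrt((k-2)/k), so that v only approaches z as t → -∞ and the solution
is global. For m = ∞ the circle has radius |φ'|, N is not warped, and the dt² and dθ² components
again agree: φ'' - φ'''/φ' = -1.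

All profiles come from one family of equations. Writing v = z·exp(s/(k-2)) turns the equation for v
into (s')² = 2∫₀ˢ e^{-δσ}(1-e^{-σ})dσ with δ = 2/(k-2) (`besseForce_eq`), and s = 1-φ satisfies the
case δ = 0 (`isBesseProfileInfty_iff`). For r = log s this is r' = Q(δ,r) with Q smooth in r,
jointly continuous, positive and at most 1 when δ ≥ 0. Such an equation is solved by inverting the
time ∫dr/Q, which gives existence, uniqueness, smoothness and continuous dependence on δ, hence also
the limit m → ∞ (`tendsto_besseProfile_atTop`).

The asymptotics start from (v'/v)² = 1/k - v⁻²/k + O(v^{-k}). This yields the v⁻² term of H_φ, and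
it makes log v - t/√k converge, so v⁻² may be replaced by a constant times e^{-2t/√k}
(`IsBesseProfile.exists_tendsto_mul_exp`). As t is 1-Lipschitz and its coordinate lines have unit
speed, d(o,Σ_t) = |t(o) - t|.

For finite m the metric is not a warped product with factor e^{t/√k}, because there the slices
collapse as t → -∞. A homeomorphism ℝ × K ≃ ℝ × K' with compact factors sends each line ℝ × {k}
across every slice, so two lines over different points of N would come arbitrarily close; but v > z
keeps the projection to N Lipschitz (`not_isIsometricTo_of_collapsing`). For m = ∞ the circles
become arbitrarily short as t → -∞. In a product ℝ × N' with compact N', a short loop projects into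
a coordinate ball of N' and is null-homotopic, whereas these circles are not
(`not_isIsometricTo_of_short_circles`).

The curvature of a doubly warped product is computed once, for metrics on open subsets of vector
spaces (`localRicci_warpedForm`), and carried to manifolds through the product charts
(`formInChart_warpedInner`). -/

section LocalMetrics

/-! ### Metrics on open subsets of a vector space -/

variable {E : Type*} [NormedAddCommGroup E] [NormedSpace ℝ E]

/-- `G` is a smooth Riemannian metric on the open set `U`. -/
structure IsLocalMetricOn (G : E → E →L[ℝ] E →L[ℝ] ℝ) (U : Set E) : Prop where
  isOpen : IsOpen U
  contDiffOn : ContDiffOn ℝ ∞ G U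
  symm : ∀ y ∈ U, ∀ v w, G y v w = G y w v
  pos : ∀ y ∈ U, ∀ v, v ≠ 0 → 0 < G y v v

theorem ContinuousLinearMap.isInvertible_of_pos [FiniteDimensional ℝ E] (B : E →L[ℝ] E →L[ℝ] ℝ)
    (hB : ∀ v, v ≠ 0 → 0 < B v v) : B.IsInvertible := by
  have hinj : Function.Injective (B : E →ₗ[ℝ] (E →L[ℝ] ℝ)) := by
    rw [← LinearMap.ker_eq_bot, LinearMap.ker_eq_bot']
    intro v hv
    by_contra hne
    have h := hB v hne
    rw [show B v = 0 from hv] at h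
    simp at h
  have hdim : Module.finrank ℝ E = Module.finrank ℝ (E →L[ℝ] ℝ) := by
    rw [← (LinearMap.toContinuousLinearMap : (E →ₗ[ℝ] ℝ) ≃ₗ[ℝ] (E →L[ℝ] ℝ)).finrank_eq]
    exact (Subspace.dual_finrank_eq (K := ℝ) (V := E)).symm
  let e := LinearMap.linearEquivOfInjective (B : E →ₗ[ℝ] (E →L[ℝ] ℝ)) hinj hdim
  exact ⟨e.toContinuousLinearEquiv, by ext v w; rfl⟩

/-- Reduces the derivative of a tensor field to derivatives of scalar or vector functions of one
real variable; the derivatives of warped products below are all found this way and identified by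
uniqueness. -/
theorem HasLineDerivAt.clm_apply_apply {F : Type*} [NormedAddCommGroup F] [NormedSpace ℝ F]
    {G : E → E →L[ℝ] E →L[ℝ] F} {y : E}
    (hG : DifferentiableAt ℝ G y) (u v w : E) :
    HasLineDerivAt ℝ (fun z => G z v w) (fderiv ℝ G y u v w) y u := by
  have h := hG.hasFDerivAt.hasLineDerivAt u
  have h' : HasDerivAt (fun t : ℝ => G (y + t • u)) (fderiv ℝ G y u) 0 := h
  have h2 := (h'.clm_apply (hasDerivAt_const (0 : ℝ) v)).clm_apply (hasDerivAt_const (0 : ℝ) w)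
  simpa [HasLineDerivAt] using h2

variable {G : E → E →L[ℝ] E →L[ℝ] ℝ} {U : Set E} {y : E}

namespace IsLocalMetricOn

theorem contDiffAt (hG : IsLocalMetricOn G U) (hy : y ∈ U) : ContDiffAt ℝ ∞ G y :=
  hG.contDiffOn.contDiffAt (hG.isOpen.mem_nhds hy)

theorem differentiableAt (hG : IsLocalMetricOn G U) (hy : y ∈ U) : DifferentiableAt ℝ G y :=
  (hG.contDiffAt hy).differentiableAt (by simp)

theorem isInvertible [FiniteDimensional ℝ E] (hG : IsLocalMetricOn G U) (hy : y ∈ U) :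
    (G y).IsInvertible :=
  ContinuousLinearMap.isInvertible_of_pos _ (hG.pos y hy)

/-- Nondegeneracy, in the form used to recognise a Christoffel vector from its defining identity. -/
theorem eq_of_forall (hG : IsLocalMetricOn G U) (hy : y ∈ U) {a b : E}
    (h : ∀ w, G y a w = G y b w) : a = b := by
  by_contra hne
  have h1 := hG.pos y hy (a - b) (sub_ne_zero.2 hne)
  have h2 : G y (a - b) = 0 := by
    rw [map_sub, sub_eq_zero]
    exact ContinuousLinearMap.ext h
  simp [h2] at h1

theorem christoffel_spec [FiniteDimensional ℝ E] (hG : IsLocalMetricOn G U) (hy : y ∈ U)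
    (u v w : E) : G y (localChristoffel G y u v) w =
      1 / 2 * (fderiv ℝ G y u v w + fderiv ℝ G y v u w - fderiv ℝ G y w u v) :=
  localChristoffel_spec G y (hG.isInvertible hy) u v w

theorem fderiv_symm (hG : IsLocalMetricOn G U) (hy : y ∈ U) (u v w : E) :
    fderiv ℝ G y u v w = fderiv ℝ G y u w v := by
  have h1 := HasLineDerivAt.clm_apply_apply (hG.differentiableAt hy) u v w
  have h2 := HasLineDerivAt.clm_apply_apply (hG.differentiableAt hy) u w v
  refine HasLineDerivAt.unique (h1.congr_of_eventuallyEq ?_) h2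
  filter_upwards [hG.isOpen.mem_nhds hy] with z hz using hG.symm z hz w v

theorem christoffel_symm [FiniteDimensional ℝ E] (hG : IsLocalMetricOn G U) (hy : y ∈ U)
    (u v : E) : localChristoffel G y u v = localChristoffel G y v u := by
  refine hG.eq_of_forall hy fun w => ?_
  rw [hG.christoffel_spec hy, hG.christoffel_spec hy, hG.fderiv_symm hy w u v]
  ring

theorem contDiffAt_christoffel [FiniteDimensional ℝ E] (hG : IsLocalMetricOn G U) (hy : y ∈ U) :
    ContDiffAt ℝ ∞ (localChristoffel G) y := by
  have h0 : ContDiffAt ℝ ∞ (fderiv ℝ G) y :=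
    (hG.contDiffAt hy).fderiv_right (m := ∞) (by simp)
  have hflip : ContDiffAt ℝ ∞ (fun z => (fderiv ℝ G z).flip) y :=
    (ContinuousLinearMap.flipₗᵢ ℝ E E (E →L[ℝ] ℝ)).contDiff.contDiffAt.comp y h0
  have hcomp := contDiffAt_const (𝕜 := ℝ) (n := ∞) (x := y)
    (c := (ContinuousLinearMap.flipₗᵢ ℝ E E ℝ).toContinuousLinearEquiv.toContinuousLinearMap)
  have hinv : ContDiffAt ℝ ∞ (fun z => ContinuousLinearMap.inverse (G z)) y :=
    ((hG.isInvertible hy).contDiffAt_map_inverse).comp y (hG.contDiffAt hy)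
  have hL := (ContinuousLinearMap.compL ℝ E (E →L[ℝ] ℝ) E).contDiff.contDiffAt.comp y hinv
  exact ContDiffAt.clm_comp hL ((((h0.add hflip).sub (hcomp.clm_comp hflip))).const_smul (1 / 2 : ℝ))

theorem differentiableAt_christoffel [FiniteDimensional ℝ E] (hG : IsLocalMetricOn G U)
    (hy : y ∈ U) : DifferentiableAt ℝ (localChristoffel G) y :=
  (hG.contDiffAt_christoffel hy).differentiableAt (by simp)

end IsLocalMetricOn

/-- The Ricci tensor vanishes in dimension one. -/
theorem localRicci_eq_zero_of_finrank_eq_one (hE : Module.finrank ℝ E = 1)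
    (G : E → E →L[ℝ] E →L[ℝ] ℝ) (y v w : E) : localRicci G y v w = 0 := by
  change LinearMap.trace ℝ E (localCurvature G y v w) = 0
  -- Antisymmetry of R(u,v) in u and v; on a line all vectors are multiples of one vector `a`.
  have hself : ∀ a, localCurvature G y a w a = 0 := fun a => by simp [localCurvature]
  have hsmul : ∀ (c : ℝ) (a u : E), localCurvature G y (c • a) w u =
      c • localCurvature G y a w u := fun c a u => by
    simp [localCurvature, smul_sub, smul_add]
  obtain ⟨a, -, ha⟩ := finrank_eq_one_iff'.1 hE
  have : localCurvature G y v w = 0 := by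
    ext u
    obtain ⟨c, rfl⟩ := ha u
    obtain ⟨d, rfl⟩ := ha v
    rw [map_smul, hsmul, hself]
    simp
  rw [this, map_zero]

theorem LinearMap.trace_prod_eq {A B : Type*} [AddCommGroup A] [Module ℝ A] [AddCommGroup B]
    [Module ℝ B] [FiniteDimensional ℝ A] [FiniteDimensional ℝ B] (f : A × B →ₗ[ℝ] A × B) :
    LinearMap.trace ℝ (A × B) f =
      LinearMap.trace ℝ A (LinearMap.fst ℝ A B ∘ₗ f ∘ₗ LinearMap.inl ℝ A B) +
      LinearMap.trace ℝ B (LinearMap.snd ℝ A B ∘ₗ f ∘ₗ LinearMap.inr ℝ A B) := by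
  have h : f = (f ∘ₗ LinearMap.inl ℝ A B) ∘ₗ LinearMap.fst ℝ A B +
      (f ∘ₗ LinearMap.inr ℝ A B) ∘ₗ LinearMap.snd ℝ A B := by
    refine LinearMap.ext fun x => ?_
    simp [← map_add]
  conv_lhs => rw [h]
  rw [map_add, LinearMap.trace_comp_comm', LinearMap.trace_comp_comm' (LinearMap.snd ℝ A B)]

theorem LinearMap.trace_real (f : ℝ →ₗ[ℝ] ℝ) : LinearMap.trace ℝ ℝ f = f 1 := by
  have h : f = f 1 • LinearMap.id := by ext; simp
  conv_lhs => rw [h]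
  simp

end LocalMetrics

/-! ### Christoffel symbols, Hessian and curvature of a doubly warped product -/

section WarpedForms

variable {E₁ E₂ : Type*} [NormedAddCommGroup E₁] [NormedSpace ℝ E₁] [NormedAddCommGroup E₂]
  [NormedSpace ℝ E₂]

/-- The doubly warped product `dt² ⊕ α(t)² G₁ ⊕ β(t)² G₂` on `ℝ × E₁ × E₂`. -/
noncomputable def warpedForm (α β : ℝ → ℝ) (G₁ : E₁ → E₁ →L[ℝ] E₁ →L[ℝ] ℝ)
    (G₂ : E₂ → E₂ →L[ℝ] E₂ →L[ℝ] ℝ) (y : ℝ × E₁ × E₂) :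
    (ℝ × E₁ × E₂) →L[ℝ] (ℝ × E₁ × E₂) →L[ℝ] ℝ :=
  let p₀ := ContinuousLinearMap.fst ℝ ℝ (E₁ × E₂)
  let p₁ := (ContinuousLinearMap.fst ℝ E₁ E₂).comp (ContinuousLinearMap.snd ℝ ℝ (E₁ × E₂))
  let p₂ := (ContinuousLinearMap.snd ℝ E₁ E₂).comp (ContinuousLinearMap.snd ℝ ℝ (E₁ × E₂))
  (ContinuousLinearMap.mul ℝ ℝ).bilinearComp p₀ p₀ +
    α y.1 ^ 2 • (G₁ y.2.1).bilinearComp p₁ p₁ + β y.1 ^ 2 • (G₂ y.2.2).bilinearComp p₂ p₂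

variable {α β : ℝ → ℝ} {G₁ : E₁ → E₁ →L[ℝ] E₁ →L[ℝ] ℝ} {G₂ : E₂ → E₂ →L[ℝ] E₂ →L[ℝ] ℝ}
  {U₁ : Set E₁} {U₂ : Set E₂} {y : ℝ × E₁ × E₂}

theorem warpedForm_apply (y v w : ℝ × E₁ × E₂) : warpedForm α β G₁ G₂ y v w =
    v.1 * w.1 + α y.1 ^ 2 * G₁ y.2.1 v.2.1 w.2.1 + β y.1 ^ 2 * G₂ y.2.2 v.2.2 w.2.2 := by
  simp [warpedForm]

theorem ContDiffOn.bilinearComp_const {E F V : Type*} [NormedAddCommGroup E] [NormedSpace ℝ E]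
    [NormedAddCommGroup F] [NormedSpace ℝ F] [NormedAddCommGroup V] [NormedSpace ℝ V]
    [FiniteDimensional ℝ E] {s : Set V}
    {G : V → F →L[ℝ] F →L[ℝ] ℝ} (hG : ContDiffOn ℝ ∞ G s) (p : E →L[ℝ] F) :
    ContDiffOn ℝ ∞ (fun y => (G y).bilinearComp p p) s := by
  rw [contDiffOn_clm_apply]
  intro v
  rw [contDiffOn_clm_apply]
  intro w
  exact (hG.clm_apply contDiffOn_const).clm_apply contDiffOn_const

theorem isLocalMetricOn_warpedForm [FiniteDimensional ℝ E₁] [FiniteDimensional ℝ E₂]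
    (hα : ContDiff ℝ ∞ α) (hβ : ContDiff ℝ ∞ β) (hα0 : ∀ t, α t ≠ 0) (hβ0 : ∀ t, β t ≠ 0)
    (h₁ : IsLocalMetricOn G₁ U₁) (h₂ : IsLocalMetricOn G₂ U₂) :
    IsLocalMetricOn (warpedForm α β G₁ G₂) (univ ×ˢ U₁ ×ˢ U₂) where
  isOpen := isOpen_univ.prod (h₁.isOpen.prod h₂.isOpen)
  contDiffOn := by
    have e₁ : ContDiffOn ℝ ∞ (fun y : ℝ × E₁ × E₂ => G₁ y.2.1) (univ ×ˢ U₁ ×ˢ U₂) :=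
      h₁.contDiffOn.comp (by fun_prop) fun y hy => hy.2.1
    have e₂ : ContDiffOn ℝ ∞ (fun y : ℝ × E₁ × E₂ => G₂ y.2.2) (univ ×ˢ U₁ ×ˢ U₂) :=
      h₂.contDiffOn.comp (by fun_prop) fun y hy => hy.2.2
    have a₁ : ContDiffOn ℝ ∞ (fun y : ℝ × E₁ × E₂ => α y.1 ^ 2) (univ ×ˢ U₁ ×ˢ U₂) :=
      ((hα.comp contDiff_fst).pow 2).contDiffOn
    have a₂ : ContDiffOn ℝ ∞ (fun y : ℝ × E₁ × E₂ => β y.1 ^ 2) (univ ×ˢ U₁ ×ˢ U₂) :=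
      ((hβ.comp contDiff_fst).pow 2).contDiffOn
    exact (contDiffOn_const.add (a₁.smul (e₁.bilinearComp_const _))).add
      (a₂.smul (e₂.bilinearComp_const _))
  symm y hy v w := by
    rw [warpedForm_apply, warpedForm_apply, h₁.symm _ hy.2.1, h₂.symm _ hy.2.2, mul_comm v.1]
  pos y hy v hv := by
    rw [warpedForm_apply]
    have p₁ : 0 ≤ G₁ y.2.1 v.2.1 v.2.1 := by
      by_cases h : v.2.1 = 0
      · simp [h]
      · exact (h₁.pos _ hy.2.1 _ h).le
    have p₂ : 0 ≤ G₂ y.2.2 v.2.2 v.2.2 := by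
      by_cases h : v.2.2 = 0
      · simp [h]
      · exact (h₂.pos _ hy.2.2 _ h).le
    have a := pow_pos (abs_pos.2 (hα0 y.1)) 2
    have b := pow_pos (abs_pos.2 (hβ0 y.1)) 2
    rw [sq_abs] at a b
    have c := mul_self_nonneg v.1
    by_cases k₁ : v.2.1 = 0
    · by_cases k₂ : v.2.2 = 0
      · have : v.1 ≠ 0 := fun k => hv (Prod.ext k (Prod.ext k₁ k₂))
        have := mul_self_pos.2 this
        positivity
      · have := h₂.pos _ hy.2.2 _ k₂
        positivity
    · have := h₁.pos _ hy.2.1 _ k₁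
      positivity

theorem hasDerivAt_comp_add_smul {f : ℝ → ℝ} {t : ℝ} (hf : DifferentiableAt ℝ f t) (τ : ℝ) :
    HasDerivAt (fun s : ℝ => f (t + s * τ)) (deriv f t * τ) 0 := by
  have h1 : HasDerivAt (fun s : ℝ => t + s * τ) τ 0 := by
    simpa using ((hasDerivAt_id (0 : ℝ)).mul_const τ).const_add t
  have h2 : HasDerivAt f (deriv f t) (t + 0 * τ) := by simpa using hf.hasDerivAt
  exact h2.comp (0 : ℝ) h1

section

variable [FiniteDimensional ℝ E₁] [FiniteDimensional ℝ E₂]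

theorem fderiv_warpedForm
    (hα : ContDiff ℝ ∞ α) (hβ : ContDiff ℝ ∞ β) (hα0 : ∀ t, α t ≠ 0) (hβ0 : ∀ t, β t ≠ 0)
    (h₁ : IsLocalMetricOn G₁ U₁) (h₂ : IsLocalMetricOn G₂ U₂) (hy : y ∈ univ ×ˢ U₁ ×ˢ U₂)
    (u v w : ℝ × E₁ × E₂) :
    fderiv ℝ (warpedForm α β G₁ G₂) y u v w =
      2 * α y.1 * (deriv α y.1 * u.1) * G₁ y.2.1 v.2.1 w.2.1 +
      α y.1 ^ 2 * fderiv ℝ G₁ y.2.1 u.2.1 v.2.1 w.2.1 +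
      (2 * β y.1 * (deriv β y.1 * u.1) * G₂ y.2.2 v.2.2 w.2.2 +
      β y.1 ^ 2 * fderiv ℝ G₂ y.2.2 u.2.2 v.2.2 w.2.2) := by
  have hW := isLocalMetricOn_warpedForm hα hβ hα0 hβ0 h₁ h₂
  have l : HasDerivAt _ _ _ := HasLineDerivAt.clm_apply_apply (hW.differentiableAt hy) u v w
  have l₁ : HasDerivAt _ _ _ :=
    HasLineDerivAt.clm_apply_apply (h₁.differentiableAt hy.2.1) u.2.1 v.2.1 w.2.1
  have l₂ : HasDerivAt _ _ _ :=
    HasLineDerivAt.clm_apply_apply (h₂.differentiableAt hy.2.2) u.2.2 v.2.2 w.2.2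
  have a := (hasDerivAt_comp_add_smul (hα.differentiable (by simp) y.1) u.1).pow 2
  have b := (hasDerivAt_comp_add_smul (hβ.differentiable (by simp) y.1) u.1).pow 2
  refine l.unique ?_
  simp only [warpedForm_apply]
  refine (((hasDerivAt_const _ (v.1 * w.1)).add (a.mul l₁)).add (b.mul l₂)).congr_deriv ?_
  simp

/-- The metric is definite, so it suffices to pair both sides with an arbitrary vector and compare
with the Koszul formula. -/
theorem localChristoffel_warpedForm
    (hα : ContDiff ℝ ∞ α) (hβ : ContDiff ℝ ∞ β) (hα0 : ∀ t, α t ≠ 0) (hβ0 : ∀ t, β t ≠ 0)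
    (h₁ : IsLocalMetricOn G₁ U₁) (h₂ : IsLocalMetricOn G₂ U₂) (hy : y ∈ univ ×ˢ U₁ ×ˢ U₂)
    (u v : ℝ × E₁ × E₂) :
    localChristoffel (warpedForm α β G₁ G₂) y u v =
      (-(α y.1 * deriv α y.1 * G₁ y.2.1 u.2.1 v.2.1 + β y.1 * deriv β y.1 * G₂ y.2.2 u.2.2 v.2.2),
        (deriv α y.1 / α y.1) • (u.1 • v.2.1 + v.1 • u.2.1) +
          localChristoffel G₁ y.2.1 u.2.1 v.2.1,
        (deriv β y.1 / β y.1) • (u.1 • v.2.2 + v.1 • u.2.2) +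
          localChristoffel G₂ y.2.2 u.2.2 v.2.2) := by
  have hW := isLocalMetricOn_warpedForm hα hβ hα0 hβ0 h₁ h₂
  refine hW.eq_of_forall hy fun w => ?_
  rw [hW.christoffel_spec hy]
  simp only [fderiv_warpedForm hα hβ hα0 hβ0 h₁ h₂ hy, warpedForm_apply, map_add, map_smul,
    add_apply, smul_apply, smul_eq_mul, h₁.christoffel_spec hy.2.1, h₂.christoffel_spec hy.2.2]
  have := hα0 y.1
  have := hβ0 y.1
  field_simp
  ring

theorem fderiv_localChristoffel_warpedForm
    (hα : ContDiff ℝ ∞ α) (hβ : ContDiff ℝ ∞ β) (hα0 : ∀ t, α t ≠ 0) (hβ0 : ∀ t, β t ≠ 0)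
    (h₁ : IsLocalMetricOn G₁ U₁) (h₂ : IsLocalMetricOn G₂ U₂) (hy : y ∈ univ ×ˢ U₁ ×ˢ U₂)
    (u v w : ℝ × E₁ × E₂) :
    fderiv ℝ (localChristoffel (warpedForm α β G₁ G₂)) y u v w =
      (-(((deriv α y.1 ^ 2 + α y.1 * deriv (deriv α) y.1) * u.1 * G₁ y.2.1 v.2.1 w.2.1 +
          α y.1 * deriv α y.1 * fderiv ℝ G₁ y.2.1 u.2.1 v.2.1 w.2.1) +
        ((deriv β y.1 ^ 2 + β y.1 * deriv (deriv β) y.1) * u.1 * G₂ y.2.2 v.2.2 w.2.2 +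
          β y.1 * deriv β y.1 * fderiv ℝ G₂ y.2.2 u.2.2 v.2.2 w.2.2)),
        ((deriv (deriv α) y.1 / α y.1 - (deriv α y.1 / α y.1) ^ 2) * u.1) •
          (v.1 • w.2.1 + w.1 • v.2.1) +
          fderiv ℝ (localChristoffel G₁) y.2.1 u.2.1 v.2.1 w.2.1,
        ((deriv (deriv β) y.1 / β y.1 - (deriv β y.1 / β y.1) ^ 2) * u.1) •
          (v.1 • w.2.2 + w.1 • v.2.2) +
          fderiv ℝ (localChristoffel G₂) y.2.2 u.2.2 v.2.2 w.2.2) := by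
  have hW := isLocalMetricOn_warpedForm hα hβ hα0 hβ0 h₁ h₂
  have l := HasLineDerivAt.clm_apply_apply (hW.differentiableAt_christoffel hy) u v w
  have l₁ : HasDerivAt _ _ _ :=
    HasLineDerivAt.clm_apply_apply (h₁.differentiableAt hy.2.1) u.2.1 v.2.1 w.2.1
  have l₂ : HasDerivAt _ _ _ :=
    HasLineDerivAt.clm_apply_apply (h₂.differentiableAt hy.2.2) u.2.2 v.2.2 w.2.2
  have c₁ : HasDerivAt _ _ _ :=
    HasLineDerivAt.clm_apply_apply (h₁.differentiableAt_christoffel hy.2.1) u.2.1 v.2.1 w.2.1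
  have c₂ : HasDerivAt _ _ _ :=
    HasLineDerivAt.clm_apply_apply (h₂.differentiableAt_christoffel hy.2.2) u.2.2 v.2.2 w.2.2
  have a := hasDerivAt_comp_add_smul (hα.differentiable (by simp) y.1) u.1
  have b := hasDerivAt_comp_add_smul (hβ.differentiable (by simp) y.1) u.1
  have a' := hasDerivAt_comp_add_smul
    ((contDiff_infty_iff_deriv.1 hα).2.differentiable (by simp) y.1) u.1
  have b' := hasDerivAt_comp_add_smul
    ((contDiff_infty_iff_deriv.1 hβ).2.differentiable (by simp) y.1) u.1
  -- The closed formula holds on an open set, so it may be differentiated.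
  have hloc : (fun z => localChristoffel (warpedForm α β G₁ G₂) z v w) =ᶠ[𝓝 y] _ :=
    Filter.eventually_of_mem (hW.isOpen.mem_nhds hy) fun z hz =>
      localChristoffel_warpedForm hα hβ hα0 hβ0 h₁ h₂ hz v w
  have l' : HasDerivAt _ _ _ := l.congr_of_eventuallyEq hloc.symm
  refine l'.unique ?_
  refine (HasDerivAt.prodMk (((a.mul a').mul l₁).add ((b.mul b').mul l₂)).neg
    (HasDerivAt.prodMk
      (((a'.div a (by simpa using hα0 y.1)).smul_const (v.1 • w.2.1 + w.1 • v.2.1)).add c₁)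
      (((b'.div b (by simpa using hβ0 y.1)).smul_const
        (v.1 • w.2.2 + w.1 • v.2.2)).add c₂))).congr_deriv ?_
  have := hα0 y.1
  have := hβ0 y.1
  refine Prod.ext ?_ (Prod.ext ?_ ?_)
  · simp
    ring
  · simp only [zero_mul, add_zero]
    congr 2
    field_simp
  · simp only [zero_mul, add_zero]
    congr 2
    field_simp

theorem localHessian_warpedForm {f : ℝ → ℝ} (hf : ContDiff ℝ ∞ f)
    (hα : ContDiff ℝ ∞ α) (hβ : ContDiff ℝ ∞ β) (hα0 : ∀ t, α t ≠ 0) (hβ0 : ∀ t, β t ≠ 0)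
    (h₁ : IsLocalMetricOn G₁ U₁) (h₂ : IsLocalMetricOn G₂ U₂) (hy : y ∈ univ ×ˢ U₁ ×ˢ U₂)
    (u v : ℝ × E₁ × E₂) :
    localHessian (warpedForm α β G₁ G₂) (fun z => f z.1) y u v =
      deriv (deriv f) y.1 * (u.1 * v.1) +
        deriv f y.1 * (α y.1 * deriv α y.1 * G₁ y.2.1 u.2.1 v.2.1 +
          β y.1 * deriv β y.1 * G₂ y.2.2 u.2.2 v.2.2) := by
  have hF : ∀ z w : ℝ × E₁ × E₂, fderiv ℝ (fun z : ℝ × E₁ × E₂ => f z.1) z w =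
      deriv f z.1 * w.1 := fun z w => by
    have h : HasFDerivAt (fun z : ℝ × E₁ × E₂ => f z.1) _ z :=
      (hf.differentiable (by simp) z.1).hasDerivAt.hasFDerivAt.comp z
        (hasFDerivAt_fst (𝕜 := ℝ) (p := z))
    rw [h.fderiv]
    simp [mul_comm]
  have hs : ContDiff ℝ ∞ (fderiv ℝ (fun z : ℝ × E₁ × E₂ => f z.1)) :=
    (hf.comp contDiff_fst).fderiv_right (m := ∞) (by simp)
  have h2 : fderiv ℝ (fderiv ℝ (fun z : ℝ × E₁ × E₂ => f z.1)) y u v =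
      deriv (deriv f) y.1 * u.1 * v.1 := by
    have l : HasDerivAt (fun s : ℝ => fderiv ℝ (fun z : ℝ × E₁ × E₂ => f z.1) (y + s • u)) _ 0 :=
      (hs.differentiable (by simp) y).hasFDerivAt.hasLineDerivAt u
    have l' := l.clm_apply (hasDerivAt_const (0 : ℝ) v)
    simp only [hF] at l'
    have r := (hasDerivAt_comp_add_smul
      ((contDiff_infty_iff_deriv.1 hf).2.differentiable (by simp) y.1) u.1).mul_const v.1
    simpa using l'.unique r
  rw [localHessian, h2, hF, localChristoffel_warpedForm hα hβ hα0 hβ0 h₁ h₂ hy]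
  ring

/-- The Ricci tensor is a trace over ℝ × E₁ × E₂, so only the three diagonal blocks of u ↦ R(u,v)w
are needed. This is the first; the next two lemmas give the others. -/
theorem localCurvature_warpedForm_fst
    (hα : ContDiff ℝ ∞ α) (hβ : ContDiff ℝ ∞ β) (hα0 : ∀ t, α t ≠ 0) (hβ0 : ∀ t, β t ≠ 0)
    (h₁ : IsLocalMetricOn G₁ U₁) (h₂ : IsLocalMetricOn G₂ U₂) (hy : y ∈ univ ×ˢ U₁ ×ˢ U₂)
    (v w : ℝ × E₁ × E₂) :
    (localCurvature (warpedForm α β G₁ G₂) y v w (1, 0)).1 =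
      -(α y.1 * deriv (deriv α) y.1 * G₁ y.2.1 v.2.1 w.2.1 +
        β y.1 * deriv (deriv β) y.1 * G₂ y.2.2 v.2.2 w.2.2) := by
  have := hα0 y.1
  have := hβ0 y.1
  simp [localCurvature, fderiv_localChristoffel_warpedForm hα hβ hα0 hβ0 h₁ h₂ hy,
    localChristoffel_warpedForm hα hβ hα0 hβ0 h₁ h₂ hy]
  field_simp
  ring

theorem localCurvature_warpedForm_snd_fst
    (hα : ContDiff ℝ ∞ α) (hβ : ContDiff ℝ ∞ β) (hα0 : ∀ t, α t ≠ 0) (hβ0 : ∀ t, β t ≠ 0)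
    (h₁ : IsLocalMetricOn G₁ U₁) (h₂ : IsLocalMetricOn G₂ U₂) (hy : y ∈ univ ×ˢ U₁ ×ˢ U₂)
    (v w : ℝ × E₁ × E₂) (a : E₁) :
    (localCurvature (warpedForm α β G₁ G₂) y v w (0, a, 0)).2.1 =
      localCurvature G₁ y.2.1 v.2.1 w.2.1 a -
        (deriv (deriv α) y.1 / α y.1 * (v.1 * w.1) + deriv α y.1 ^ 2 * G₁ y.2.1 v.2.1 w.2.1 +
          deriv α y.1 / α y.1 * (β y.1 * deriv β y.1) * G₂ y.2.2 v.2.2 w.2.2) • a +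
        (deriv α y.1 ^ 2 * G₁ y.2.1 a w.2.1) • v.2.1 := by
  have := hα0 y.1
  have := hβ0 y.1
  have e : deriv α y.1 / α y.1 * (α y.1 * deriv α y.1) = deriv α y.1 ^ 2 := by
    field_simp
  simp [localCurvature, fderiv_localChristoffel_warpedForm hα hβ hα0 hβ0 h₁ h₂ hy,
    localChristoffel_warpedForm hα hβ hα0 hβ0 h₁ h₂ hy, h₁.christoffel_symm hy.2.1 v.2.1 a, ← e]
  module

theorem localCurvature_warpedForm_snd_snd
    (hα : ContDiff ℝ ∞ α) (hβ : ContDiff ℝ ∞ β) (hα0 : ∀ t, α t ≠ 0) (hβ0 : ∀ t, β t ≠ 0)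
    (h₁ : IsLocalMetricOn G₁ U₁) (h₂ : IsLocalMetricOn G₂ U₂) (hy : y ∈ univ ×ˢ U₁ ×ˢ U₂)
    (v w : ℝ × E₁ × E₂) (a : E₂) :
    (localCurvature (warpedForm α β G₁ G₂) y v w (0, 0, a)).2.2 =
      localCurvature G₂ y.2.2 v.2.2 w.2.2 a -
        (deriv (deriv β) y.1 / β y.1 * (v.1 * w.1) + deriv β y.1 ^ 2 * G₂ y.2.2 v.2.2 w.2.2 +
          deriv β y.1 / β y.1 * (α y.1 * deriv α y.1) * G₁ y.2.1 v.2.1 w.2.1) • a +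
        (deriv β y.1 ^ 2 * G₂ y.2.2 a w.2.2) • v.2.2 := by
  have := hα0 y.1
  have := hβ0 y.1
  have e : deriv β y.1 / β y.1 * (β y.1 * deriv β y.1) = deriv β y.1 ^ 2 := by
    field_simp
  simp [localCurvature, fderiv_localChristoffel_warpedForm hα hβ hα0 hβ0 h₁ h₂ hy,
    localChristoffel_warpedForm hα hβ hα0 hβ0 h₁ h₂ hy, h₂.christoffel_symm hy.2.2 v.2.2 a, ← e]
  module

end

end WarpedForms

/-! ### Ricci tensor, divergence and scalar curvature of a doubly warped product -/

section WarpedRicci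

variable {E₁ E₂ : Type*} [NormedAddCommGroup E₁] [NormedSpace ℝ E₁] [NormedAddCommGroup E₂]
  [NormedSpace ℝ E₂] [FiniteDimensional ℝ E₁] [FiniteDimensional ℝ E₂]
  {α β : ℝ → ℝ} {G₁ : E₁ → E₁ →L[ℝ] E₁ →L[ℝ] ℝ} {G₂ : E₂ → E₂ →L[ℝ] E₂ →L[ℝ] ℝ}
  {U₁ : Set E₁} {U₂ : Set E₂} {y : ℝ × E₁ × E₂}

/-- The trace is the sum over the diagonal blocks. In a block of dimension d the multiple of the
identity contributes d times its coefficient, and the rank-one term gives back one copy of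
α'²G₁(v,w) (or β'²G₂(v,w)); this is the origin of the factors d - 1. -/
theorem localRicci_warpedForm
    (hα : ContDiff ℝ ∞ α) (hβ : ContDiff ℝ ∞ β) (hα0 : ∀ t, α t ≠ 0) (hβ0 : ∀ t, β t ≠ 0)
    (h₁ : IsLocalMetricOn G₁ U₁) (h₂ : IsLocalMetricOn G₂ U₂) (hy : y ∈ univ ×ˢ U₁ ×ˢ U₂)
    (v w : ℝ × E₁ × E₂) :
    localRicci (warpedForm α β G₁ G₂) y v w =
      -(Module.finrank ℝ E₁ * (deriv (deriv α) y.1 / α y.1) +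
        Module.finrank ℝ E₂ * (deriv (deriv β) y.1 / β y.1)) * (v.1 * w.1) +
      (localRicci G₁ y.2.1 v.2.1 w.2.1 -
        (α y.1 * deriv (deriv α) y.1 + (Module.finrank ℝ E₁ - 1) * deriv α y.1 ^ 2 +
          Module.finrank ℝ E₂ * (α y.1 * deriv α y.1 * (deriv β y.1 / β y.1))) *
            G₁ y.2.1 v.2.1 w.2.1) +
      (localRicci G₂ y.2.2 v.2.2 w.2.2 -
        (β y.1 * deriv (deriv β) y.1 + (Module.finrank ℝ E₂ - 1) * deriv β y.1 ^ 2 +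
          Module.finrank ℝ E₁ * (β y.1 * deriv β y.1 * (deriv α y.1 / α y.1))) *
            G₂ y.2.2 v.2.2 w.2.2) := by
  change LinearMap.trace ℝ _ (localCurvature (warpedForm α β G₁ G₂) y v w) = _
  rw [LinearMap.trace_prod_eq, LinearMap.trace_real, LinearMap.trace_prod_eq]
  have t₁ : LinearMap.fst ℝ E₁ E₂ ∘ₗ (LinearMap.snd ℝ ℝ (E₁ × E₂) ∘ₗ
      localCurvature (warpedForm α β G₁ G₂) y v w ∘ₗ LinearMap.inr ℝ ℝ (E₁ × E₂)) ∘ₗ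
        LinearMap.inl ℝ E₁ E₂ = localCurvature G₁ y.2.1 v.2.1 w.2.1 -
        (deriv (deriv α) y.1 / α y.1 * (v.1 * w.1) + deriv α y.1 ^ 2 * G₁ y.2.1 v.2.1 w.2.1 +
          deriv α y.1 / α y.1 * (β y.1 * deriv β y.1) * G₂ y.2.2 v.2.2 w.2.2) • LinearMap.id +
        deriv α y.1 ^ 2 • ((G₁ y.2.1).flip w.2.1 : E₁ →ₗ[ℝ] ℝ).smulRight v.2.1 := by
    refine LinearMap.ext fun a => ?_
    simpa [mul_smul] using localCurvature_warpedForm_snd_fst hα hβ hα0 hβ0 h₁ h₂ hy v w a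
  have t₂ : LinearMap.snd ℝ E₁ E₂ ∘ₗ (LinearMap.snd ℝ ℝ (E₁ × E₂) ∘ₗ
      localCurvature (warpedForm α β G₁ G₂) y v w ∘ₗ LinearMap.inr ℝ ℝ (E₁ × E₂)) ∘ₗ
        LinearMap.inr ℝ E₁ E₂ = localCurvature G₂ y.2.2 v.2.2 w.2.2 -
        (deriv (deriv β) y.1 / β y.1 * (v.1 * w.1) + deriv β y.1 ^ 2 * G₂ y.2.2 v.2.2 w.2.2 +
          deriv β y.1 / β y.1 * (α y.1 * deriv α y.1) * G₁ y.2.1 v.2.1 w.2.1) • LinearMap.id +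
        deriv β y.1 ^ 2 • ((G₂ y.2.2).flip w.2.2 : E₂ →ₗ[ℝ] ℝ).smulRight v.2.2 := by
    refine LinearMap.ext fun a => ?_
    simpa [mul_smul] using localCurvature_warpedForm_snd_snd hα hβ hα0 hβ0 h₁ h₂ hy v w a
  have t₀ := localCurvature_warpedForm_fst hα hβ hα0 hβ0 h₁ h₂ hy v w
  rw [t₁, t₂]
  simp only [map_add, map_sub, map_smul, LinearMap.trace_smulRight, LinearMap.trace_id]
  have e : (LinearMap.fst ℝ ℝ (E₁ × E₂) ∘ₗ localCurvature (warpedForm α β G₁ G₂) y v w ∘ₗ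
      LinearMap.inl ℝ ℝ (E₁ × E₂)) 1 =
      (localCurvature (warpedForm α β G₁ G₂) y v w (1, 0)).1 := rfl
  rw [e, t₀]
  change _ + (LinearMap.trace ℝ E₁ (localCurvature G₁ y.2.1 v.2.1 w.2.1) - _ + _ +
    (LinearMap.trace ℝ E₂ (localCurvature G₂ y.2.2 v.2.2 w.2.2) - _ + _)) = _ +
    (LinearMap.trace ℝ E₁ (localCurvature G₁ y.2.1 v.2.1 w.2.1) - _) +
    (LinearMap.trace ℝ E₂ (localCurvature G₂ y.2.2 v.2.2 w.2.2) - _)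
  have := hα0 y.1
  have := hβ0 y.1
  simp
  field_simp
  ring

/-- ∇∂_t is diagonal, with eigenvalues 0, α'/α and β'/β on the three factors. -/
theorem localDivergence_warpedForm
    (hα : ContDiff ℝ ∞ α) (hβ : ContDiff ℝ ∞ β) (hα0 : ∀ t, α t ≠ 0) (hβ0 : ∀ t, β t ≠ 0)
    (h₁ : IsLocalMetricOn G₁ U₁) (h₂ : IsLocalMetricOn G₂ U₂) (hy : y ∈ univ ×ˢ U₁ ×ˢ U₂)
    {X : ℝ × E₁ × E₂ → ℝ × E₁ × E₂} (hX : X =ᶠ[𝓝 y] fun _ => (1, 0)) :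
    localDivergence (warpedForm α β G₁ G₂) X y =
      Module.finrank ℝ E₁ * (deriv α y.1 / α y.1) +
        Module.finrank ℝ E₂ * (deriv β y.1 / β y.1) := by
  have h : ((fderiv ℝ X y + (localChristoffel (warpedForm α β G₁ G₂) y).flip (X y) :
      (ℝ × E₁ × E₂) →L[ℝ] ℝ × E₁ × E₂) : (ℝ × E₁ × E₂) →ₗ[ℝ] ℝ × E₁ × E₂) =
      LinearMap.prodMap 0 (LinearMap.prodMap ((deriv α y.1 / α y.1) • LinearMap.id)
        ((deriv β y.1 / β y.1) • LinearMap.id)) := by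
    refine LinearMap.ext fun u => ?_
    rw [hX.fderiv_eq, hX.self_of_nhds]
    simp [localChristoffel_warpedForm hα hβ hα0 hβ0 h₁ h₂ hy]
  rw [localDivergence, h]
  simp [LinearMap.trace_prodMap', mul_comm]

theorem localScalar_eq_of_localRicci {E : Type*} [NormedAddCommGroup E] [NormedSpace ℝ E]
    [FiniteDimensional ℝ E] {G : E → E →L[ℝ] E →L[ℝ] ℝ} {y : E} (hG : (G y).IsInvertible)
    (A : E →ₗ[ℝ] E) (hA : ∀ v w, localRicci G y v w = G y (A v) w) :
    localScalar G y = LinearMap.trace ℝ E A := by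
  obtain ⟨e, he⟩ := hG
  rw [localScalar]
  congr 1
  refine LinearMap.ext fun v => ?_
  have : (LinearMap.toContinuousLinearMap : (E →ₗ[ℝ] ℝ) ≃ₗ[ℝ] (E →L[ℝ] ℝ))
      (localRicci G y v) = G y (A v) := by
    ext w
    exact hA v w
  simp [this, ← he]

end WarpedRicci

/-! ### Metrics on manifolds read in charts -/

section ManifoldMetrics

open Bundle

variable {E H M : Type*} [NormedAddCommGroup E] [NormedSpace ℝ E] [TopologicalSpace H]
  {I : ModelWithCorners ℝ E H} [TopologicalSpace M] [ChartedSpace H M] [IsManifold I ∞ M]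

/-- A field of bilinear forms on the tangent spaces, read in the preferred chart at `x₀`. -/
noncomputable def formInChart (I : ModelWithCorners ℝ E H)
    (B : (x : M) → TangentSpace I x →L[ℝ] TangentSpace I x →L[ℝ] ℝ)
    (x₀ : M) (y : E) : E →L[ℝ] E →L[ℝ] ℝ :=
  let A : E →L[ℝ] E := mfderiv 𝓘(ℝ, E) I (extChartAt I x₀).symm y
  let C : E →L[ℝ] E →L[ℝ] ℝ := B ((extChartAt I x₀).symm y)
  C.bilinearComp A A

theorem formInChart_apply (B : (x : M) → TangentSpace I x →L[ℝ] TangentSpace I x →L[ℝ] ℝ)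
    (x₀ : M) (y v w : E) : formInChart I B x₀ y v w =
      B ((extChartAt I x₀).symm y) (mfderiv 𝓘(ℝ, E) I (extChartAt I x₀).symm y v)
        (mfderiv 𝓘(ℝ, E) I (extChartAt I x₀).symm y w) := rfl

theorem SmoothMetric.inChart_eq_formInChart (g : SmoothMetric I M) (x₀ : M) :
    g.inChart x₀ = formInChart I g.inner x₀ := rfl

theorem inCoordinates_eq_formInChart [I.Boundaryless]
    (B : (x : M) → TangentSpace I x →L[ℝ] TangentSpace I x →L[ℝ] ℝ)
    {x₀ x : M} (hx : x ∈ (chartAt H x₀).source) :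
    ContinuousLinearMap.inCoordinates E (TangentSpace I) (E →L[ℝ] ℝ)
      (fun x : M => TangentSpace I x →L[ℝ] ℝ) x₀ x x₀ x (B x) =
      formInChart I B x₀ (extChartAt I x₀ x) := by
  have hx' : x ∈ (extChartAt I x₀).source := by rwa [extChartAt_source]
  ext v w
  have hs := TangentBundle.symmL_trivializationAt (I := I) hx
  rw [I.range_eq_univ, mfderivWithin_univ] at hs
  have h2 : ∀ L : TangentSpace I x →L[ℝ] ℝ, (trivializationAt (E →L[ℝ] ℝ)
      (fun x : M => TangentSpace I x →L[ℝ] ℝ) x₀).continuousLinearMapAt ℝ x L w =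
      L ((trivializationAt E (TangentSpace I) x₀).symmL ℝ x w) := by
    intro L
    rw [Trivialization.continuousLinearMapAt_apply_of_mem]
    · simp [hom_trivializationAt_apply, ContinuousLinearMap.inCoordinates]
    · simpa using hx
  change (trivializationAt (E →L[ℝ] ℝ)
      (fun x : M => TangentSpace I x →L[ℝ] ℝ) x₀).continuousLinearMapAt ℝ x
      (B x ((trivializationAt E (TangentSpace I) x₀).symmL ℝ x v)) w = _
  rw [h2, hs, formInChart_apply, (extChartAt I x₀).left_inv hx']
  rfl

/-- Used in both directions: to see that a given metric is smooth in coordinates, and to build a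
metric from its coordinate expressions. -/
theorem contMDiff_iff_contDiffOn_formInChart [I.Boundaryless]
    (B : (x : M) → TangentSpace I x →L[ℝ] TangentSpace I x →L[ℝ] ℝ) :
    ContMDiff I (I.prod 𝓘(ℝ, E →L[ℝ] E →L[ℝ] ℝ)) ∞
      (fun x => TotalSpace.mk' (E →L[ℝ] E →L[ℝ] ℝ)
        (E := fun x : M => TangentSpace I x →L[ℝ] TangentSpace I x →L[ℝ] ℝ) x (B x)) ↔
      ∀ x₀ : M, ContDiffOn ℝ ∞ (formInChart I B x₀) (extChartAt I x₀).target := by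
  have key : ∀ x₀ : M, ContMDiffOn I (I.prod 𝓘(ℝ, E →L[ℝ] E →L[ℝ] ℝ)) ∞
      (fun x => TotalSpace.mk' (E →L[ℝ] E →L[ℝ] ℝ)
        (E := fun x : M => TangentSpace I x →L[ℝ] TangentSpace I x →L[ℝ] ℝ) x (B x))
      (chartAt H x₀).source ↔ ContMDiffOn I 𝓘(ℝ, E →L[ℝ] E →L[ℝ] ℝ) ∞
        (fun x => formInChart I B x₀ (extChartAt I x₀ x)) (chartAt H x₀).source := by
    intro x₀
    rw [(trivializationAt (E →L[ℝ] E →L[ℝ] ℝ)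
      (fun x : M => TangentSpace I x →L[ℝ] TangentSpace I x →L[ℝ] ℝ) x₀).contMDiffOn_iff]
    · refine (and_iff_right contMDiffOn_id).trans (contMDiffOn_congr fun x hx => ?_)
      exact inCoordinates_eq_formInChart B hx
    · intro x hx
      simpa using hx
  constructor
  · intro h x₀
    have h1 := ((key x₀).1 h.contMDiffOn).comp (contMDiffOn_extChartAt_symm x₀)
      fun y hy => by simpa using (extChartAt I x₀).map_target hy
    refine (contMDiffOn_iff_contDiffOn.1 h1).congr fun y hy => ?_
    simp only [Function.comp_apply, (extChartAt I x₀).right_inv hy]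
  · intro h x
    have h1 : ContMDiffOn I 𝓘(ℝ, E →L[ℝ] E →L[ℝ] ℝ) ∞
        (fun z => formInChart I B x (extChartAt I x z)) (chartAt H x).source :=
      (h x).contMDiffOn.comp contMDiffOn_extChartAt fun z hz =>
        (extChartAt I x).map_source (by simpa using hz)
    exact ((key x).2 h1).contMDiffAt
      ((chartAt H x).open_source.mem_nhds (mem_chart_source H x))

/-- On the compact unit sphere the form has a positive minimum. -/
theorem isVonNBounded_setOf_lt_one_of_pos [FiniteDimensional ℝ E] (B : E →L[ℝ] E →L[ℝ] ℝ)
    (hB : ∀ v, v ≠ 0 → 0 < B v v) : Bornology.IsVonNBounded ℝ {v : E | B v v < 1} := by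
  rw [NormedSpace.isVonNBounded_iff]
  rcases (Metric.sphere (0 : E) 1).eq_empty_or_nonempty with he | hne
  · have : ∀ v : E, v = 0 := fun v => by
      by_contra hv
      have : (‖v‖⁻¹ • v) ∈ Metric.sphere (0 : E) 1 := by
        simp [norm_smul, inv_mul_cancel₀ (norm_ne_zero_iff.2 hv)]
      rw [he] at this
      exact this
    exact (Set.finite_singleton (0 : E)).isBounded.subset fun v _ => this v
  · have hc : Continuous fun v : E => B v v := by fun_prop
    obtain ⟨v₀, hv₀, hmin⟩ := (isCompact_sphere (0 : E) 1).exists_isMinOn hne hc.continuousOn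
    have hv₀' : v₀ ≠ 0 := by
      rintro rfl
      simp at hv₀
    have hpos := hB v₀ hv₀'
    -- With c the minimum on the sphere, ‖v‖² ≤ 1/c, and the cruder radius 1 + 1/c avoids a square
    -- root since x ≤ 1 + x².
    refine Metric.isBounded_iff_subset_closedBall (0 : E) |>.2 ⟨1 + (B v₀ v₀)⁻¹, fun v hv => ?_⟩
    rw [mem_closedBall_zero_iff]
    by_cases h0 : v = 0
    · simp [h0]
      positivity
    have hn := norm_pos_iff.2 h0
    have h1 : B v₀ v₀ ≤ B (‖v‖⁻¹ • v) (‖v‖⁻¹ • v) := hmin (by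
      simp [norm_smul, inv_mul_cancel₀ hn.ne'])
    have h2 : B v₀ v₀ * ‖v‖ ^ 2 ≤ 1 := by
      have h3 : B (‖v‖⁻¹ • v) (‖v‖⁻¹ • v) = B v v / ‖v‖ ^ 2 := by
        simp
        field_simp
      rw [h3, le_div_iff₀ (by positivity)] at h1
      exact h1.trans (le_of_lt hv)
    have h4 : ‖v‖ ^ 2 ≤ (B v₀ v₀)⁻¹ := by
      rw [← one_div, le_div_iff₀ hpos]
      linarith
    nlinarith [sq_nonneg (‖v‖ - 1)]

/-- A smooth metric from a field of inner products which is smooth in the preferred charts. -/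
noncomputable def SmoothMetric.ofFormInChart [FiniteDimensional ℝ E] [I.Boundaryless]
    (B : (x : M) → TangentSpace I x →L[ℝ] TangentSpace I x →L[ℝ] ℝ)
    (symm : ∀ x v w, B x v w = B x w v) (pos : ∀ x v, v ≠ 0 → 0 < B x v v)
    (smooth : ∀ x₀ : M, ContDiffOn ℝ ∞ (formInChart I B x₀) (extChartAt I x₀).target) :
    SmoothMetric I M where
  inner := B
  symm := symm
  pos := pos
  isVonNBounded x := isVonNBounded_setOf_lt_one_of_pos (E := E) (B x) (pos x)
  contMDiff := (contMDiff_iff_contDiffOn_formInChart B).2 smooth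

theorem injective_mfderiv_extChartAt_symm [I.Boundaryless] {x₀ : M} {y : E}
    (hy : y ∈ (extChartAt I x₀).target) :
    Function.Injective (mfderiv 𝓘(ℝ, E) I (extChartAt I x₀).symm y) := by
  have h : (mfderivWithin 𝓘(ℝ, E) I (extChartAt I x₀).symm (range I) y).IsInvertible :=
    isInvertible_mfderivWithin_extChartAt_symm hy
  rw [I.range_eq_univ, mfderivWithin_univ] at h
  exact h.injective

theorem chartDeriv_self (x : M) (X : TangentSpace I x) : SmoothMetric.chartDeriv I x x X = X := by
  rw [SmoothMetric.chartDeriv, mfderiv_extChartAt_self]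
  rfl

theorem chartDeriv_mfderiv_symm [I.Boundaryless] {x₀ : M} {y : E}
    (hy : y ∈ (extChartAt I x₀).target) (v : E) :
    SmoothMetric.chartDeriv I x₀ ((extChartAt I x₀).symm y)
      (mfderiv 𝓘(ℝ, E) I (extChartAt I x₀).symm y v) = v := by
  have h := mfderiv_extChartAt_comp_mfderivWithin_extChartAt_symm (I := I) hy
  rw [I.range_eq_univ, mfderivWithin_univ] at h
  exact DFunLike.congr_fun h v

theorem mfderiv_extChartAt_symm_self [I.Boundaryless] (x : M) (v : E) :
    mfderiv 𝓘(ℝ, E) I (extChartAt I x).symm (extChartAt I x x) v = (v : E) := by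
  have h := mfderivWithin_range_extChartAt_symm (I := I) (x := x)
  rw [I.range_eq_univ, mfderivWithin_univ] at h
  exact DFunLike.congr_fun h v

theorem formInChart_self [I.Boundaryless]
    (B : (x : M) → TangentSpace I x →L[ℝ] TangentSpace I x →L[ℝ] ℝ)
    (x : M) (X Y : E) : formInChart I B x (extChartAt I x x) X Y =
      (B x : E →L[ℝ] E →L[ℝ] ℝ) X Y := by
  have h : ∀ p (hp : p = x), ∀ X Y : E, B p (X : E) (Y : E) = B x (X : E) (Y : E) := by
    rintro p rfl X Y
    rfl
  refine (h _ ((extChartAt I x).left_inv (mem_extChartAt_source x)) _ _).trans ?_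
  exact congrArg₂ (fun a b : E => B x a b) (mfderiv_extChartAt_symm_self x X)
    (mfderiv_extChartAt_symm_self x Y)

theorem SmoothMetric.inChart_self [I.Boundaryless] (g : SmoothMetric I M) (x : M)
    (X Y : E) : g.inChart x (extChartAt I x x) X Y =
      (g.inner x : E →L[ℝ] E →L[ℝ] ℝ) X Y :=
  formInChart_self g.inner x X Y

theorem SmoothMetric.isLocalMetricOn_inChart [I.Boundaryless] (g : SmoothMetric I M) (x₀ : M) :
    IsLocalMetricOn (g.inChart x₀) (extChartAt I x₀).target where
  isOpen := isOpen_extChartAt_target x₀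
  contDiffOn := (contMDiff_iff_contDiffOn_formInChart g.inner).1 g.contMDiff x₀
  symm y hy v w := g.symm ((extChartAt I x₀).symm y) (mfderiv 𝓘(ℝ, E) I (extChartAt I x₀).symm y v)
    (mfderiv 𝓘(ℝ, E) I (extChartAt I x₀).symm y w)
  pos y hy v hv := by
    refine g.pos ((extChartAt I x₀).symm y) (mfderiv 𝓘(ℝ, E) I (extChartAt I x₀).symm y v) ?_
    intro h
    exact hv (injective_mfderiv_extChartAt_symm hy (h.trans (map_zero _).symm))

end ManifoldMetrics

/-! ### The Riemannian distance -/

section RiemannianDistance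

open Bundle Manifold MeasureTheory
open scoped NNReal

variable {E H M : Type*} [NormedAddCommGroup E] [NormedSpace ℝ E] [TopologicalSpace H]
  {I : ModelWithCorners ℝ E H} [TopologicalSpace M] [ChartedSpace H M] [IsManifold I ∞ M]
  {E' H' M' : Type*} [NormedAddCommGroup E'] [NormedSpace ℝ E'] [TopologicalSpace H']
  {I' : ModelWithCorners ℝ E' H'} [TopologicalSpace M'] [ChartedSpace H' M'] [IsManifold I' ∞ M']

namespace SmoothMetric

/-- The pseudo-distance of a smooth metric, which induces the topology of the manifold. -/
@[reducible] noncomputable def toPseudoEMetricSpace (g : SmoothMetric I M) [RegularSpace M] :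
    PseudoEMetricSpace M :=
  letI : RiemannianBundle (fun x : M => TangentSpace I x) := ⟨g.toRiemannianMetric⟩
  letI : IsManifold I 1 M := IsManifold.of_le (n := ∞) (by norm_cast)
  haveI : IsContinuousRiemannianBundle E (fun x : M => TangentSpace I x) :=
    ⟨g.inner, g.contMDiff.continuous, fun _ _ _ => rfl⟩
  PseudoEMetricSpace.ofRiemannianMetric I M

variable (g : SmoothMetric I M) (g' : SmoothMetric I' M')

theorem edist_comm (x y : M) : g.edist x y = g.edist y x :=
  let : RiemannianBundle (fun x : M => TangentSpace I x) := ⟨g.toRiemannianMetric⟩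
  let : IsManifold I 1 M := IsManifold.of_le (n := ∞) (by norm_cast)
  riemannianEDist_comm

theorem edist_triangle (x y z : M) : g.edist x z ≤ g.edist x y + g.edist y z :=
  let : RiemannianBundle (fun x : M => TangentSpace I x) := ⟨g.toRiemannianMetric⟩
  let : IsManifold I 1 M := IsManifold.of_le (n := ∞) (by norm_cast)
  riemannianEDist_triangle

theorem tendsto_edist_iff [RegularSpace M] {ι : Type*} {l : Filter ι} {u : ι → M} {x : M} :
    Tendsto (fun i => g.edist (u i) x) l (𝓝 0) ↔ Tendsto u l (𝓝 x) := by
  let := g.toPseudoEMetricSpace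
  exact (tendsto_iff_edist_tendsto_0 (l := l) (α := M) (y := x)).symm

theorem continuous_edist [RegularSpace M] (x : M) : Continuous (g.edist x) := by
  let := g.toPseudoEMetricSpace
  exact (continuous_const (y := x)).edist continuous_id

theorem edist_pos [T3Space M] {x y : M} (h : x ≠ y) : 0 < g.edist x y := by
  let := g.toPseudoEMetricSpace
  let : EMetricSpace M := EMetricSpace.ofT0PseudoEMetricSpace M
  exact _root_.edist_pos.2 h

/-- The set of points at finite distance from `x` is open and closed. -/
theorem edist_lt_top [RegularSpace M] [ConnectedSpace M] (x y : M) : g.edist x y < ⊤ := by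
  let := g.toPseudoEMetricSpace
  have h : IsClopen (Metric.eball x (⊤ : ℝ≥0∞)) :=
    ⟨Metric.isClosed_eball_top (x := x), Metric.isOpen_eball (x := x)⟩
  have h2 := h.eq_univ ⟨x, by simp⟩
  have h3 : y ∈ Metric.eball x (⊤ : ℝ≥0∞) := h2 ▸ mem_univ y
  rw [edist_comm]
  exact h3

theorem exists_edist_le [RegularSpace M] [ConnectedSpace M] [CompactSpace M] :
    ∃ D : ℝ≥0, ∀ x y, g.edist x y ≤ D := by
  obtain ⟨x₀⟩ := (inferInstance : Nonempty M)
  obtain ⟨z, -, hz⟩ := isCompact_univ.exists_isMaxOn univ_nonempty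
    (g.continuous_edist x₀).continuousOn
  have hlt := g.edist_lt_top x₀ z
  refine ⟨(g.edist x₀ z).toNNReal + (g.edist x₀ z).toNNReal, fun x y => ?_⟩
  rw [ENNReal.coe_add, ENNReal.coe_toNNReal hlt.ne]
  refine (g.edist_triangle x x₀ y).trans (add_le_add ?_ (hz (mem_univ y)))
  rw [g.edist_comm]
  exact hz (mem_univ x)

/-- A map whose differential has norm at most `c` multiplies lengths of paths by at most `c`. The
comparisons between the distances of different metrics below all come from this estimate, applied to
projections, inclusions and isometries. -/
theorem edist_map_le {f : M → M'} (hf : ContMDiff I I' 1 f) {c : ℝ≥0} (hc : 0 < c)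
    (h : ∀ (x : M) (X : TangentSpace I x), g'.inner (f x) (mfderiv I I' f x X)
      (mfderiv I I' f x X) ≤ (c : ℝ) ^ 2 * g.inner x X X) (x y : M) :
    g'.edist (f x) (f y) ≤ c * g.edist x y := by
  let : RiemannianBundle (fun x : M => TangentSpace I x) := ⟨g.toRiemannianMetric⟩
  let : RiemannianBundle (fun x : M' => TangentSpace I' x) := ⟨g'.toRiemannianMetric⟩
  let : IsManifold I 1 M := IsManifold.of_le (n := ∞) (by norm_cast)
  let : IsManifold I' 1 M' := IsManifold.of_le (n := ∞) (by norm_cast)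
  change riemannianEDist I' (f x) (f y) ≤ c * riemannianEDist I x y
  have hn : ∀ (x : M) (X : TangentSpace I x), ‖mfderiv I I' f x X‖ₑ ≤ c * ‖X‖ₑ := by
    intro x X
    have h1 : ‖mfderiv I I' f x X‖ ≤ c * ‖X‖ := by
      rw [norm_eq_sqrt_real_inner, norm_eq_sqrt_real_inner]
      refine Real.sqrt_le_iff.2 ⟨by positivity, ?_⟩
      rw [mul_pow, Real.sq_sqrt real_inner_self_nonneg]
      exact h x X
    have h2 : ‖mfderiv I I' f x X‖₊ ≤ c * ‖X‖₊ := h1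
    rw [enorm_eq_nnnorm, enorm_eq_nnnorm]
    exact_mod_cast h2
  have hle : ∀ γ : ℝ → M, ContMDiffOn 𝓘(ℝ, ℝ) I 1 γ (Icc 0 1) →
      pathELength I' (f ∘ γ) 0 1 ≤ c * pathELength I γ 0 1 := by
    intro γ hγ
    rw [pathELength_eq_lintegral_mfderivWithin_Icc, pathELength_eq_lintegral_mfderivWithin_Icc,
      ← lintegral_const_mul' _ _ ENNReal.coe_ne_top]
    refine setLIntegral_mono' measurableSet_Icc fun t ht => ?_
    rw [mfderiv_comp_mfderivWithin t (hf.mdifferentiableAt one_ne_zero)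
      (hγ.mdifferentiableOn one_ne_zero t ht)
      (uniqueMDiffWithinAt_iff_uniqueDiffWithinAt.2 (uniqueDiffOn_Icc zero_lt_one t ht))]
    exact hn _ _
  have hlt : ∀ r : ℝ≥0∞, riemannianEDist I x y < r →
      riemannianEDist I' (f x) (f y) ≤ c * r := by
    intro r hr
    obtain ⟨γ, h0, h1, hγ, hlen⟩ := exists_lt_of_riemannianEDist_lt hr
    refine (riemannianEDist_le_pathELength (γ := f ∘ γ) (hf.comp_contMDiffOn hγ) (by simp [h0])
      (by simp [h1]) zero_le_one).trans ((hle γ hγ).trans ?_)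
    gcongr
  have hc' : (c : ℝ≥0∞) ≠ 0 := by exact_mod_cast hc.ne'
  rw [mul_comm, ← ENNReal.div_le_iff_le_mul (Or.inl hc') (Or.inl ENNReal.coe_ne_top)]
  refine le_of_forall_gt_imp_ge_of_dense fun r hr => ?_
  rw [ENNReal.div_le_iff_le_mul (Or.inl hc') (Or.inl ENNReal.coe_ne_top), mul_comm]
  exact hlt r hr

theorem edist_le_of_isometry (F : M ≃ₘ^∞⟮I, I'⟯ M')
    (h : ∀ (x : M) (X : TangentSpace I x),
      g'.inner (F x) (mfderiv I I' F x X) (mfderiv I I' F x X) = g.inner x X X) (x y : M) :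
    g'.edist (F x) (F y) ≤ g.edist x y := by
  simpa using edist_map_le g g' (F.contMDiff.of_le (by norm_cast)) (c := 1) one_pos
    (fun x X => by simp [h]) x y

theorem edist_eq_of_isometry (F : M ≃ₘ^∞⟮I, I'⟯ M')
    (h : ∀ (x : M) (X : TangentSpace I x),
      g'.inner (F x) (mfderiv I I' F x X) (mfderiv I I' F x X) = g.inner x X X) (x y : M) :
    g'.edist (F x) (F y) = g.edist x y := by
  refine le_antisymm (edist_le_of_isometry g g' F h x y) ?_
  have h' := edist_le_of_isometry g' g F.symm (fun z Z => ?_) (F x) (F y)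
  · simpa using h'
  · have hd : mfderiv I I' F (F.symm z) (mfderiv I' I F.symm z Z) = Z := by
      have h1 := mfderiv_comp z (F.mdifferentiable (by simp) (F.symm z))
        (F.symm.mdifferentiable (by simp) z)
      have h2 : (F ∘ F.symm : M' → M') = id := by
        ext w
        simp
      rw [h2, mfderiv_id] at h1
      exact (DFunLike.congr_fun h1 Z).symm
    -- F(F⁻¹z) equals z only propositionally, so the two tangent spaces are identified by
    -- substitution.
    have aux : ∀ p : M', p = z → ∀ A : E', A = Z →
        (g'.inner p : E' →L[ℝ] E' →L[ℝ] ℝ) A A = g'.inner z Z Z := by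
      rintro p rfl A rfl
      rfl
    rw [← h]
    exact aux _ (F.apply_symm_apply z) _ hd

/-- The Euclidean metric on the real line. -/
noncomputable def line : SmoothMetric 𝓘(ℝ, ℝ) ℝ where
  inner := (riemannianMetricVectorSpace ℝ).inner
  symm := (riemannianMetricVectorSpace ℝ).symm
  pos := (riemannianMetricVectorSpace ℝ).pos
  isVonNBounded := (riemannianMetricVectorSpace ℝ).isVonNBounded
  contMDiff := (riemannianMetricVectorSpace ℝ).contMDiff.of_le le_top

theorem line_inner (x : ℝ) (a b : ℝ) :
    (line.inner x : ℝ →L[ℝ] ℝ →L[ℝ] ℝ) a b = a * b := by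
  rw [mul_comm]
  rfl

theorem line_edist (x y : ℝ) : line.edist x y = ENNReal.ofReal |x - y| := by
  rw [← Real.dist_eq, ← _root_.edist_dist]
  exact (IsRiemannianManifold.out (I := 𝓘(ℝ, ℝ)) x y).symm

end SmoothMetric

end RiemannianDistance

/-! ### The unit circle -/

section CircleMetric

/-- The derivative of the inclusion of the unit circle in `ℂ`. -/
noncomputable def circleDeriv (θ : Circle) : EuclideanSpace ℝ (Fin 1) →L[ℝ] ℂ :=
  mfderiv (𝓡 1) 𝓘(ℝ, ℂ) (fun z : Circle => (z : ℂ)) θ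

theorem injective_circleDeriv (θ : Circle) : Function.Injective (circleDeriv θ) := by
  have : Fact (Module.finrank ℝ ℂ = 1 + 1) := finrank_real_complex_fact'
  exact injective_mvfderiv_subtypeVal_sphere (n := 1) (E := ℂ) θ

theorem contMDiff_coe_circle : ContMDiff (𝓡 1) 𝓘(ℝ, ℂ) ∞ (fun z : Circle => (z : ℂ)) := by
  have : Fact (Module.finrank ℝ ℂ = 1 + 1) := finrank_real_complex_fact'
  exact contMDiff_coe_sphere (n := 1) (E := ℂ)

/-- The field of inner products induced on the unit circle by `ℂ`. -/
noncomputable def circleForm (θ : Circle) :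
    EuclideanSpace ℝ (Fin 1) →L[ℝ] EuclideanSpace ℝ (Fin 1) →L[ℝ] ℝ :=
  (innerSL ℝ (E := ℂ)).bilinearComp (circleDeriv θ) (circleDeriv θ)

theorem circleForm_apply (θ : Circle) (v w : EuclideanSpace ℝ (Fin 1)) :
    circleForm θ v w = inner ℝ (circleDeriv θ v) (circleDeriv θ w) := rfl

theorem circleForm_symm (θ : Circle) (v w : EuclideanSpace ℝ (Fin 1)) :
    circleForm θ v w = circleForm θ w v := by
  rw [circleForm_apply, circleForm_apply, real_inner_comm]

/-- In a chart the form is ⟨Dι(v), Dι(w)⟩, where ι is the inverse chart regarded as a smooth map to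
ℂ. -/
theorem contDiffOn_formInChart_circleForm (θ₀ : Circle) :
    ContDiffOn ℝ ∞ (formInChart (𝓡 1) circleForm θ₀) (extChartAt (𝓡 1) θ₀).target := by
  have hι : ContDiffOn ℝ ∞ (fun y => ((extChartAt (𝓡 1) θ₀).symm y : ℂ))
      (extChartAt (𝓡 1) θ₀).target :=
    contMDiffOn_iff_contDiffOn.1
      (contMDiff_coe_circle.comp_contMDiffOn (contMDiffOn_extChartAt_symm θ₀))
  have hopen : IsOpen (extChartAt (𝓡 1) θ₀).target := isOpen_extChartAt_target θ₀
  have hD := hι.fderiv_of_isOpen (m := ∞) hopen (by simp)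
  rw [contDiffOn_clm_apply]
  intro v
  rw [contDiffOn_clm_apply]
  intro w
  have hv := hD.clm_apply (contDiffOn_const (c := v))
  have hw := hD.clm_apply (contDiffOn_const (c := w))
  refine (hv.inner ℝ hw).congr fun y hy => ?_
  have hc := mfderiv_comp y (contMDiff_coe_circle.mdifferentiable (by simp)
    ((extChartAt (𝓡 1) θ₀).symm y)) (((contMDiffOn_extChartAt_symm (n := ∞) θ₀).contMDiffAt
      (hopen.mem_nhds hy)).mdifferentiableAt (by simp))
  rw [mfderiv_eq_fderiv] at hc
  exact (congrArg₂ (fun a b : ℂ => inner ℝ a b) (DFunLike.congr_fun hc v)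
    (DFunLike.congr_fun hc w)).symm

/-- The metric of the unit circle. -/
noncomputable def circleMetric : SmoothMetric (𝓡 1) Circle :=
  SmoothMetric.ofFormInChart circleForm circleForm_symm
    (fun θ _ hv => real_inner_self_pos.2 fun h =>
      hv (injective_circleDeriv θ (h.trans (map_zero _).symm)))
    contDiffOn_formInChart_circleForm

theorem circleMetric_inner (θ : Circle) (v w : EuclideanSpace ℝ (Fin 1)) :
    (circleMetric.inner θ : EuclideanSpace ℝ (Fin 1) →L[ℝ] EuclideanSpace ℝ (Fin 1) →L[ℝ] ℝ) v w
      = inner ℝ (circleDeriv θ v) (circleDeriv θ w) := circleForm_apply θ v w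

end CircleMetric

/-! ### Charts of products -/

section ProductCharts

variable {E H M : Type*} [NormedAddCommGroup E] [NormedSpace ℝ E] [TopologicalSpace H]
  {I : ModelWithCorners ℝ E H} [TopologicalSpace M] [ChartedSpace H M] [IsManifold I ∞ M]
  {E' H' M' : Type*} [NormedAddCommGroup E'] [NormedSpace ℝ E'] [TopologicalSpace H']
  {I' : ModelWithCorners ℝ E' H'} [TopologicalSpace M'] [ChartedSpace H' M'] [IsManifold I' ∞ M']

theorem mdifferentiableAt_extChartAt_symm [I.Boundaryless] {x : M} {y : E}
    (hy : y ∈ (extChartAt I x).target) :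
    MDifferentiableAt 𝓘(ℝ, E) I (extChartAt I x).symm y :=
  ((contMDiffOn_extChartAt_symm (n := ∞) x).contMDiffAt
    ((isOpen_extChartAt_target x).mem_nhds hy)).mdifferentiableAt (by simp)

theorem mfderiv_extChartAt_prod_symm [I.Boundaryless] [I'.Boundaryless] {x : M × M'} {y : E × E'}
    (h₁ : y.1 ∈ (extChartAt I x.1).target) (h₂ : y.2 ∈ (extChartAt I' x.2).target) (v : E × E') :
    (mfderiv 𝓘(ℝ, E × E') (I.prod I') (extChartAt (I.prod I') x).symm y v : E × E') =
      ((mfderiv 𝓘(ℝ, E) I (extChartAt I x.1).symm y.1 v.1 : E),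
        (mfderiv 𝓘(ℝ, E') I' (extChartAt I' x.2).symm y.2 v.2 : E')) := by
  have hy : y ∈ (extChartAt (I.prod I') x).target := by
    rw [extChartAt_prod]
    exact ⟨h₁, h₂⟩
  have hd := mdifferentiableAt_extChartAt_symm hy
  have c₁ := mfderiv_comp y (mdifferentiableAt_fst (I := I) (I' := I')
    (x := (extChartAt (I.prod I') x).symm y)) hd
  have c₂ := mfderiv_comp y (mdifferentiableAt_snd (I := I) (I' := I')
    (x := (extChartAt (I.prod I') x).symm y)) hd
  have e₁ : (Prod.fst ∘ (extChartAt (I.prod I') x).symm : E × E' → M) =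
      (extChartAt I x.1).symm ∘ Prod.fst := by
    rw [extChartAt_prod]
    rfl
  have e₂ : (Prod.snd ∘ (extChartAt (I.prod I') x).symm : E × E' → M') =
      (extChartAt I' x.2).symm ∘ Prod.snd := by
    rw [extChartAt_prod]
    rfl
  have d₁ := mfderiv_comp y (mdifferentiableAt_extChartAt_symm h₁)
    (differentiableAt_fst (𝕜 := ℝ) (p := y)).mdifferentiableAt
  have d₂ := mfderiv_comp y (mdifferentiableAt_extChartAt_symm h₂)
    (differentiableAt_snd (𝕜 := ℝ) (p := y)).mdifferentiableAt
  rw [mfderiv_eq_fderiv, fderiv_fst] at d₁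
  rw [mfderiv_eq_fderiv, fderiv_snd] at d₂
  rw [e₁, d₁, mfderiv_fst] at c₁
  rw [e₂, d₂, mfderiv_snd] at c₂
  exact Prod.ext (DFunLike.congr_fun c₁ v).symm (DFunLike.congr_fun c₂ v).symm

end ProductCharts

/-! ### Doubly warped products of manifolds -/

section WarpedMetrics

variable {E₁ H₁ M₁ : Type*} [NormedAddCommGroup E₁] [NormedSpace ℝ E₁] [TopologicalSpace H₁]
  {I₁ : ModelWithCorners ℝ E₁ H₁} [TopologicalSpace M₁] [ChartedSpace H₁ M₁] [IsManifold I₁ ∞ M₁]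
  {E₂ H₂ M₂ : Type*} [NormedAddCommGroup E₂] [NormedSpace ℝ E₂] [TopologicalSpace H₂]
  {I₂ : ModelWithCorners ℝ E₂ H₂} [TopologicalSpace M₂] [ChartedSpace H₂ M₂] [IsManifold I₂ ∞ M₂]

/-- The inner products of the doubly warped product `dt² ⊕ α(t)² g₁ ⊕ β(t)² g₂`. -/
noncomputable def warpedInner (α β : ℝ → ℝ) (g₁ : SmoothMetric I₁ M₁) (g₂ : SmoothMetric I₂ M₂)
    (x : ℝ × M₁ × M₂) : (ℝ × E₁ × E₂) →L[ℝ] (ℝ × E₁ × E₂) →L[ℝ] ℝ :=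
  warpedForm α β (fun _ => g₁.inner x.2.1) (fun _ => g₂.inner x.2.2) (x.1, 0)

variable {α β : ℝ → ℝ} {g₁ : SmoothMetric I₁ M₁} {g₂ : SmoothMetric I₂ M₂}

theorem warpedInner_apply (x : ℝ × M₁ × M₂) (X Y : ℝ × E₁ × E₂) :
    warpedInner α β g₁ g₂ x X Y = X.1 * Y.1 +
      α x.1 ^ 2 * (g₁.inner x.2.1 : E₁ →L[ℝ] E₁ →L[ℝ] ℝ) X.2.1 Y.2.1 +
      β x.1 ^ 2 * (g₂.inner x.2.2 : E₂ →L[ℝ] E₂ →L[ℝ] ℝ) X.2.2 Y.2.2 :=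
  warpedForm_apply _ _ _

theorem warpedInner_symm (g₁ : SmoothMetric I₁ M₁) (g₂ : SmoothMetric I₂ M₂) (x : ℝ × M₁ × M₂)
    (v w : ℝ × E₁ × E₂) : warpedInner α β g₁ g₂ x v w = warpedInner α β g₁ g₂ x w v := by
  have h₁ : (g₁.inner x.2.1 : E₁ →L[ℝ] E₁ →L[ℝ] ℝ) v.2.1 w.2.1 =
      (g₁.inner x.2.1 : E₁ →L[ℝ] E₁ →L[ℝ] ℝ) w.2.1 v.2.1 := g₁.symm _ _ _
  have h₂ : (g₂.inner x.2.2 : E₂ →L[ℝ] E₂ →L[ℝ] ℝ) v.2.2 w.2.2 =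
      (g₂.inner x.2.2 : E₂ →L[ℝ] E₂ →L[ℝ] ℝ) w.2.2 v.2.2 := g₂.symm _ _ _
  rw [warpedInner_apply, warpedInner_apply, h₁, h₂, mul_comm v.1]

theorem extChartAt_warped_target (x : ℝ × M₁ × M₂) :
    (extChartAt (𝓘(ℝ, ℝ).prod (I₁.prod I₂)) x).target =
      univ ×ˢ (extChartAt I₁ x.2.1).target ×ˢ (extChartAt I₂ x.2.2).target := by
  have h0 : extChartAt 𝓘(ℝ, ℝ) x.1 = PartialEquiv.refl ℝ := extChartAt_model_space_eq_id _ _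
  rw [extChartAt_prod, extChartAt_prod, h0]
  rfl

variable [I₁.Boundaryless] [I₂.Boundaryless]

theorem mfderiv_extChartAt_warped_symm {x : ℝ × M₁ × M₂} {y : ℝ × E₁ × E₂}
    (hy : y ∈ univ ×ˢ (extChartAt I₁ x.2.1).target ×ˢ (extChartAt I₂ x.2.2).target)
    (v : ℝ × E₁ × E₂) :
    (mfderiv 𝓘(ℝ, ℝ × E₁ × E₂) (𝓘(ℝ, ℝ).prod (I₁.prod I₂))
        (extChartAt (𝓘(ℝ, ℝ).prod (I₁.prod I₂)) x).symm y v : ℝ × E₁ × E₂) =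
      (v.1, (mfderiv 𝓘(ℝ, E₁) I₁ (extChartAt I₁ x.2.1).symm y.2.1 v.2.1 : E₁),
        (mfderiv 𝓘(ℝ, E₂) I₂ (extChartAt I₂ x.2.2).symm y.2.2 v.2.2 : E₂)) := by
  have h0 : extChartAt 𝓘(ℝ, ℝ) x.1 = PartialEquiv.refl ℝ := extChartAt_model_space_eq_id _ _
  have h1 : (y.1 : ℝ) ∈ (extChartAt 𝓘(ℝ, ℝ) x.1).target := by
    rw [h0]
    trivial
  have h2 : y.2 ∈ (extChartAt (I₁.prod I₂) x.2).target := by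
    rw [extChartAt_prod]
    exact hy.2
  rw [mfderiv_extChartAt_prod_symm h1 h2, mfderiv_extChartAt_prod_symm hy.2.1 hy.2.2]
  refine Prod.ext ?_ rfl
  change (mfderiv 𝓘(ℝ, ℝ) 𝓘(ℝ, ℝ) (extChartAt 𝓘(ℝ, ℝ) x.1).symm y.1 v.1 : ℝ) = v.1
  rw [h0]
  exact DFunLike.congr_fun (mfderiv_id (I := 𝓘(ℝ, ℝ)) (x := y.1)) v.1

/-- The chart of the product is the product of charts, with the identity on ℝ; hence the coordinate
expression of the warped product is the warped product of the coordinate expressions, and the local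
formulas apply. -/
theorem formInChart_warpedInner {x : ℝ × M₁ × M₂} {y : ℝ × E₁ × E₂}
    (hy : y ∈ univ ×ˢ (extChartAt I₁ x.2.1).target ×ˢ (extChartAt I₂ x.2.2).target) :
    formInChart (𝓘(ℝ, ℝ).prod (I₁.prod I₂)) (warpedInner α β g₁ g₂) x y =
      warpedForm α β (g₁.inChart x.2.1) (g₂.inChart x.2.2) y := by
  have h0 : extChartAt 𝓘(ℝ, ℝ) x.1 = PartialEquiv.refl ℝ := extChartAt_model_space_eq_id _ _
  have hp : (extChartAt (𝓘(ℝ, ℝ).prod (I₁.prod I₂)) x).symm y =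
      (y.1, (extChartAt I₁ x.2.1).symm y.2.1, (extChartAt I₂ x.2.2).symm y.2.2) := by
    rw [extChartAt_prod, extChartAt_prod, h0]
    rfl
  refine ContinuousLinearMap.ext fun v => ContinuousLinearMap.ext fun w => ?_
  refine (congrArg₂ (fun a b : ℝ × E₁ × E₂ => warpedInner α β g₁ g₂
    ((extChartAt (𝓘(ℝ, ℝ).prod (I₁.prod I₂)) x).symm y) a b)
    (mfderiv_extChartAt_warped_symm hy v) (mfderiv_extChartAt_warped_symm hy w)).trans ?_
  simp only [hp, warpedForm_apply]
  rfl

variable [FiniteDimensional ℝ E₁] [FiniteDimensional ℝ E₂]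

theorem warpedInner_pos (hα : ContDiff ℝ ∞ α) (hβ : ContDiff ℝ ∞ β) (hα0 : ∀ t, α t ≠ 0)
    (hβ0 : ∀ t, β t ≠ 0) (g₁ : SmoothMetric I₁ M₁) (g₂ : SmoothMetric I₂ M₂) (x : ℝ × M₁ × M₂)
    (v : ℝ × E₁ × E₂) (hv : v ≠ 0) : 0 < warpedInner α β g₁ g₂ x v v := by
  have hx : extChartAt (𝓘(ℝ, ℝ).prod (I₁.prod I₂)) x x ∈
      univ ×ˢ (extChartAt I₁ x.2.1).target ×ˢ (extChartAt I₂ x.2.2).target :=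
    extChartAt_warped_target (I₁ := I₁) (I₂ := I₂) x ▸ mem_extChartAt_target x
  have h := (isLocalMetricOn_warpedForm hα hβ hα0 hβ0 (g₁.isLocalMetricOn_inChart x.2.1)
    (g₂.isLocalMetricOn_inChart x.2.2)).pos _ hx v hv
  rw [← formInChart_warpedInner hx] at h
  exact h.trans_eq (formInChart_self (I := 𝓘(ℝ, ℝ).prod (I₁.prod I₂)) (warpedInner α β g₁ g₂) x v v)

/-- The doubly warped product `dt² ⊕ α(t)² g₁ ⊕ β(t)² g₂` on `ℝ × M₁ × M₂`. -/
noncomputable def warpedMetric (hα : ContDiff ℝ ∞ α) (hβ : ContDiff ℝ ∞ β) (hα0 : ∀ t, α t ≠ 0)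
    (hβ0 : ∀ t, β t ≠ 0) (g₁ : SmoothMetric I₁ M₁) (g₂ : SmoothMetric I₂ M₂) :
    SmoothMetric (𝓘(ℝ, ℝ).prod (I₁.prod I₂)) (ℝ × M₁ × M₂) :=
  SmoothMetric.ofFormInChart (warpedInner α β g₁ g₂)
    (warpedInner_symm g₁ g₂) (warpedInner_pos hα hβ hα0 hβ0 g₁ g₂)
    (fun x => by
      rw [extChartAt_warped_target]
      exact (isLocalMetricOn_warpedForm hα hβ hα0 hβ0 (g₁.isLocalMetricOn_inChart x.2.1)
        (g₂.isLocalMetricOn_inChart x.2.2)).contDiffOn.congr fun y hy =>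
          formInChart_warpedInner hy)

/-- `g` is the doubly warped product `dt² ⊕ α(t)² g₁ ⊕ β(t)² g₂`. -/
def IsWarpedMetric (α β : ℝ → ℝ) (g₁ : SmoothMetric I₁ M₁) (g₂ : SmoothMetric I₂ M₂)
    (g : SmoothMetric (𝓘(ℝ, ℝ).prod (I₁.prod I₂)) (ℝ × M₁ × M₂)) : Prop :=
  ∀ x, (g.inner x : (ℝ × E₁ × E₂) →L[ℝ] (ℝ × E₁ × E₂) →L[ℝ] ℝ) = warpedInner α β g₁ g₂ x

theorem isWarpedMetric_warpedMetric (hα : ContDiff ℝ ∞ α) (hβ : ContDiff ℝ ∞ β)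
    (hα0 : ∀ t, α t ≠ 0) (hβ0 : ∀ t, β t ≠ 0) :
    IsWarpedMetric α β g₁ g₂ (warpedMetric hα hβ hα0 hβ0 g₁ g₂) := fun _ => rfl

end WarpedMetrics

/-! ### Local geometry depends only on the germ of the metric -/

section LocalCongruence

variable {E : Type*} [NormedAddCommGroup E] [NormedSpace ℝ E] {G G' : E → E →L[ℝ] E →L[ℝ] ℝ} {y : E}

theorem localChristoffel_congr (h : G =ᶠ[𝓝 y] G') :
    localChristoffel G =ᶠ[𝓝 y] localChristoffel G' := by
  filter_upwards [h.eventuallyEq_nhds] with z hz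
  simp only [localChristoffel, hz.fderiv_eq, hz.self_of_nhds]

theorem localCurvature_congr (h : G =ᶠ[𝓝 y] G') (v w : E) :
    localCurvature G y v w = localCurvature G' y v w := by
  have hΓ := localChristoffel_congr h
  ext u
  simp only [localCurvature, hΓ.fderiv_eq, hΓ.self_of_nhds]

theorem localRicci_congr (h : G =ᶠ[𝓝 y] G') : localRicci G y = localRicci G' y := by
  ext v w
  exact congrArg (LinearMap.trace ℝ E) (localCurvature_congr h v w)

theorem localHessian_congr (h : G =ᶠ[𝓝 y] G') (f : E → ℝ) :
    localHessian G f y = localHessian G' f y := by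
  ext u v
  simp only [localHessian, (localChristoffel_congr h).self_of_nhds]

theorem localDivergence_congr (h : G =ᶠ[𝓝 y] G') (X : E → E) :
    localDivergence G X y = localDivergence G' X y := by
  simp only [localDivergence, (localChristoffel_congr h).self_of_nhds]

end LocalCongruence

/-! ### Tensors at the centre of a chart -/

section LocalExpressions

variable {E H M : Type*} [NormedAddCommGroup E] [NormedSpace ℝ E] [TopologicalSpace H]
  {I : ModelWithCorners ℝ E H} [TopologicalSpace M] [ChartedSpace H M] [IsManifold I ∞ M]

theorem SmoothMetric.ricci_eq_localRicci (g : SmoothMetric I M) (x : M) (X Y : E) :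
    g.ricci x X Y = localRicci (g.inChart x) (extChartAt I x x) X Y :=
  congrArg₂ (fun a b : E => localRicci (g.inChart x) (extChartAt I x x) a b)
    (chartDeriv_self x X) (chartDeriv_self x Y)

theorem SmoothMetric.hessian_eq_localHessian (g : SmoothMetric I M) (f : M → ℝ) (x : M) (X Y : E) :
    g.hessian f x X Y = localHessian (g.inChart x) (fun y => f ((extChartAt I x).symm y))
      (extChartAt I x x) X Y :=
  congrArg₂ (fun a b : E => localHessian (g.inChart x) (fun y => f ((extChartAt I x).symm y))
    (extChartAt I x x) a b) (chartDeriv_self x X) (chartDeriv_self x Y)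

end LocalExpressions

/-! ### Ricci tensor and Hessian of a warped product manifold -/

section WarpedMetricGeometry

variable {E₁ H₁ M₁ : Type*} [NormedAddCommGroup E₁] [NormedSpace ℝ E₁] [TopologicalSpace H₁]
  {I₁ : ModelWithCorners ℝ E₁ H₁} [TopologicalSpace M₁] [ChartedSpace H₁ M₁] [IsManifold I₁ ∞ M₁]
  {E₂ H₂ M₂ : Type*} [NormedAddCommGroup E₂] [NormedSpace ℝ E₂] [TopologicalSpace H₂]
  {I₂ : ModelWithCorners ℝ E₂ H₂} [TopologicalSpace M₂] [ChartedSpace H₂ M₂] [IsManifold I₂ ∞ M₂]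
  {α β : ℝ → ℝ} {g₁ : SmoothMetric I₁ M₁} {g₂ : SmoothMetric I₂ M₂}
  {g : SmoothMetric (𝓘(ℝ, ℝ).prod (I₁.prod I₂)) (ℝ × M₁ × M₂)}

theorem differential_comp_fst {f : ℝ → ℝ} (hf : Differentiable ℝ f) (x : ℝ × M₁ × M₂)
    (X : ℝ × E₁ × E₂) :
    SmoothMetric.differential (𝓘(ℝ, ℝ).prod (I₁.prod I₂)) (fun q : ℝ × M₁ × M₂ => f q.1) x X =
      deriv f x.1 * X.1 := by
  have h := mfderiv_comp x (hf x.1).mdifferentiableAt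
    (mdifferentiableAt_fst (I := 𝓘(ℝ, ℝ)) (I' := I₁.prod I₂) (x := x))
  rw [mfderiv_eq_fderiv, mfderiv_fst] at h
  refine (DFunLike.congr_fun h X).trans ?_
  change fderiv ℝ f x.1 X.1 = _
  rw [← toSpanSingleton_deriv]
  simp [mul_comm]

theorem extChartAt_self_mem_warped_target (x : ℝ × M₁ × M₂) :
    extChartAt (𝓘(ℝ, ℝ).prod (I₁.prod I₂)) x x ∈
      (univ ×ˢ (extChartAt I₁ x.2.1).target ×ˢ (extChartAt I₂ x.2.2).target :
        Set (ℝ × E₁ × E₂)) :=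
  extChartAt_warped_target (I₁ := I₁) (I₂ := I₂) x ▸ mem_extChartAt_target x

namespace IsWarpedMetric

variable [I₁.Boundaryless] [I₂.Boundaryless]

theorem inChart_eventuallyEq (hg : IsWarpedMetric α β g₁ g₂ g) (x : ℝ × M₁ × M₂) :
    g.inChart x =ᶠ[𝓝 (extChartAt (𝓘(ℝ, ℝ).prod (I₁.prod I₂)) x x)]
      warpedForm α β (g₁.inChart x.2.1) (g₂.inChart x.2.2) := by
  have hg' : g.inner = warpedInner α β g₁ g₂ := funext hg
  have h : (univ ×ˢ (extChartAt I₁ x.2.1).target ×ˢ (extChartAt I₂ x.2.2).target :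
      Set (ℝ × E₁ × E₂)) ∈ 𝓝 (extChartAt (𝓘(ℝ, ℝ).prod (I₁.prod I₂)) x x) := by
    rw [← extChartAt_warped_target (I₁ := I₁) (I₂ := I₂) x]
    exact extChartAt_target_mem_nhds x
  filter_upwards [h] with y hy
  rw [SmoothMetric.inChart_eq_formInChart, hg']
  exact formInChart_warpedInner hy

variable [FiniteDimensional ℝ E₁] [FiniteDimensional ℝ E₂]

theorem ricci_eq (hg : IsWarpedMetric α β g₁ g₂ g)
    (hα : ContDiff ℝ ∞ α) (hβ : ContDiff ℝ ∞ β) (hα0 : ∀ t, α t ≠ 0) (hβ0 : ∀ t, β t ≠ 0)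
    (x : ℝ × M₁ × M₂) (X Y : ℝ × E₁ × E₂) :
    g.ricci x X Y =
      -(Module.finrank ℝ E₁ * (deriv (deriv α) x.1 / α x.1) +
        Module.finrank ℝ E₂ * (deriv (deriv β) x.1 / β x.1)) * (X.1 * Y.1) +
      (g₁.ricci x.2.1 X.2.1 Y.2.1 -
        (α x.1 * deriv (deriv α) x.1 + (Module.finrank ℝ E₁ - 1) * deriv α x.1 ^ 2 +
          Module.finrank ℝ E₂ * (α x.1 * deriv α x.1 * (deriv β x.1 / β x.1))) *
            (g₁.inner x.2.1 : E₁ →L[ℝ] E₁ →L[ℝ] ℝ) X.2.1 Y.2.1) +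
      (g₂.ricci x.2.2 X.2.2 Y.2.2 -
        (β x.1 * deriv (deriv β) x.1 + (Module.finrank ℝ E₂ - 1) * deriv β x.1 ^ 2 +
          Module.finrank ℝ E₁ * (β x.1 * deriv β x.1 * (deriv α x.1 / α x.1))) *
            (g₂.inner x.2.2 : E₂ →L[ℝ] E₂ →L[ℝ] ℝ) X.2.2 Y.2.2) := by
  have h := localRicci_warpedForm hα hβ hα0 hβ0 (g₁.isLocalMetricOn_inChart x.2.1)
    (g₂.isLocalMetricOn_inChart x.2.2) (extChartAt_self_mem_warped_target x) X Y
  rw [← localRicci_congr (hg.inChart_eventuallyEq x)] at h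
  refine (g.ricci_eq_localRicci x X Y).trans (h.trans ?_)
  have e₁ := g₁.ricci_eq_localRicci x.2.1 X.2.1 Y.2.1
  have e₂ := g₂.ricci_eq_localRicci x.2.2 X.2.2 Y.2.2
  rw [e₁, e₂, ← g₁.inChart_self, ← g₂.inChart_self]
  rfl

theorem hessian_eq (hg : IsWarpedMetric α β g₁ g₂ g) {f : ℝ → ℝ} (hf : ContDiff ℝ ∞ f)
    (hα : ContDiff ℝ ∞ α) (hβ : ContDiff ℝ ∞ β) (hα0 : ∀ t, α t ≠ 0) (hβ0 : ∀ t, β t ≠ 0)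
    (x : ℝ × M₁ × M₂) (X Y : ℝ × E₁ × E₂) :
    g.hessian (fun q => f q.1) x X Y =
      deriv (deriv f) x.1 * (X.1 * Y.1) + deriv f x.1 *
        (α x.1 * deriv α x.1 * (g₁.inner x.2.1 : E₁ →L[ℝ] E₁ →L[ℝ] ℝ) X.2.1 Y.2.1 +
          β x.1 * deriv β x.1 * (g₂.inner x.2.2 : E₂ →L[ℝ] E₂ →L[ℝ] ℝ) X.2.2 Y.2.2) := by
  have h := localHessian_warpedForm hf hα hβ hα0 hβ0 (g₁.isLocalMetricOn_inChart x.2.1)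
    (g₂.isLocalMetricOn_inChart x.2.2) (extChartAt_self_mem_warped_target x) X Y
  rw [← localHessian_congr (hg.inChart_eventuallyEq x)] at h
  refine (g.hessian_eq_localHessian _ x X Y).trans (h.trans ?_)
  rw [← g₁.inChart_self, ← g₂.inChart_self]
  rfl

end IsWarpedMetric

end WarpedMetricGeometry

/-! ### Unit normal and mean curvature of the slices, scalar curvature -/

section LevelSets

variable {E₁ H₁ M₁ : Type*} [NormedAddCommGroup E₁] [NormedSpace ℝ E₁] [TopologicalSpace H₁]
  {I₁ : ModelWithCorners ℝ E₁ H₁} [TopologicalSpace M₁] [ChartedSpace H₁ M₁] [IsManifold I₁ ∞ M₁]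
  {E₂ H₂ M₂ : Type*} [NormedAddCommGroup E₂] [NormedSpace ℝ E₂] [TopologicalSpace H₂]
  {I₂ : ModelWithCorners ℝ E₂ H₂} [TopologicalSpace M₂] [ChartedSpace H₂ M₂] [IsManifold I₂ ∞ M₂]
  {α β : ℝ → ℝ} {g₁ : SmoothMetric I₁ M₁} {g₂ : SmoothMetric I₂ M₂}
  {g : SmoothMetric (𝓘(ℝ, ℝ).prod (I₁.prod I₂)) (ℝ × M₁ × M₂)}

theorem differential_fst (x : ℝ × M₁ × M₂) (X : ℝ × E₁ × E₂) :
    SmoothMetric.differential (𝓘(ℝ, ℝ).prod (I₁.prod I₂)) (fun q : ℝ × M₁ × M₂ => q.1) x X =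
      X.1 :=
  DFunLike.congr_fun (mfderiv_fst (I := 𝓘(ℝ, ℝ)) (I' := I₁.prod I₂) (x := x)) X

theorem mfderiv_warped_snd_snd (x : ℝ × M₁ × M₂) (X : ℝ × E₁ × E₂) :
    (mfderiv (𝓘(ℝ, ℝ).prod (I₁.prod I₂)) I₂ (fun q : ℝ × M₁ × M₂ => q.2.2) x X : E₂) = X.2.2 := by
  have h1 := mfderiv_comp x (mdifferentiableAt_snd (I := I₁) (I' := I₂) (x := x.2))
    (mdifferentiableAt_snd (I := 𝓘(ℝ, ℝ)) (I' := I₁.prod I₂) (x := x))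
  rw [mfderiv_snd, mfderiv_snd] at h1
  exact DFunLike.congr_fun h1 X

namespace IsWarpedMetric

theorem inner_apply (hg : IsWarpedMetric α β g₁ g₂ g) (x : ℝ × M₁ × M₂) (X Y : ℝ × E₁ × E₂) :
    (g.inner x : (ℝ × E₁ × E₂) →L[ℝ] (ℝ × E₁ × E₂) →L[ℝ] ℝ) X Y = X.1 * Y.1 +
      α x.1 ^ 2 * (g₁.inner x.2.1 : E₁ →L[ℝ] E₁ →L[ℝ] ℝ) X.2.1 Y.2.1 +
      β x.1 ^ 2 * (g₂.inner x.2.2 : E₂ →L[ℝ] E₂ →L[ℝ] ℝ) X.2.2 Y.2.2 :=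
  (DFunLike.congr_fun (DFunLike.congr_fun (hg x) X) Y).trans (warpedInner_apply x X Y)

theorem inner_one_zero (hg : IsWarpedMetric α β g₁ g₂ g) (x : ℝ × M₁ × M₂) (X : ℝ × E₁ × E₂) :
    (g.inner x : (ℝ × E₁ × E₂) →L[ℝ] (ℝ × E₁ × E₂) →L[ℝ] ℝ) (1, 0) X = X.1 := by
  have h : ∀ (a b : ℝ) (B₁ : E₁ →L[ℝ] E₁ →L[ℝ] ℝ) (B₂ : E₂ →L[ℝ] E₂ →L[ℝ] ℝ),
      1 * X.1 + a * B₁ 0 X.2.1 + b * B₂ 0 X.2.2 = X.1 := by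
    intro a b B₁ B₂
    simp
  exact (hg.inner_apply x (1, 0) X).trans (h _ _ _ _)

variable [FiniteDimensional ℝ E₁] [FiniteDimensional ℝ E₂]

/-- The vector ∂_t represents dt. -/
theorem gradient_fst (hg : IsWarpedMetric α β g₁ g₂ g) (x : ℝ × M₁ × M₂) :
    (g.gradient (fun q => q.1) x : ℝ × E₁ × E₂) = (1, 0) := by
  have hinv : (g.inner x : (ℝ × E₁ × E₂) →L[ℝ] (ℝ × E₁ × E₂) →L[ℝ] ℝ).IsInvertible :=
    ContinuousLinearMap.isInvertible_of_pos (E := ℝ × E₁ × E₂) (g.inner x) (g.pos x)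
  have h : (SmoothMetric.differential (𝓘(ℝ, ℝ).prod (I₁.prod I₂))
      (fun q : ℝ × M₁ × M₂ => q.1) x : (ℝ × E₁ × E₂) →L[ℝ] ℝ) =
      (g.inner x : (ℝ × E₁ × E₂) →L[ℝ] (ℝ × E₁ × E₂) →L[ℝ] ℝ) (1, 0) := by
    refine ContinuousLinearMap.ext fun X => ?_
    exact (differential_fst x X).trans (hg.inner_one_zero x X).symm
  obtain ⟨e, he⟩ := hinv
  change ContinuousLinearMap.inverse (g.inner x : (ℝ × E₁ × E₂) →L[ℝ] (ℝ × E₁ × E₂) →L[ℝ] ℝ)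
    (SmoothMetric.differential (𝓘(ℝ, ℝ).prod (I₁.prod I₂)) (fun q : ℝ × M₁ × M₂ => q.1) x :
      (ℝ × E₁ × E₂) →L[ℝ] ℝ) = _
  rw [h, ← he, ContinuousLinearMap.inverse_equiv]
  exact e.symm_apply_apply _

theorem unitNormal_fst (hg : IsWarpedMetric α β g₁ g₂ g) (x : ℝ × M₁ × M₂) :
    (g.unitNormal (fun q => q.1) x : ℝ × E₁ × E₂) = (1, 0) := by
  have h := hg.gradient_fst x
  have h1 : (g.inner x : (ℝ × E₁ × E₂) →L[ℝ] (ℝ × E₁ × E₂) →L[ℝ] ℝ) (1, 0) (1, 0) = 1 :=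
    hg.inner_one_zero x (1, 0)
  have h2 : g.inner x (g.gradient (fun q => q.1) x) (g.gradient (fun q => q.1) x) = 1 :=
    (congrArg (fun a : ℝ × E₁ × E₂ =>
      (g.inner x : (ℝ × E₁ × E₂) →L[ℝ] (ℝ × E₁ × E₂) →L[ℝ] ℝ) a a) h).trans h1
  rw [SmoothMetric.unitNormal, h2]
  simpa using h

variable [I₁.Boundaryless] [I₂.Boundaryless]

theorem levelSetMeanCurvature_fst (hg : IsWarpedMetric α β g₁ g₂ g) {φ : ℝ → ℝ}
    (hφ : Differentiable ℝ φ) (hα : ContDiff ℝ ∞ α) (hβ : ContDiff ℝ ∞ β) (hα0 : ∀ t, α t ≠ 0)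
    (hβ0 : ∀ t, β t ≠ 0) (x : ℝ × M₁ × M₂) :
    g.levelSetMeanCurvature (fun q => φ q.1) (fun q => q.1) x =
      Module.finrank ℝ E₁ * (deriv α x.1 / α x.1) +
        Module.finrank ℝ E₂ * (deriv β x.1 / β x.1) - deriv φ x.1 := by
  have hd : SmoothMetric.differential (𝓘(ℝ, ℝ).prod (I₁.prod I₂))
      (fun q : ℝ × M₁ × M₂ => φ q.1) x (g.unitNormal (fun q => q.1) x) = deriv φ x.1 := by
    refine (differential_comp_fst (I₁ := I₁) (I₂ := I₂) hφ x
      (g.unitNormal (fun q => q.1) x : ℝ × E₁ × E₂)).trans ?_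
    rw [hg.unitNormal_fst, mul_one]
  -- In the chart, the unit normal field is the constant field (1, 0) near the point, as the
  -- divergence formula requires.
  have hX : (fun y : ℝ × E₁ × E₂ => (SmoothMetric.chartDeriv (𝓘(ℝ, ℝ).prod (I₁.prod I₂)) x
      ((extChartAt (𝓘(ℝ, ℝ).prod (I₁.prod I₂)) x).symm y)
      (g.unitNormal (fun q => q.1) ((extChartAt (𝓘(ℝ, ℝ).prod (I₁.prod I₂)) x).symm y)) :
        ℝ × E₁ × E₂)) =ᶠ[𝓝 (extChartAt (𝓘(ℝ, ℝ).prod (I₁.prod I₂)) x x)] fun _ => (1, 0) := by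
    filter_upwards [extChartAt_target_mem_nhds x] with y hy
    have h1 := chartDeriv_mfderiv_symm hy (1, 0)
    have h2 := mfderiv_extChartAt_warped_symm (I₁ := I₁) (I₂ := I₂)
      (extChartAt_warped_target (I₁ := I₁) (I₂ := I₂) x ▸ hy) (1, 0)
    refine Eq.trans (congrArg (fun a : ℝ × E₁ × E₂ =>
      (SmoothMetric.chartDeriv (𝓘(ℝ, ℝ).prod (I₁.prod I₂)) x
      ((extChartAt (𝓘(ℝ, ℝ).prod (I₁.prod I₂)) x).symm y) a : ℝ × E₁ × E₂)) ?_) h1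
    refine (hg.unitNormal_fst _).trans (h2.trans ?_).symm
    exact Prod.ext rfl (Prod.ext (map_zero _) (map_zero _))
  have hdiv := localDivergence_warpedForm hα hβ hα0 hβ0 (g₁.isLocalMetricOn_inChart x.2.1)
    (g₂.isLocalMetricOn_inChart x.2.2) (extChartAt_self_mem_warped_target x) hX
  rw [← localDivergence_congr (hg.inChart_eventuallyEq x)] at hdiv
  rw [SmoothMetric.levelSetMeanCurvature, SmoothMetric.weightedDivergence, hd]
  exact congrArg (· - deriv φ x.1) hdiv

theorem scalar_eq (hg : IsWarpedMetric α β g₁ g₂ g) {a b c : ℝ} (x : ℝ × M₁ × M₂)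
    (h : ∀ X Y : ℝ × E₁ × E₂, g.ricci x X Y = a * (X.1 * Y.1) +
      b * (α x.1 ^ 2 * (g₁.inner x.2.1 : E₁ →L[ℝ] E₁ →L[ℝ] ℝ) X.2.1 Y.2.1) +
      c * (β x.1 ^ 2 * (g₂.inner x.2.2 : E₂ →L[ℝ] E₂ →L[ℝ] ℝ) X.2.2 Y.2.2)) :
    g.scalar x = a + b * Module.finrank ℝ E₁ + c * Module.finrank ℝ E₂ := by
  have hinv := (g.isLocalMetricOn_inChart x).isInvertible (mem_extChartAt_target x)
  rw [SmoothMetric.scalar, localScalar_eq_of_localRicci hinv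
    (LinearMap.prodMap (a • LinearMap.id) (LinearMap.prodMap (b • LinearMap.id)
      (c • LinearMap.id)))]
  · simp only [LinearMap.trace_prodMap', map_smul, LinearMap.trace_id, smul_eq_mul]
    simp
    ring
  · intro v w
    rw [← g.ricci_eq_localRicci, h]
    have hB : ∀ (r s : ℝ) (B₁ : E₁ →L[ℝ] E₁ →L[ℝ] ℝ) (B₂ : E₂ →L[ℝ] E₂ →L[ℝ] ℝ),
        a * v.1 * w.1 + r * B₁ (b • v.2.1) w.2.1 + s * B₂ (c • v.2.2) w.2.2 =
        a * (v.1 * w.1) + b * (r * B₁ v.2.1 w.2.1) + c * (s * B₂ v.2.2 w.2.2) := by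
      intro r s B₁ B₂
      simp
      ring
    exact Eq.symm ((g.inChart_self x _ w).trans ((hg.inner_apply x _ w).trans (hB _ _ _ _)))

end IsWarpedMetric

end LevelSets

/-! ### The circle as first fibre -/

section LineCircle

variable {d : ℕ} {N : Type*} [TopologicalSpace N] [ChartedSpace (EuclideanSpace ℝ (Fin d)) N]
  [IsManifold (𝓡 d) ∞ N] {α β : ℝ → ℝ} {h : SmoothMetric (𝓡 d) N}
  {g : SmoothMetric (lineCircleModel d) (ℝ × Circle × N)}

theorem circleDifferential_eq (x : ℝ × Circle × N) (X : ℝ × EuclideanSpace ℝ (Fin 1) ×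
    EuclideanSpace ℝ (Fin d)) : circleDifferential x X = circleDeriv x.2.1 X.2.1 := by
  have h1 := mfderiv_comp x (mdifferentiableAt_fst (I := 𝓡 1) (I' := 𝓡 d) (x := x.2))
    (mdifferentiableAt_snd (I := 𝓘(ℝ, ℝ)) (I' := (𝓡 1).prod (𝓡 d)) (x := x))
  have h2 := mfderiv_comp x (contMDiff_coe_circle.mdifferentiable (by simp) x.2.1)
    ((mdifferentiableAt_fst (I := 𝓡 1) (I' := 𝓡 d) (x := x.2)).comp x
      (mdifferentiableAt_snd (I := 𝓘(ℝ, ℝ)) (I' := (𝓡 1).prod (𝓡 d)) (x := x)))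
  rw [h1, mfderiv_fst, mfderiv_snd] at h2
  exact DFunLike.congr_fun h2 X

theorem isLineCircleWarpedMetric_of_isWarpedMetric (hg : IsWarpedMetric α β circleMetric h g) :
    IsLineCircleWarpedMetric α β h g := by
  intro x X Y
  have h1 := differential_fst (I₁ := 𝓡 1) (I₂ := 𝓡 d) x
  have h2 := circleDifferential_eq (d := d) x
  have h3 := mfderiv_warped_snd_snd (I₁ := 𝓡 1) (I₂ := 𝓡 d) x
  refine (hg.inner_apply x X Y).trans ?_
  refine (congrArg (fun r : ℝ => (X.1 : ℝ) * Y.1 + α x.1 ^ 2 * r + β x.1 ^ 2 * h.inner x.2.2 X.2.2 Y.2.2)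
    (circleMetric_inner x.2.1 X.2.1 Y.2.1)).trans ?_
  exact (congrArg₂ (· + ·) (congrArg₂ (· + ·) (congrArg₂ (· * ·) (h1 X) (h1 Y))
    (congrArg (α x.1 ^ 2 * ·) (congrArg₂ (fun a b : ℂ => (inner ℝ a b : ℝ)) (h2 X) (h2 Y))))
    (congrArg (β x.1 ^ 2 * ·) (congrArg₂ (fun a b : EuclideanSpace ℝ (Fin d) =>
      (h.inner x.2.2 : EuclideanSpace ℝ (Fin d) →L[ℝ] EuclideanSpace ℝ (Fin d) →L[ℝ] ℝ) a b)
      (h3 X) (h3 Y)))).symm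

theorem ricci_circleMetric (θ : Circle) (v w : EuclideanSpace ℝ (Fin 1)) :
    circleMetric.ricci θ v w = 0 := by
  rw [circleMetric.ricci_eq_localRicci]
  exact localRicci_eq_zero_of_finrank_eq_one (by simp) _ _ _ _

end LineCircle

/-! ### Distances and completeness in warped products -/

section WarpedDistance

open scoped NNReal

variable {E₁ H₁ M₁ : Type*} [NormedAddCommGroup E₁] [NormedSpace ℝ E₁] [TopologicalSpace H₁]
  {I₁ : ModelWithCorners ℝ E₁ H₁} [TopologicalSpace M₁] [ChartedSpace H₁ M₁] [IsManifold I₁ ∞ M₁]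
  {E₂ H₂ M₂ : Type*} [NormedAddCommGroup E₂] [NormedSpace ℝ E₂] [TopologicalSpace H₂]
  {I₂ : ModelWithCorners ℝ E₂ H₂} [TopologicalSpace M₂] [ChartedSpace H₂ M₂] [IsManifold I₂ ∞ M₂]
  {α β : ℝ → ℝ} {g₁ : SmoothMetric I₁ M₁} {g₂ : SmoothMetric I₂ M₂}
  {g : SmoothMetric (𝓘(ℝ, ℝ).prod (I₁.prod I₂)) (ℝ × M₁ × M₂)}

theorem SmoothMetric.inner_self_nonneg {E H M : Type*} [NormedAddCommGroup E] [NormedSpace ℝ E]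
    [TopologicalSpace H] {I : ModelWithCorners ℝ E H} [TopologicalSpace M] [ChartedSpace H M]
    [IsManifold I ∞ M] (g : SmoothMetric I M) (x : M) (X : E) :
    0 ≤ (g.inner x : E →L[ℝ] E →L[ℝ] ℝ) X X := by
  by_cases hX : X = 0
  · have aux : ∀ B : E →L[ℝ] E →L[ℝ] ℝ, 0 ≤ B 0 0 := by simp
    exact hX ▸ aux (g.inner x)
  · exact (g.pos x X hX).le

theorem mfderiv_warped_line (t : ℝ) (y : M₁ × M₂) (s : ℝ) :
    (mfderiv 𝓘(ℝ, ℝ) (𝓘(ℝ, ℝ).prod (I₁.prod I₂)) (fun r : ℝ => (r, y)) t s : ℝ × E₁ × E₂) =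
      (s, 0) :=
  DFunLike.congr_fun (mfderiv_prod_left (I := 𝓘(ℝ, ℝ)) (I' := I₁.prod I₂) (x₀ := t) (y₀ := y)) s

theorem mfderiv_warped_fiber (t : ℝ) (θ : M₁) (p : M₂) (X : E₁) :
    (mfderiv I₁ (𝓘(ℝ, ℝ).prod (I₁.prod I₂)) (fun θ : M₁ => (t, θ, p)) θ X : ℝ × E₁ × E₂) =
      (0, X, 0) := by
  have h1 := mfderiv_comp (I := I₁) (I' := I₁.prod I₂) (I'' := 𝓘(ℝ, ℝ).prod (I₁.prod I₂)) θ
    (g := fun y : M₁ × M₂ => (t, y)) (f := fun θ : M₁ => (θ, p))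
    ((contMDiff_const.prodMk contMDiff_id : ContMDiff (I₁.prod I₂) (𝓘(ℝ, ℝ).prod (I₁.prod I₂)) 1
      fun y : M₁ × M₂ => (t, y)).mdifferentiable one_ne_zero _)
    ((contMDiff_id.prodMk contMDiff_const : ContMDiff I₁ (I₁.prod I₂) 1
      fun θ : M₁ => (θ, p)).mdifferentiable one_ne_zero _)
  rw [mfderiv_prod_left, mfderiv_prod_right] at h1
  exact DFunLike.congr_fun h1 X

namespace IsWarpedMetric

theorem abs_fst_sub_le (hg : IsWarpedMetric α β g₁ g₂ g) (x y : ℝ × M₁ × M₂) :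
    ENNReal.ofReal |x.1 - y.1| ≤ g.edist x y := by
  rw [← SmoothMetric.line_edist]
  refine (SmoothMetric.edist_map_le g SmoothMetric.line
    (f := fun q : ℝ × M₁ × M₂ => q.1) contMDiff_fst one_pos (fun z Z => ?_) x y).trans (by simp)
  have h1 := differential_fst (I₁ := I₁) (I₂ := I₂) z
  refine ((congrArg₂ (fun a b : ℝ => (SmoothMetric.line.inner z.1 : ℝ →L[ℝ] ℝ →L[ℝ] ℝ) a b)
    (h1 Z) (h1 Z)).trans (SmoothMetric.line_inner _ _ _)).trans_le ?_
  have h2 := g₁.inner_self_nonneg z.2.1 (Z : ℝ × E₁ × E₂).2.1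
  have h3 := g₂.inner_self_nonneg z.2.2 (Z : ℝ × E₁ × E₂).2.2
  refine le_of_le_of_eq ?_ (congrArg (((1 : ℝ≥0) : ℝ) ^ 2 * ·) (hg.inner_apply z Z Z).symm)
  rw [NNReal.coe_one, one_pow, one_mul]
  have := mul_nonneg (sq_nonneg (α z.1)) h2
  have := mul_nonneg (sq_nonneg (β z.1)) h3
  linarith

/-- A lower bound on the warping factor makes the projection to the second fibre b⁻¹-Lipschitz. -/
theorem edist_snd_snd_le (hg : IsWarpedMetric α β g₁ g₂ g) {b : ℝ≥0} (hb : 0 < b)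
    (hβ : ∀ t, b ≤ β t) (x y : ℝ × M₁ × M₂) :
    b * g₂.edist x.2.2 y.2.2 ≤ g.edist x y := by
  have hb' : (b : ℝ≥0∞) ≠ 0 := by exact_mod_cast hb.ne'
  rw [mul_comm, ← ENNReal.le_div_iff_mul_le (Or.inl hb') (Or.inl ENNReal.coe_ne_top),
    ENNReal.div_eq_inv_mul, ← ENNReal.coe_inv hb.ne']
  refine SmoothMetric.edist_map_le g g₂
    (f := fun q : ℝ × M₁ × M₂ => q.2.2) (contMDiff_snd.comp contMDiff_snd) (inv_pos.2 hb)
    (fun z Z => ?_) x y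
  have h1 := mfderiv_warped_snd_snd (I₁ := I₁) (I₂ := I₂) z
  refine (congrArg₂ (fun a b : E₂ => (g₂.inner z.2.2 : E₂ →L[ℝ] E₂ →L[ℝ] ℝ) a b)
    (h1 Z) (h1 Z)).trans_le ?_
  have h2 := g₁.inner_self_nonneg z.2.1 (Z : ℝ × E₁ × E₂).2.1
  have h3 := g₂.inner_self_nonneg z.2.2 (Z : ℝ × E₁ × E₂).2.2
  refine le_of_le_of_eq ?_ (congrArg (((b⁻¹ : ℝ≥0) : ℝ) ^ 2 * ·) (hg.inner_apply z Z Z).symm)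
  have hb0 : (0 : ℝ) < b := hb
  rw [NNReal.coe_inv, inv_pow, ← div_eq_inv_mul, le_div_iff₀ (by positivity)]
  have h4 := mul_nonneg (sq_nonneg (α z.1)) h2
  have h5 : (b : ℝ) ^ 2 ≤ β z.1 ^ 2 := pow_le_pow_left₀ hb0.le (hβ _) 2
  have h6 := mul_le_mul_of_nonneg_right h5 h3
  have h7 : 0 ≤ (Z : ℝ × E₁ × E₂).1 * (Z : ℝ × E₁ × E₂).1 := mul_self_nonneg _
  exact (mul_comm _ _).trans_le (by linarith)

theorem edist_line_le (hg : IsWarpedMetric α β g₁ g₂ g) (s t : ℝ) (y : M₁ × M₂) :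
    g.edist (s, y) (t, y) ≤ ENNReal.ofReal |s - t| := by
  rw [← SmoothMetric.line_edist]
  refine (SmoothMetric.edist_map_le SmoothMetric.line g
    (f := fun r : ℝ => (r, y)) (contMDiff_id.prodMk contMDiff_const) one_pos
    (fun r R => ?_) s t).trans (by simp)
  have h1 := mfderiv_warped_line (I₁ := I₁) (I₂ := I₂) r y
  refine ((congrArg₂ (fun a b : ℝ × E₁ × E₂ =>
    (g.inner (r, y) : (ℝ × E₁ × E₂) →L[ℝ] (ℝ × E₁ × E₂) →L[ℝ] ℝ) a b)
    (h1 R) (h1 R)).trans (hg.inner_apply _ _ _)).trans_le ?_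
  refine le_of_le_of_eq ?_
    (congrArg (((1 : ℝ≥0) : ℝ) ^ 2 * ·) (SmoothMetric.line_inner r R R).symm)
  have aux : ∀ (a b c : ℝ) (B₁ : E₁ →L[ℝ] E₁ →L[ℝ] ℝ) (B₂ : E₂ →L[ℝ] E₂ →L[ℝ] ℝ),
      c + a * B₁ 0 0 + b * B₂ 0 0 ≤ ((1 : ℝ≥0) : ℝ) ^ 2 * c := by simp
  exact aux _ _ _ _ _

theorem edist_fiber_le (hg : IsWarpedMetric α β g₁ g₂ g) {t : ℝ} (ht : α t ≠ 0) (θ θ' : M₁)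
    (p : M₂) : g.edist (t, θ, p) (t, θ', p) ≤ ‖α t‖₊ * g₁.edist θ θ' := by
  refine SmoothMetric.edist_map_le g₁ g
    (f := fun θ : M₁ => (t, θ, p))
    (contMDiff_const.prodMk (contMDiff_id.prodMk contMDiff_const)) (nnnorm_pos.2 ht)
    (fun r R => ?_) θ θ'
  have h1 := mfderiv_warped_fiber (I₁ := I₁) (I₂ := I₂) t r p
  refine ((congrArg₂ (fun a b : ℝ × E₁ × E₂ =>
    (g.inner (t, r, p) : (ℝ × E₁ × E₂) →L[ℝ] (ℝ × E₁ × E₂) →L[ℝ] ℝ) a b)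
    (h1 R) (h1 R)).trans (hg.inner_apply _ _ _)).trans_le ?_
  have aux : ∀ (a b : ℝ) (R : E₁) (B₁ : E₁ →L[ℝ] E₁ →L[ℝ] ℝ) (B₂ : E₂ →L[ℝ] E₂ →L[ℝ] ℝ),
      (0 : ℝ) * 0 + a ^ 2 * B₁ R R + b ^ 2 * B₂ 0 0 ≤ (‖a‖₊ : ℝ) ^ 2 * B₁ R R := by simp
  exact aux _ _ _ _ _

/-- The bound from below holds because t is 1-Lipschitz; the coordinate line through `o` attains it.
-/
theorem edistSet_eq (hg : IsWarpedMetric α β g₁ g₂ g) (o : ℝ × M₁ × M₂) (t : ℝ) :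
    g.edistSet o {x | x.1 = t} = ENNReal.ofReal |o.1 - t| := by
  refine le_antisymm ((iInf₂_le (f := fun y (_ : y ∈ {x : ℝ × M₁ × M₂ | x.1 = t}) =>
    g.edist o y) (t, o.2) rfl).trans (hg.edist_line_le o.1 t o.2)) ?_
  refine le_iInf₂ fun x hx => ?_
  have hx : x.1 = t := hx
  rw [← hx]
  exact hg.abs_fst_sub_le o x

/-- A Cauchy sequence is Cauchy in t, and in M₂ because β ≥ b > 0. There is no such control in M₁,
as α may tend to 0; compactness provides a subsequence there, and a Cauchy sequence with a
convergent subsequence converges. -/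
theorem isComplete [CompactSpace M₁] [FirstCountableTopology M₁] [RegularSpace M₁]
    [RegularSpace M₂] (hg : IsWarpedMetric α β g₁ g₂ g) {b : ℝ≥0} (hb : 0 < b)
    (hβ : ∀ t, b ≤ β t) (h₂ : g₂.IsComplete) : g.IsComplete := by
  intro u hu
  have hcauchy : CauchySeq fun i => (u i).1 := by
    refine Metric.cauchySeq_iff.2 fun ε hε => ?_
    obtain ⟨K, hK⟩ := hu (ENNReal.ofReal ε) (by simpa using hε)
    refine ⟨K, fun i hi j hj => ?_⟩
    have := (hg.abs_fst_sub_le (u i) (u j)).trans_lt (hK i hi j hj)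
    rw [Real.dist_eq]
    exact (ENNReal.ofReal_lt_ofReal_iff hε).1 this
  obtain ⟨t, ht⟩ := cauchySeq_tendsto_of_complete hcauchy
  obtain ⟨p, hp⟩ := h₂ (fun i => (u i).2.2) fun ε hε => by
    obtain ⟨K, hK⟩ := hu (b * ε) (by
      refine ENNReal.mul_pos ?_ hε.ne'
      exact_mod_cast hb.ne')
    refine ⟨K, fun i hi j hj => ?_⟩
    have := (hg.edist_snd_snd_le hb hβ (u i) (u j)).trans_lt (hK i hi j hj)
    exact lt_of_mul_lt_mul_left' this
  rw [g₂.tendsto_edist_iff] at hp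
  obtain ⟨θ, σ, hσ, hθ⟩ := CompactSpace.tendsto_subseq fun i => (u i).2.1
  have hlim : Tendsto (u ∘ σ) atTop (𝓝 (t, θ, p)) :=
    (ht.comp hσ.tendsto_atTop).prodMk_nhds (hθ.prodMk_nhds (hp.comp hσ.tendsto_atTop))
  rw [← g.tendsto_edist_iff] at hlim
  refine ⟨(t, θ, p), ENNReal.tendsto_nhds_zero.2 fun ε hε => ?_⟩
  have hε2 : 0 < ε / 2 := ENNReal.half_pos hε.ne'
  obtain ⟨K, hK⟩ := hu (ε / 2) hε2
  have hsub := ENNReal.tendsto_nhds_zero.1 hlim (ε / 2) hε2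
  filter_upwards [hsub, eventually_ge_atTop K] with i hi hiK
  calc g.edist (u i) (t, θ, p) ≤ g.edist (u i) (u (σ i)) + g.edist (u (σ i)) (t, θ, p) :=
        g.edist_triangle _ _ _
    _ ≤ ε / 2 + ε / 2 := add_le_add (hK i hiK _ (hiK.trans hσ.le_apply)).le hi
    _ = ε := ENNReal.add_halves ε

end IsWarpedMetric

end WarpedDistance

/-! ### Topology of ℝ × K for compact connected K -/

section Ends

variable {K : Type*} [TopologicalSpace K]

theorem isConnected_fst_preimage [ConnectedSpace K] {S : Set ℝ} (hS : IsConnected S) :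
    IsConnected {x : ℝ × K | x.1 ∈ S} := by
  have h : {x : ℝ × K | x.1 ∈ S} = S ×ˢ univ := by
    ext
    simp
  exact h ▸ hS.prod isConnected_univ

theorem isCompact_fst_preimage [CompactSpace K] {S : Set ℝ} (hS : IsCompact S) :
    IsCompact {x : ℝ × K | x.1 ∈ S} := by
  have h : {x : ℝ × K | x.1 ∈ S} = S ×ˢ univ := by
    ext
    simp
  exact h ▸ hS.prod isCompact_univ

theorem exists_isOpen_isConnected_compl_slice [ConnectedSpace K] (t : ℝ) :
    ∃ U V : Set (ℝ × K), IsOpen U ∧ IsOpen V ∧ IsConnected U ∧ IsConnected V ∧ Disjoint U V ∧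
      U ∪ V = {x : ℝ × K | x.1 = t}ᶜ := by
  refine ⟨{x | x.1 ∈ Iio t}, {x | x.1 ∈ Ioi t}, isOpen_Iio.preimage continuous_fst,
    isOpen_Ioi.preimage continuous_fst, isConnected_fst_preimage isConnected_Iio,
    isConnected_fst_preimage isConnected_Ioi, ?_, ?_⟩
  · exact Set.disjoint_left.2 fun x hx hx' => lt_asymm (a := x.1) (b := t) hx hx'
  · ext x
    exact (ne_iff_lt_or_gt (a := x.1) (b := t)).symm

theorem exists_abs_fst_le {C : Set (ℝ × K)} (hC : IsCompact C) :
    ∃ R : ℝ, 0 < R ∧ ∀ x ∈ C, |x.1| ≤ R := by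
  obtain ⟨R, hR⟩ := (hC.image continuous_fst).isBounded.exists_norm_le
  exact ⟨max R 1, by positivity, fun x hx => (hR _ ⟨x, hx, rfl⟩).trans (le_max_left _ _)⟩

/-- A compact set lies in a slab |t| ≤ R. A component of its complement without compact closure
leaves the slab, hence contains one of the two half-cylinders, so there are at most two. Removing
the slice t = 0 attains this. -/
theorem numberOfEnds_real_prod [CompactSpace K] [ConnectedSpace K] :
    numberOfEnds (ℝ × K) = 2 := by
  obtain ⟨k⟩ := (inferInstance : Nonempty K)
  refine le_antisymm (iSup₂_le fun C hC => ?_) ?_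
  · obtain ⟨R, -, hR⟩ := exists_abs_fst_le hC
    have hsub : ∀ S : Set ℝ, (∀ s ∈ S, R < |s|) → {x : ℝ × K | x.1 ∈ S} ⊆ Cᶜ :=
      fun S hS x hx hxC => (hS _ hx).not_ge (hR x hxC)
    refine (encard_le_encard (t := {connectedComponentIn Cᶜ (R + 1, k),
      connectedComponentIn Cᶜ (-(R + 1), k)}) ?_).trans ((encard_insert_le _ _).trans (by
      rw [encard_singleton, one_add_one_eq_two]))
    rintro D ⟨⟨x, hx, rfl⟩, hD⟩
    have hex : ∃ y ∈ connectedComponentIn Cᶜ x, R < |y.1| := by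
      by_contra! hcon
      refine hD ((isCompact_fst_preimage isCompact_Icc (K := K)).of_isClosed_subset isClosed_closure
        (closure_minimal (fun y hy => ?_) ((isClosed_Icc (a := -R) (b := R)).preimage
          continuous_fst)))
      exact abs_le.1 (hcon y hy)
    obtain ⟨y, hy, hRy⟩ := hex
    rw [connectedComponentIn_eq hy]
    rcases lt_abs.1 hRy with h | h
    · refine Or.inl (connectedComponentIn_eq ?_)
      refine (isConnected_fst_preimage (K := K) isConnected_Ioi).isPreconnected.subset_connectedComponentIn
        (x := y) h (hsub (Ioi R) fun s hs => lt_abs.2 (Or.inl hs)) ?_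
      exact lt_add_one R
    · refine Or.inr (connectedComponentIn_eq ?_)
      refine (isConnected_fst_preimage (K := K) isConnected_Iio).isPreconnected.subset_connectedComponentIn
        (x := y) (lt_neg_of_lt_neg h) (hsub (Iio (-R)) fun s hs => lt_abs.2 (Or.inr
          (lt_neg_of_lt_neg hs))) ?_
      exact neg_lt_neg (lt_add_one R)
  · have hC : IsCompact {x : ℝ × K | x.1 ∈ ({0} : Set ℝ)} := isCompact_fst_preimage isCompact_singleton
    refine le_trans ?_ (le_iSup₂ (f := fun (C : Set (ℝ × K)) (_ : IsCompact C) =>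
      Set.encard {D : Set (ℝ × K) | (∃ x ∈ Cᶜ, D = connectedComponentIn Cᶜ x) ∧
        ¬ IsCompact (closure D)}) _ hC)
    set U : Set (ℝ × K) := {x : ℝ × K | x.1 ∈ ({0} : Set ℝ)}ᶜ with hU
    have hmem : ∀ x : ℝ × K, x ∈ U ↔ x.1 ≠ 0 := fun x => Iff.rfl
    have hpos : {x : ℝ × K | x.1 ∈ Ioi 0} ⊆ connectedComponentIn U (1, k) :=
      (isConnected_fst_preimage isConnected_Ioi).isPreconnected.subset_connectedComponentIn
        (one_pos : (0 : ℝ) < 1) fun x hx => (ne_of_gt hx : x.1 ≠ 0)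
    have hneg : {x : ℝ × K | x.1 ∈ Iio 0} ⊆ connectedComponentIn U (-1, k) :=
      (isConnected_fst_preimage isConnected_Iio).isPreconnected.subset_connectedComponentIn
        (neg_one_lt_zero : (-1 : ℝ) < 0) fun x hx => (ne_of_lt hx : x.1 ≠ 0)
    have hne : connectedComponentIn U (1, k) ≠ connectedComponentIn U (-1, k) := by
      intro h
      have h1 : (-1, k) ∈ connectedComponentIn U (1, k) :=
        h ▸ mem_connectedComponentIn (show ((-1 : ℝ), k) ∈ U from by simp [hmem])
      have h2 : (1, k) ∈ connectedComponentIn U (1, k) :=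
        mem_connectedComponentIn (show ((1 : ℝ), k) ∈ U from by simp [hmem])
      have h3 := isPreconnected_connectedComponentIn.intermediate_value h1 h2
        (f := fun x : ℝ × K => x.1) continuous_fst.continuousOn
      obtain ⟨z, hz, hz0⟩ := h3 (show (0 : ℝ) ∈ Icc (-1) 1 from by simp)
      exact connectedComponentIn_subset U _ hz hz0
    rw [← encard_pair hne]
    refine encard_le_encard ?_
    rintro D (rfl | rfl)
    · refine ⟨⟨_, by simp [hmem], rfl⟩, fun hcpt => ?_⟩
      obtain ⟨R, hR0, hR⟩ := exists_abs_fst_le hcpt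
      have := hR (R + 1, k) (subset_closure (hpos (show (0 : ℝ) < R + 1 by positivity)))
      have := (le_abs_self (R + 1)).trans this
      linarith
    · refine ⟨⟨_, by simp [hmem], rfl⟩, fun hcpt => ?_⟩
      obtain ⟨R, hR0, hR⟩ := exists_abs_fst_le hcpt
      have := hR (-(R + 1), k) (subset_closure (hneg (neg_lt_zero.2 (add_pos hR0 one_pos))))
      have := (neg_le_abs (-(R + 1))).trans this
      linarith

/-- If the image of one line stayed below level `s`, connectedness would keep both ends of ℝ × K
below |s|, and the compact middle part is bounded too; then the homeomorphism would not be
surjective. -/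
theorem not_bddAbove_fst_homeomorph [CompactSpace K] [ConnectedSpace K] {K' : Type*}
    [TopologicalSpace K'] [CompactSpace K'] (F : ℝ × K ≃ₜ ℝ × K') (s : ℝ) (k : K) :
    ¬ ∀ t : ℝ, (F (t, k)).1 < s := by
  intro h
  have hcont : Continuous fun x => (F x).1 := continuous_fst.comp F.continuous
  obtain ⟨T, hT, hTs⟩ := exists_abs_fst_le
    (F.isCompact_preimage.2 (isCompact_fst_preimage (K := K') (isCompact_Icc (a := -|s|) (b := |s|))))
  -- The preimage of the slab |t| ≤ |s| lies in |t| ≤ T, so on a connected set beyond T the first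
  -- coordinate of F cannot take the value |s|.
  have hend : ∀ S : Set ℝ, IsConnected S → (∀ r ∈ S, T < |r|) → ∀ x : ℝ × K, x.1 ∈ S →
      (F x).1 < |s| := by
    intro S hS hST x hx
    by_contra! hcon
    have hiv := (isConnected_fst_preimage (K := K) hS).isPreconnected.intermediate_value
      (show (x.1, k) ∈ {x : ℝ × K | x.1 ∈ S} from hx) hx hcont.continuousOn
    obtain ⟨z, hz, hzs⟩ := hiv ⟨((h x.1).trans_le (le_abs_self s)).le, hcon⟩
    refine (hST _ hz).not_ge (hTs z ?_)
    have hzs : (F z).1 = |s| := hzs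
    exact ⟨(neg_nonpos.2 (abs_nonneg s)).trans ((abs_nonneg s).trans hzs.ge), hzs.le⟩
  obtain ⟨B, hB⟩ := ((isCompact_fst_preimage (K := K) (isCompact_Icc (a := -T) (b := T))).image
    hcont).bddAbove
  obtain ⟨x, hx⟩ := F.surjective (max |s| B + 1, (F (0, k)).2)
  have hx1 : (F x).1 = max |s| B + 1 := by rw [hx]
  have h1 := le_max_left |s| B
  have h2 := le_max_right |s| B
  by_cases hxT : x.1 ∈ Icc (-T) T
  · have := hB ⟨x, hxT, rfl⟩
    linarith
  · have hxT' : T < |x.1| := by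
      by_contra! hcon
      exact hxT (abs_le.1 hcon)
    rcases lt_abs.1 hxT' with h' | h'
    · have := hend (Ioi T) isConnected_Ioi (fun r hr => lt_abs.2 (Or.inl hr)) x h'
      linarith
    · have := hend (Iio (-T)) isConnected_Iio
        (fun r hr => lt_abs.2 (Or.inr (lt_neg_of_lt_neg hr))) x (lt_neg_of_lt_neg h')
      linarith

/-- A homeomorphism `ℝ × K ≃ ℝ × K'` carries some point of each line `ℝ × {k}` to the slice
`{s} × K'`. -/
theorem exists_fst_eq_of_homeomorph [CompactSpace K] [ConnectedSpace K] {K' : Type*}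
    [TopologicalSpace K'] [CompactSpace K'] (F : ℝ × K ≃ₜ ℝ × K') (s : ℝ) (k : K) :
    ∃ t : ℝ, (F (t, k)).1 = s := by
  have h1 := not_bddAbove_fst_homeomorph F s k
  -- Reversing ℝ in the target gives values at most `s` on the line; the intermediate value theorem
  -- finishes.
  have h2 := not_bddAbove_fst_homeomorph
    (F.trans ((Homeomorph.neg ℝ).prodCongr (Homeomorph.refl K'))) (-s) k
  push Not at h1
  obtain ⟨a, ha⟩ := h1
  have h2' : ∃ t, (F (t, k)).1 ≤ s := by
    by_contra! hcon
    exact h2 fun t => neg_lt_neg (hcon t)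
  obtain ⟨b, hb⟩ := h2'
  exact mem_range_of_exists_le_of_exists_ge
    (f := fun t : ℝ => (F (t, k)).1) (by fun_prop) ⟨b, hb⟩ ⟨a, ha⟩

end Ends

/-! ### The circle does not lift to the line -/

section CircleSections

/-- For a section s, the continuous function (s(e^{ix}) - x)/2π is integer-valued and drops by 1
from x = 0 to x = 2π. -/
theorem not_continuous_section_circleExp {s : Circle → ℝ} (hs : Continuous s) :
    ¬ ∀ z, Circle.exp (s z) = z := by
  intro h
  have hcont : Continuous fun x : ℝ => (s (Circle.exp x) - x) / (2 * Real.pi) := by fun_prop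
  have hint : ∀ x : ℝ, ∃ k : ℤ, (s (Circle.exp x) - x) / (2 * Real.pi) = k := by
    intro x
    obtain ⟨k, hk⟩ := Circle.exp_eq_exp.1 (h (Circle.exp x))
    refine ⟨k, ?_⟩
    rw [hk]
    field_simp
    ring
  have h2 : Circle.exp (2 * Real.pi) = Circle.exp 0 := by simp
  have hiv := intermediate_value_Icc' Real.two_pi_pos.le hcont.continuousOn
  rw [h2, sub_zero, sub_div, div_self Real.two_pi_pos.ne'] at hiv
  obtain ⟨x, -, hx⟩ := hiv (show s (Circle.exp 0) / (2 * Real.pi) - 1 / 2 ∈ _ from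
    ⟨by linarith, by linarith⟩)
  obtain ⟨k, hk⟩ := hint x
  obtain ⟨l, hl⟩ := hint 0
  rw [sub_zero] at hl
  simp only at hx
  rw [hk, hl] at hx
  have : (2 * k : ℝ) = 2 * l - 1 := by linarith
  have : 2 * k = 2 * l - 1 := by exact_mod_cast this
  omega

theorem exists_continuous_circleExp_lift {E : Type*} [NormedAddCommGroup E] [NormedSpace ℝ E]
    {f : E → Circle} (hf : Continuous f) :
    ∃ F : E → ℝ, Continuous F ∧ ∀ x, Circle.exp (F x) = f x := by
  obtain ⟨e, he⟩ := Circle.exp_surjective (f 0)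
  obtain ⟨F, ⟨-, hF⟩, -⟩ := Circle.isCoveringMap_exp.existsUnique_continuousMap_lifts
    ⟨f, hf⟩ 0 e he
  exact ⟨F, F.continuous, congrFun hF⟩

/-- A coordinate ball is homeomorphic to the whole model space. Continuity of `f` on all of E is
what allows lifting through the simply connected E. -/
theorem exists_euclidean_nhds {E N : Type*} [NormedAddCommGroup E] [InnerProductSpace ℝ E]
    [TopologicalSpace N] [ChartedSpace E N] (p : N) :
    ∃ U : Set N, IsOpen U ∧ p ∈ U ∧ ∃ (f : E → N) (r : N → E), Continuous f ∧
      ContinuousOn r U ∧ ∀ q ∈ U, f (r q) = q := by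
  set e := chartAt E p
  obtain ⟨δ, hδ, hball⟩ := Metric.isOpen_iff.1 e.open_target (e p) (mem_chart_target E p)
  set b := OpenPartialHomeomorph.univBall (e p) δ
  have hbt : b.target = Metric.ball (e p) δ := OpenPartialHomeomorph.univBall_target _ hδ
  have hbs : b.source = univ := OpenPartialHomeomorph.univBall_source _ _
  refine ⟨e.source ∩ e ⁻¹' Metric.ball (e p) δ, e.isOpen_inter_preimage Metric.isOpen_ball,
    ⟨mem_chart_source E p, Metric.mem_ball_self hδ⟩, fun y => e.symm (b y), fun q => b.symm (e q),
    ?_, ?_, ?_⟩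
  · refine e.continuousOn_symm.comp_continuous
      (OpenPartialHomeomorph.continuous_univBall (e p) δ) fun y => hball ?_
    rw [← hbt]
    exact b.map_source (hbs ▸ mem_univ y)
  · exact (OpenPartialHomeomorph.continuousOn_univBall_symm (e p) δ).comp
      (e.continuousOn.mono inter_subset_left) fun q hq => hq.2
  · intro q hq
    simp only
    rw [b.right_inv (hbt ▸ hq.2), e.left_inv hq.1]

/-- A continuous map to the circle has no section over the circle through a set that is
contractible in its domain. -/
theorem not_section_of_euclidean {E N : Type*} [NormedAddCommGroup E] [NormedSpace ℝ E]
    [TopologicalSpace N] {U : Set N} {f : E → N} {r : N → E} (hf : Continuous f)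
    (hr : ContinuousOn r U) (hfr : ∀ q ∈ U, f (r q) = q) {ψ : ℝ × N → Circle}
    (hψ : Continuous ψ) {c : Circle → ℝ × N} (hc : Continuous c) (hcU : ∀ z, (c z).2 ∈ U) :
    ¬ ∀ z, ψ (c z) = z := by
  intro h
  -- Pulled back to ℝ × E, ψ has a real-valued argument L; composed with a section through U it
  -- would be a section of the exponential.
  obtain ⟨L, hL, hLψ⟩ := exists_continuous_circleExp_lift (E := ℝ × E)
    (f := fun x => ψ (x.1, f x.2)) (by fun_prop)
  refine not_continuous_section_circleExp (s := fun z => L ((c z).1, r (c z).2)) ?_ fun z => ?_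
  · exact hL.comp ((continuous_fst.comp hc).prodMk
      (hr.comp_continuous (continuous_snd.comp hc) hcU))
  · rw [hLψ]
    simp only
    rw [hfr _ (hcU z), Prod.mk.eta, h]

theorem nontrivial_of_chartedSpace (E N : Type*) [NormedAddCommGroup E] [NormedSpace ℝ E]
    [Nontrivial E] [TopologicalSpace N] [ChartedSpace E N] [Nonempty N] : Nontrivial N := by
  obtain ⟨p⟩ := (inferInstance : Nonempty N)
  have : (𝓝[≠] (chartAt E p p)).NeBot := Module.punctured_nhds_neBot ℝ E _
  obtain ⟨y, hy, hne⟩ := (infinite_of_mem_nhds _ ((chartAt E p).open_target.mem_nhds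
    (mem_chart_target E p))).nontrivial.exists_ne (chartAt E p p)
  refine ⟨(chartAt E p).symm y, p, fun h => hne ?_⟩
  rw [← (chartAt E p).right_inv hy, h]

end CircleSections

/-! ### Distances in dt² ⊕ β²h -/

section LineWarped

open scoped NNReal

variable {d : ℕ} {N : Type*} [TopologicalSpace N] [ChartedSpace (EuclideanSpace ℝ (Fin d)) N]
  [IsManifold (𝓡 d) ∞ N] {β : ℝ → ℝ} {h : SmoothMetric (𝓡 d) N}
  {g : SmoothMetric (lineModel d) (ℝ × N)}

namespace IsLineWarpedMetric

theorem inner_apply (hg : IsLineWarpedMetric β h g) (x : ℝ × N)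
    (X Y : ℝ × EuclideanSpace ℝ (Fin d)) :
    (g.inner x : (ℝ × EuclideanSpace ℝ (Fin d)) →L[ℝ] (ℝ × EuclideanSpace ℝ (Fin d)) →L[ℝ] ℝ) X Y =
      X.1 * Y.1 + β x.1 ^ 2 * (h.inner x.2 :
        EuclideanSpace ℝ (Fin d) →L[ℝ] EuclideanSpace ℝ (Fin d) →L[ℝ] ℝ) X.2 Y.2 := by
  have h1 : ∀ X : ℝ × EuclideanSpace ℝ (Fin d),
      SmoothMetric.differential (lineModel d) (fun q : ℝ × N => q.1) x X = X.1 := fun X =>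
    DFunLike.congr_fun (mfderiv_fst (I := 𝓘(ℝ, ℝ)) (I' := 𝓡 d) (x := x)) X
  have h2 : ∀ X : ℝ × EuclideanSpace ℝ (Fin d),
      (mfderiv (lineModel d) (𝓡 d) (fun q : ℝ × N => q.2) x X : EuclideanSpace ℝ (Fin d)) = X.2 :=
    fun X => DFunLike.congr_fun (mfderiv_snd (I := 𝓘(ℝ, ℝ)) (I' := 𝓡 d) (x := x)) X
  exact (hg x X Y).trans (congrArg₂ (· + ·) (congrArg₂ (· * ·) (h1 X) (h1 Y))
    (congrArg (β x.1 ^ 2 * ·) (congrArg₂ (fun a b : EuclideanSpace ℝ (Fin d) =>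
      (h.inner x.2 : EuclideanSpace ℝ (Fin d) →L[ℝ] EuclideanSpace ℝ (Fin d) →L[ℝ] ℝ) a b)
      (h2 X) (h2 Y))))

theorem edist_fiber_le (hg : IsLineWarpedMetric β h g) {t : ℝ} (ht : β t ≠ 0) (p q : N) :
    g.edist (t, p) (t, q) ≤ ‖β t‖₊ * h.edist p q := by
  refine SmoothMetric.edist_map_le h g (f := fun p : N => (t, p))
    (contMDiff_const.prodMk contMDiff_id) (nnnorm_pos.2 ht) (fun r R => ?_) p q
  have h1 : (mfderiv (𝓡 d) (lineModel d) (fun p : N => (t, p)) r R :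
      ℝ × EuclideanSpace ℝ (Fin d)) = (0, R) :=
    DFunLike.congr_fun (mfderiv_prod_right (I := 𝓘(ℝ, ℝ)) (I' := 𝓡 d) (x₀ := t) (y₀ := r)) R
  refine ((congrArg₂ (fun a b : ℝ × EuclideanSpace ℝ (Fin d) =>
    (g.inner (t, r) : (ℝ × EuclideanSpace ℝ (Fin d)) →L[ℝ]
      (ℝ × EuclideanSpace ℝ (Fin d)) →L[ℝ] ℝ) a b)
    h1 h1).trans (hg.inner_apply _ _ _)).trans_le ?_
  have aux : ∀ (a s : ℝ), (0 : ℝ) * 0 + a ^ 2 * s ≤ (‖a‖₊ : ℝ) ^ 2 * s := by simp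
  exact aux _ _

theorem edist_snd_le (hg : IsLineWarpedMetric (fun _ => 1) h g) (x y : ℝ × N) :
    h.edist x.2 y.2 ≤ g.edist x y := by
  refine (SmoothMetric.edist_map_le g h (f := fun q : ℝ × N => q.2) contMDiff_snd one_pos
    (fun z Z => ?_) x y).trans (by simp)
  have h1 : (mfderiv (lineModel d) (𝓡 d) (fun q : ℝ × N => q.2) z Z : EuclideanSpace ℝ (Fin d)) =
      (Z : ℝ × EuclideanSpace ℝ (Fin d)).2 :=
    DFunLike.congr_fun (mfderiv_snd (I := 𝓘(ℝ, ℝ)) (I' := 𝓡 d) (x := z)) Z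
  refine (congrArg₂ (fun a b : EuclideanSpace ℝ (Fin d) => (h.inner z.2 :
    EuclideanSpace ℝ (Fin d) →L[ℝ] EuclideanSpace ℝ (Fin d) →L[ℝ] ℝ) a b) h1 h1).trans_le ?_
  refine le_of_le_of_eq ?_ (congrArg (((1 : ℝ≥0) : ℝ) ^ 2 * ·) (hg.inner_apply z Z Z).symm)
  have aux : ∀ (a s : ℝ), s ≤ ((1 : ℝ≥0) : ℝ) ^ 2 * (a * a + 1 ^ 2 * s) := by
    intro a s
    simp [mul_self_nonneg]
  exact aux _ _

end IsLineWarpedMetric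

end LineWarped

/-! ### The two obstructions to an isometry -/

section NonIsometry

open scoped NNReal

variable {n d : ℕ} {N N' : Type*} [TopologicalSpace N] [ChartedSpace (EuclideanSpace ℝ (Fin n)) N]
  [IsManifold (𝓡 n) ∞ N] {α β β' : ℝ → ℝ} {h : SmoothMetric (𝓡 n) N}
  {g : SmoothMetric (lineCircleModel n) (ℝ × Circle × N)}
  [TopologicalSpace N'] [T2Space N'] [CompactSpace N']
  [ChartedSpace (EuclideanSpace ℝ (Fin d)) N'] [IsManifold (𝓡 d) ∞ N']
  {h' : SmoothMetric (𝓡 d) N'} {g' : SmoothMetric (lineModel d) (ℝ × N')}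
  [T2Space N] [CompactSpace N] [ConnectedSpace N]

/-- For p ≠ q in N, the lines over (1,p) and (1,q) both meet the preimage of the slice s, whose
diameter is at most β'(s) times that of N' in absolute value. This tends to 0 as s → -∞, although
points of the two lines are at distance at least b·d(p,q). -/
theorem not_isIsometricTo_of_collapsing [Nontrivial N]
    (hg : IsWarpedMetric α β circleMetric h g) {b : ℝ≥0} (hb : 0 < b) (hβ : ∀ t, b ≤ β t)
    (hg' : IsLineWarpedMetric β' h' g') (hβ0 : ∀ t, β' t ≠ 0) (hβ' : Tendsto β' atBot (𝓝 0)) :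
    ¬ g.IsIsometricTo g' := by
  rintro ⟨F, hF⟩
  obtain ⟨p, q, hpq⟩ := exists_pair_ne N
  have : ConnectedSpace N' :=
    (Prod.snd_surjective.comp F.surjective).connectedSpace (continuous_snd.comp F.continuous)
  obtain ⟨D, hD⟩ := h'.exists_edist_le
  have hle : ∀ s : ℝ, b * h.edist p q ≤ ‖β' s‖₊ * D := by
    intro s
    obtain ⟨t₁, ht₁⟩ := exists_fst_eq_of_homeomorph F.toHomeomorph s ((1 : Circle), p)
    obtain ⟨t₂, ht₂⟩ := exists_fst_eq_of_homeomorph F.toHomeomorph s ((1 : Circle), q)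
    have h1 := hg.edist_snd_snd_le hb hβ (t₁, 1, p) (t₂, 1, q)
    rw [← SmoothMetric.edist_eq_of_isometry g g' F (fun x X => hF x X X)] at h1
    have h2 := hg'.edist_fiber_le (hβ0 s) (F (t₁, 1, p)).2 (F (t₂, 1, q)).2
    have e₁ : F (t₁, 1, p) = (s, (F (t₁, 1, p)).2) := Prod.ext ht₁ rfl
    have e₂ : F (t₂, 1, q) = (s, (F (t₂, 1, q)).2) := Prod.ext ht₂ rfl
    rw [← e₁, ← e₂] at h2
    exact h1.trans (h2.trans (by gcongr; exact hD _ _))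
  have hpos : 0 < b * h.edist p q :=
    ENNReal.mul_pos (by exact_mod_cast hb.ne') (h.edist_pos hpq).ne'
  have hlim : Tendsto (fun s => (‖β' s‖₊ : ℝ≥0∞) * D) atBot (𝓝 0) := by
    have h1 : Tendsto (fun s => ‖β' s‖₊ * D) atBot (𝓝 0) := by
      simpa using (hβ'.nnnorm.mul_const D)
    simpa only [ENNReal.coe_mul, ENNReal.coe_zero] using ENNReal.tendsto_coe.2 h1
  exact hpos.not_ge (ge_of_tendsto' hlim hle)

/-- The image of a sufficiently short circle {t} × S¹ × {p} has projection to N' inside one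
coordinate ball, so the circle coordinate has a real-valued lift along it; but that coordinate is
the identity of S¹. -/
theorem not_isIsometricTo_of_short_circles
    (hg : IsWarpedMetric α β circleMetric h g) (hα0 : ∀ t, α t ≠ 0)
    (hα : Tendsto α atBot (𝓝 0)) (hg' : IsLineWarpedMetric (fun _ => 1) h' g') :
    ¬ g.IsIsometricTo g' := by
  rintro ⟨F, hF⟩
  obtain ⟨p⟩ := (inferInstance : Nonempty N)
  choose U hUo hU f r hf hr hfr using
    exists_euclidean_nhds (E := EuclideanSpace ℝ (Fin d)) (N := N')
  -- A Lebesgue number for the cover of N' by coordinate balls.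
  obtain ⟨δ, hδ, hleb⟩ : ∃ δ > 0, ∀ x, ∃ i, ∀ y, h'.edist y x < δ → y ∈ U i := by
    let := h'.toPseudoEMetricSpace
    obtain ⟨δ, hδ, hx⟩ := lebesgue_number_lemma_of_emetric (isCompact_univ (X := N')) hUo
      fun x _ => mem_iUnion.2 ⟨x, hU x⟩
    exact ⟨δ, hδ, fun x => (hx x (mem_univ x)).imp fun i hi y hy => hi hy⟩
  obtain ⟨D, hD⟩ := circleMetric.exists_edist_le
  have hlim : Tendsto (fun s => (‖α s‖₊ : ℝ≥0∞) * D) atBot (𝓝 0) := by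
    have h1 : Tendsto (fun s => ‖α s‖₊ * D) atBot (𝓝 0) := by
      simpa using (hα.nnnorm.mul_const D)
    simpa only [ENNReal.coe_mul, ENNReal.coe_zero] using ENNReal.tendsto_coe.2 h1
  obtain ⟨t, ht⟩ := (hlim.eventually_lt_const hδ).exists
  obtain ⟨i, hi⟩ := hleb (F (t, 1, p)).2
  refine not_section_of_euclidean (hf i) (hr i) (hfr i) (ψ := fun x => (F.symm x).2.1) ?_
    (c := fun z => F (t, z, p)) ?_ (fun z => hi _ ?_) fun z => ?_
  · exact continuous_fst.comp (continuous_snd.comp F.symm.continuous)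
  · exact F.continuous.comp (by fun_prop)
  · refine (hg'.edist_snd_le _ _).trans_lt ?_
    rw [SmoothMetric.edist_eq_of_isometry g g' F (fun x X => hF x X X)]
    refine (hg.edist_fiber_le (hα0 t) z 1 p).trans_lt (lt_of_le_of_lt ?_ ht)
    gcongr
    exact hD _ _
  · simp

end NonIsometry

/-! ### Bakry-Émery tensor, mean curvature and scalar curvature of the examples -/

section LineCircleCurvature

variable {d : ℕ} {N : Type*} [TopologicalSpace N] [ChartedSpace (EuclideanSpace ℝ (Fin d)) N]
  [IsManifold (𝓡 d) ∞ N] {α β φ : ℝ → ℝ} {h : SmoothMetric (𝓡 d) N}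
  {g : SmoothMetric (lineCircleModel d) (ℝ × Circle × N)}

namespace IsWarpedMetric

/-- `h₀`, `h₁` and `h₂` are the coefficients of dt², dθ² and h. The constant `e` is the negative of
the Einstein constant that N would need for equality. -/
theorem bakryEmeryRicci_eq (hg : IsWarpedMetric α β circleMetric h g) {m : ℝ≥0∞} {e : ℝ}
    (hφ : ContDiff ℝ ∞ φ) (hα : ContDiff ℝ ∞ α) (hβ : ContDiff ℝ ∞ β) (hα0 : ∀ t, α t ≠ 0)
    (hβ0 : ∀ t, β t ≠ 0) (x : ℝ × Circle × N)
    (h₀ : -(deriv (deriv α) x.1 / α x.1 + d * (deriv (deriv β) x.1 / β x.1)) +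
      deriv (deriv φ) x.1 - (m⁻¹).toReal * deriv φ x.1 ^ 2 = -1)
    (h₁ : -(deriv (deriv α) x.1 / α x.1 + d * (deriv α x.1 / α x.1 * (deriv β x.1 / β x.1))) +
      deriv φ x.1 * (deriv α x.1 / α x.1) = -1)
    (h₂ : -(β x.1 * deriv (deriv β) x.1 + (d - 1) * deriv β x.1 ^ 2 +
      β x.1 * deriv β x.1 * (deriv α x.1 / α x.1)) + deriv φ x.1 * (β x.1 * deriv β x.1) =
        e - β x.1 ^ 2)
    (X Y : ℝ × EuclideanSpace ℝ (Fin 1) × EuclideanSpace ℝ (Fin d)) :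
    g.bakryEmeryRicci (fun q => φ q.1) m x X Y =
      -((g.inner x : (ℝ × EuclideanSpace ℝ (Fin 1) × EuclideanSpace ℝ (Fin d)) →L[ℝ]
        (ℝ × EuclideanSpace ℝ (Fin 1) × EuclideanSpace ℝ (Fin d)) →L[ℝ] ℝ) X Y) +
      (h.ricci x.2.2 X.2.2 Y.2.2 + e * (h.inner x.2.2 :
        EuclideanSpace ℝ (Fin d) →L[ℝ] EuclideanSpace ℝ (Fin d) →L[ℝ] ℝ) X.2.2 Y.2.2) := by
  have hd := differential_comp_fst (I₁ := 𝓡 1) (I₂ := 𝓡 d) (hφ.differentiable (by simp)) x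
  have hr := hg.ricci_eq hα hβ hα0 hβ0 x X Y
  have hh := hg.hessian_eq hφ hα hβ hα0 hβ0 x X Y
  rw [ricci_circleMetric, finrank_euclideanSpace_fin, finrank_euclideanSpace_fin] at hr
  refine (congrArg₂ (· - ·) (congrArg₂ (· + ·) hr hh)
    (congrArg ((m⁻¹).toReal * ·) (congrArg₂ (· * ·) (hd X) (hd Y)))).trans ?_
  rw [hg.inner_apply]
  set A := deriv (deriv α) x.1 / α x.1
  have hA : α x.1 * deriv (deriv α) x.1 = α x.1 ^ 2 * A := by
    simp only [A]
    field_simp [hα0 x.1]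
  have hA' : α x.1 * deriv α x.1 = α x.1 ^ 2 * (deriv α x.1 / α x.1) := by
    field_simp [hα0 x.1]
  simp only [hA, hA']
  generalize (circleMetric.inner x.2.1 : EuclideanSpace ℝ (Fin 1) →L[ℝ]
    EuclideanSpace ℝ (Fin 1) →L[ℝ] ℝ) X.2.1 Y.2.1 = c
  generalize (h.inner x.2.2 : EuclideanSpace ℝ (Fin d) →L[ℝ]
    EuclideanSpace ℝ (Fin d) →L[ℝ] ℝ) X.2.2 Y.2.2 = c'
  linear_combination (X.1 * Y.1) * h₀ + (α x.1 ^ 2 * c) * h₁ + c' * h₂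

/-- The metric `dt² ⊕ (k v')² dθ² ⊕ v² h` with density `v^m`. -/
theorem bakryEmeryRicci_besse {m k : ℝ} {v : ℝ → ℝ}
    (hg : IsWarpedMetric (fun t => k * deriv v t) v circleMetric h g) (hk : k = m + d + 1)
    (hk0 : k ≠ 0) (hm : 0 ≤ m) (hv : ContDiff ℝ ∞ v) (hv0 : ∀ t, 0 < v t)
    (hv1 : ∀ t, 0 < deriv v t) (x : ℝ × Circle × N) {c : ℝ}
    (ode₁ : deriv v x.1 ^ 2 = (v x.1 ^ 2 - 1) / k + c * v x.1)
    (ode₂ : deriv (deriv v) x.1 = v x.1 / k - (k - 2) / 2 * c)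
    (ode₃ : deriv (deriv (deriv v)) x.1 =
      deriv v x.1 * (1 / k + (k - 2) * (k - 1) / 2 * (c / v x.1)))
    (X Y : ℝ × EuclideanSpace ℝ (Fin 1) × EuclideanSpace ℝ (Fin d)) :
    g.bakryEmeryRicci (fun q => -m * Real.log (v q.1)) (ENNReal.ofReal m) x X Y =
      -((g.inner x : (ℝ × EuclideanSpace ℝ (Fin 1) × EuclideanSpace ℝ (Fin d)) →L[ℝ]
        (ℝ × EuclideanSpace ℝ (Fin 1) × EuclideanSpace ℝ (Fin d)) →L[ℝ] ℝ) X Y) +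
      (h.ricci x.2.2 X.2.2 Y.2.2 + (k - 2) / k * (h.inner x.2.2 :
        EuclideanSpace ℝ (Fin d) →L[ℝ] EuclideanSpace ℝ (Fin d) →L[ℝ] ℝ) X.2.2 Y.2.2) := by
  have hne : ∀ t, v t ≠ 0 := fun t => (hv0 t).ne'
  have hv' : ContDiff ℝ ∞ (deriv v) := hv.deriv'
  have hφ : ContDiff ℝ ∞ fun t => -m * Real.log (v t) := contDiff_const.mul (hv.log hne)
  have hφ1 : deriv (fun t => -m * Real.log (v t)) = fun t => -m * (deriv v t / v t) := by
    funext t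
    exact (((hv.differentiable (by simp) t).hasDerivAt.log (hne t)).const_mul (-m)).deriv
  have hφ2 : deriv (deriv fun t => -m * Real.log (v t)) x.1 =
      -m * ((deriv (deriv v) x.1 * v x.1 - deriv v x.1 * deriv v x.1) / v x.1 ^ 2) := by
    rw [hφ1]
    exact (((hv'.differentiable (by simp) x.1).hasDerivAt.div
      (hv.differentiable (by simp) x.1).hasDerivAt (hne x.1)).const_mul (-m)).deriv
  have hα1 : deriv (fun t => k * deriv v t) = fun t => k * deriv (deriv v) t := by
    funext t
    exact ((hv'.differentiable (by simp) t).hasDerivAt.const_mul k).deriv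
  have hα2 : deriv (deriv fun t => k * deriv v t) x.1 = k * deriv (deriv (deriv v)) x.1 := by
    rw [hα1]
    have hv'' : ContDiff ℝ ∞ (deriv (deriv v)) := hv'.deriv'
    exact ((hv''.differentiable (by simp) x.1).hasDerivAt.const_mul k).deriv
  -- For m = 0 both sides are 0: the extended inverse is ∞, whose real value is 0. The next identity
  -- likewise holds at 0, so m = 0 needs no separate treatment.
  have hm' : ((ENNReal.ofReal m)⁻¹).toReal = m⁻¹ := by
    rw [ENNReal.toReal_inv, ENNReal.toReal_ofReal hm]
  have hmm : m⁻¹ * m ^ 2 = m := by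
    by_cases h0 : m = 0
    · simp [h0]
    · field_simp
  have h0 := hne x.1
  have h1 := (hv1 x.1).ne'
  have hd : (d : ℝ) = k - 1 - m := by linarith
  -- Since φ'' - (φ')²/m = -m v''/v, the first two goals are both v'''/v' + (k-1)v''/v = 1, where
  -- the terms in `c` cancel. In the third they cancel between 2vv'' and (k-2)(v')².
  refine hg.bakryEmeryRicci_eq (φ := fun t => -m * Real.log (v t)) hφ (contDiff_const.mul hv') hv
    (fun t => mul_ne_zero hk0 (hv1 t).ne') hne x ?_ ?_ ?_ X Y
  · rw [hα2, hφ2, hφ1, hm', ode₃, hd]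
    simp only
    have e : m⁻¹ * (-m * (deriv v x.1 / v x.1)) ^ 2 = m * (deriv v x.1 / v x.1) ^ 2 := by
      linear_combination (deriv v x.1 / v x.1) ^ 2 * hmm
    rw [e, ode₂]
    field_simp
    ring
  · rw [hα2, hφ1, hα1, ode₃, hd]
    simp only
    rw [ode₂]
    field_simp
    ring
  · rw [hφ1, hα1, hd]
    simp only
    have e : v x.1 * deriv v x.1 * (k * deriv (deriv v) x.1 / (k * deriv v x.1)) =
        v x.1 * deriv (deriv v) x.1 := by
      field_simp
    have e' : -m * (deriv v x.1 / v x.1) * (v x.1 * deriv v x.1) = -m * deriv v x.1 ^ 2 := by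
      field_simp
    rw [e, e', ode₁, ode₂]
    field_simp
    ring

theorem levelSetMeanCurvature_besse {m k : ℝ} {v : ℝ → ℝ}
    (hg : IsWarpedMetric (fun t => k * deriv v t) v circleMetric h g)
    (hk0 : k ≠ 0) (hv : ContDiff ℝ ∞ v) (hv0 : ∀ t, 0 < v t)
    (hv1 : ∀ t, 0 < deriv v t) (x : ℝ × Circle × N) :
    g.levelSetMeanCurvature (fun q => -m * Real.log (v q.1)) (fun q => q.1) x =
      deriv (deriv v) x.1 / deriv v x.1 + (m + d) * (deriv v x.1 / v x.1) := by
  have hne : ∀ t, v t ≠ 0 := fun t => (hv0 t).ne'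
  have hv' : ContDiff ℝ ∞ (deriv v) := hv.deriv'
  have hφ : ContDiff ℝ ∞ fun t => -m * Real.log (v t) := contDiff_const.mul (hv.log hne)
  have hφ1 : deriv (fun t => -m * Real.log (v t)) x.1 = -m * (deriv v x.1 / v x.1) :=
    (((hv.differentiable (by simp) x.1).hasDerivAt.log (hne x.1)).const_mul (-m)).deriv
  have hα1 : deriv (fun t => k * deriv v t) x.1 = k * deriv (deriv v) x.1 :=
    ((hv'.differentiable (by simp) x.1).hasDerivAt.const_mul k).deriv
  refine (hg.levelSetMeanCurvature_fst (φ := fun t => -m * Real.log (v t))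
    (hφ.differentiable (by simp)) (contDiff_const.mul hv') hv
    (fun t => mul_ne_zero hk0 (hv1 t).ne') hne x).trans ?_
  rw [hφ1, hα1, finrank_euclideanSpace_fin, finrank_euclideanSpace_fin,
    mul_div_mul_left _ _ hk0]
  push_cast
  ring

theorem levelSetMeanCurvature_soliton
    (hg : IsWarpedMetric (deriv φ) (fun _ => 1) circleMetric h g) (hφ : ContDiff ℝ ∞ φ)
    (hφ0 : ∀ t, deriv φ t ≠ 0) (x : ℝ × Circle × N) :
    g.levelSetMeanCurvature (fun q => φ q.1) (fun q => q.1) x =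
      deriv (deriv φ) x.1 / deriv φ x.1 - deriv φ x.1 := by
  refine (hg.levelSetMeanCurvature_fst (hφ.differentiable (by simp)) hφ.deriv' contDiff_const
    hφ0 (fun _ => one_ne_zero) x).trans ?_
  simp

/-- Here α''/α = φ'''/φ' = c and φ'·α'/α = φ'' = c - 1, so the dt² and dθ² components are both -c +
(c - 1); in the N direction the Hessian vanishes. -/
theorem bakryEmeryRicci_soliton
    (hg : IsWarpedMetric (deriv φ) (fun _ => 1) circleMetric h g) (hφ : ContDiff ℝ ∞ φ)
    (hφ0 : ∀ t, deriv φ t ≠ 0) (x : ℝ × Circle × N) {c : ℝ} (ode₂ : deriv (deriv φ) x.1 = c - 1)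
    (ode₃ : deriv (deriv (deriv φ)) x.1 = c * deriv φ x.1)
    (X Y : ℝ × EuclideanSpace ℝ (Fin 1) × EuclideanSpace ℝ (Fin d)) :
    g.bakryEmeryRicci (fun q => φ q.1) ⊤ x X Y =
      -((g.inner x : (ℝ × EuclideanSpace ℝ (Fin 1) × EuclideanSpace ℝ (Fin d)) →L[ℝ]
        (ℝ × EuclideanSpace ℝ (Fin 1) × EuclideanSpace ℝ (Fin d)) →L[ℝ] ℝ) X Y) +
      (h.ricci x.2.2 X.2.2 Y.2.2 + 1 * (h.inner x.2.2 :
        EuclideanSpace ℝ (Fin d) →L[ℝ] EuclideanSpace ℝ (Fin d) →L[ℝ] ℝ) X.2.2 Y.2.2) := by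
  have h0 := hφ0 x.1
  refine hg.bakryEmeryRicci_eq hφ hφ.deriv' contDiff_const hφ0 (fun _ => one_ne_zero) x ?_ ?_ ?_ X Y
  · rw [ode₂, ode₃]
    simp
    field_simp
    ring
  · rw [ode₂, ode₃]
    simp
    field_simp
    ring
  · simp

/-- The surface factor ℝ × S¹ has Ricci curvature -c, and N has Ricci curvature -1. -/
theorem scalar_soliton
    (hg : IsWarpedMetric (deriv φ) (fun _ => 1) circleMetric h g) (hφ : ContDiff ℝ ∞ φ)
    (hφ0 : ∀ t, deriv φ t ≠ 0) (x : ℝ × Circle × N) {c : ℝ} (ode₃ : deriv (deriv (deriv φ)) x.1 = c * deriv φ x.1)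
    (hh : ∀ (p : N) (X Y : TangentSpace (𝓡 d) p), h.ricci p X Y = -(h.inner p X Y)) :
    g.scalar x = -2 * c - d := by
  have h0 := hφ0 x.1
  refine (hg.scalar_eq (a := -c) (b := -c) (c := -1) x fun X Y => ?_).trans ?_
  · refine (hg.ricci_eq hφ.deriv' contDiff_const hφ0 (fun _ => one_ne_zero) x X Y).trans ?_
    rw [ricci_circleMetric, hh x.2.2 X.2.2 Y.2.2, finrank_euclideanSpace_fin,
      finrank_euclideanSpace_fin, ode₃]
    generalize (circleMetric.inner x.2.1 : EuclideanSpace ℝ (Fin 1) →L[ℝ]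
      EuclideanSpace ℝ (Fin 1) →L[ℝ] ℝ) X.2.1 Y.2.1 = c₁
    generalize (h.inner x.2.2 : EuclideanSpace ℝ (Fin d) →L[ℝ]
      EuclideanSpace ℝ (Fin d) →L[ℝ] ℝ) X.2.2 Y.2.2 = c₂
    simp
    field_simp
  · simp
    ring

end IsWarpedMetric

end LineCircleCurvature

/-! ### Autonomous scalar equations, solved by quadrature -/

section AutonomousEquation

/-- The time that a solution of `x' = q(x)` takes from `a` to `b`. -/
noncomputable def traversalTime (q : ℝ → ℝ) (a b : ℝ) : ℝ := ∫ x in a..b, (q x)⁻¹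

variable {q : ℝ → ℝ}

theorem hasDerivAt_traversalTime (hq : Continuous q) (hpos : ∀ x, 0 < q x) (a b : ℝ) :
    HasDerivAt (traversalTime q a) (q b)⁻¹ b :=
  ((hq.inv₀ fun x => (hpos x).ne').integral_hasStrictDerivAt a b).hasDerivAt

theorem strictMono_traversalTime (hq : Continuous q) (hpos : ∀ x, 0 < q x) (a : ℝ) :
    StrictMono (traversalTime q a) :=
  strictMono_of_hasDerivAt_pos (fun b => hasDerivAt_traversalTime hq hpos a b)
    fun b => inv_pos.2 (hpos b)

/-- Speed at most 1 means that the time grows at least as fast as the distance covered. -/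
theorem surjective_traversalTime (hq : Continuous q) (hpos : ∀ x, 0 < q x) (hle : ∀ x, q x ≤ 1)
    (a : ℝ) : Function.Surjective (traversalTime q a) := by
  have hmono : Monotone fun b => traversalTime q a b - b := by
    refine monotone_of_hasDerivAt_nonneg
      (fun b => (hasDerivAt_traversalTime hq hpos a b).sub (hasDerivAt_id b)) fun b => ?_
    exact sub_nonneg.2 ((one_le_inv₀ (hpos b)).2 (hle b))
  have ha : traversalTime q a a = 0 := intervalIntegral.integral_same
  have hcont : Continuous (traversalTime q a) :=
    continuous_iff_continuousAt.2 fun b => (hasDerivAt_traversalTime hq hpos a b).continuousAt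
  refine hcont.surjective ?_ ?_
  · refine tendsto_atTop_mono' atTop ?_ (tendsto_atTop_add_const_right _ (-a) tendsto_id)
    filter_upwards [eventually_ge_atTop a] with b hb
    have := hmono hb
    simp only [ha] at this
    simp only [id]
    linarith
  · refine tendsto_atBot_mono' atBot ?_ (tendsto_atBot_add_const_right _ (-a) tendsto_id)
    filter_upwards [eventually_le_atBot a] with b hb
    have := hmono hb
    simp only [ha] at this
    simp only [id]
    linarith

/-- The time is an explicit inverse of every solution; uniqueness, behaviour at ±∞ and continuous
dependence are all read off from it. -/
theorem traversalTime_solution (hq : Continuous q) (hpos : ∀ x, 0 < q x) {x : ℝ → ℝ}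
    (hx : ∀ t, HasDerivAt x (q (x t)) t) (t : ℝ) : traversalTime q (x 0) (x t) = t := by
  have h : ∀ s, HasDerivAt (fun t => traversalTime q (x 0) (x t) - t) 0 s := fun s => by
    have := ((hasDerivAt_traversalTime hq hpos (x 0) (x s)).comp s (hx s)).sub (hasDerivAt_id s)
    rwa [inv_mul_cancel₀ (hpos _).ne', sub_self] at this
  have h0 := is_const_of_deriv_eq_zero (fun s => (h s).differentiableAt) (fun s => (h s).deriv) t 0
  have ha : traversalTime q (x 0) (x 0) = 0 := intervalIntegral.integral_same
  simp only [ha] at h0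
  linarith

theorem solution_unique (hq : Continuous q) (hpos : ∀ x, 0 < q x) {x y : ℝ → ℝ}
    (hx : ∀ t, HasDerivAt x (q (x t)) t) (hy : ∀ t, HasDerivAt y (q (y t)) t) (h0 : x 0 = y 0) :
    x = y := by
  funext t
  apply (strictMono_traversalTime hq hpos (x 0)).injective
  rw [traversalTime_solution hq hpos hx, h0, traversalTime_solution hq hpos hy]

/-- The solution is the inverse function of the time, an increasing bijection of ℝ. -/
theorem exists_solution (hq : Continuous q) (hpos : ∀ x, 0 < q x) (hle : ∀ x, q x ≤ 1) (a : ℝ) :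
    ∃ x : ℝ → ℝ, x 0 = a ∧ ∀ t, HasDerivAt x (q (x t)) t := by
  set e := (strictMono_traversalTime hq hpos a).orderIsoOfSurjective _
    (surjective_traversalTime hq hpos hle a)
  have he : ∀ t, traversalTime q a (e.symm t) = t := fun t => e.apply_symm_apply t
  refine ⟨e.symm, ?_, fun t => ?_⟩
  · have ha : e a = 0 := intervalIntegral.integral_same (f := fun x => (q x)⁻¹)
    rw [← ha, e.symm_apply_apply]
  · have := HasDerivAt.of_local_left_inverse (g := e.symm) e.symm.continuous.continuousAt
      (hasDerivAt_traversalTime hq hpos a (e.symm t)) (inv_ne_zero (hpos _).ne')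
      (Eventually.of_forall he)
    rwa [inv_inv] at this

theorem tendsto_solution_atTop (hq : Continuous q) (hpos : ∀ x, 0 < q x) {x : ℝ → ℝ}
    (hx : ∀ t, HasDerivAt x (q (x t)) t) : Tendsto x atTop atTop := by
  have hmono : StrictMono x := strictMono_of_hasDerivAt_pos hx fun t => hpos _
  refine tendsto_atTop_atTop_of_monotone hmono.monotone fun b => ⟨traversalTime q (x 0) b, ?_⟩
  rw [← (strictMono_traversalTime hq hpos (x 0)).le_iff_le, traversalTime_solution hq hpos hx]

theorem tendsto_solution_atBot (hq : Continuous q) (hpos : ∀ x, 0 < q x) {x : ℝ → ℝ}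
    (hx : ∀ t, HasDerivAt x (q (x t)) t) : Tendsto x atBot atBot := by
  have hmono : StrictMono x := strictMono_of_hasDerivAt_pos hx fun t => hpos _
  refine tendsto_atBot_atBot_of_monotone hmono.monotone fun b => ⟨traversalTime q (x 0) b, ?_⟩
  rw [← (strictMono_traversalTime hq hpos (x 0)).le_iff_le, traversalTime_solution hq hpos hx]

theorem contDiff_solution (hq : ContDiff ℝ ∞ q) {x : ℝ → ℝ}
    (hx : ∀ t, HasDerivAt x (q (x t)) t) : ContDiff ℝ ∞ x := by
  have hd : Differentiable ℝ x := fun t => (hx t).differentiableAt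
  have hderiv : deriv x = fun t => q (x t) := funext fun t => (hx t).deriv
  refine contDiff_infty.2 fun n => ?_
  induction n with
  | zero => exact contDiff_zero.2 hd.continuous
  | succ n ih =>
    rw [Nat.cast_succ, contDiff_succ_iff_deriv, hderiv]
    refine ⟨hd, fun h => absurd h (by simp), ?_⟩
    exact (hq.of_le (by exact_mod_cast le_top)).comp ih

theorem continuous_traversalTime {Q : ℝ → ℝ → ℝ} (hQ : Continuous Q.uncurry)
    (hpos : ∀ δ x, 0 < Q δ x) :
    Continuous fun p : ℝ × ℝ × ℝ => traversalTime (Q p.1) p.2.1 p.2.2 := by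
  have hinv : Continuous (fun (p : ℝ × ℝ × ℝ) x => (Q p.1 x)⁻¹).uncurry :=
    (hQ.comp (by fun_prop : Continuous fun y : (ℝ × ℝ × ℝ) × ℝ => (y.1.1, y.2))).inv₀
      fun y => (hpos _ _).ne'
  have h : (fun p : ℝ × ℝ × ℝ => traversalTime (Q p.1) p.2.1 p.2.2) = fun p =>
      (∫ x in (0 : ℝ)..p.2.2, (Q p.1 x)⁻¹) - ∫ x in (0 : ℝ)..p.2.1, (Q p.1 x)⁻¹ := by
    funext p
    have hc : Continuous fun x => (Q p.1 x)⁻¹ := hinv.comp (Continuous.prodMk_right p)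
    exact (intervalIntegral.integral_interval_sub_left (hc.intervalIntegrable _ _)
      (hc.intervalIntegrable _ _)).symm
  rw [h]
  exact (intervalIntegral.continuous_parametric_intervalIntegral_of_continuous hinv
    (by fun_prop)).sub (intervalIntegral.continuous_parametric_intervalIntegral_of_continuous hinv
    (by fun_prop))

/-- Continuous dependence of the solutions of `x' = Q(δ, x)` on `δ` and on the initial value. -/
theorem tendsto_solution {ι : Type*} {l : Filter ι} {Q : ℝ → ℝ → ℝ} (hQ : Continuous Q.uncurry)
    (hpos : ∀ δ x, 0 < Q δ x) {δ : ι → ℝ} {δ₀ : ℝ} (hδ : Tendsto δ l (𝓝 δ₀)) {x : ι → ℝ → ℝ}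
    {x₀ : ℝ → ℝ} (hx : ∀ᶠ i in l, ∀ t, HasDerivAt (x i) (Q (δ i) (x i t)) t)
    (hx₀ : ∀ t, HasDerivAt x₀ (Q δ₀ (x₀ t)) t) (h0 : Tendsto (fun i => x i 0) l (𝓝 (x₀ 0)))
    (t : ℝ) : Tendsto (fun i => x i t) l (𝓝 (x₀ t)) := by
  have hc : ∀ δ, Continuous (Q δ) := fun δ => hQ.comp (Continuous.prodMk_right δ)
  have hT : ∀ y, Tendsto (fun i => traversalTime (Q (δ i)) (x i 0) y) l
      (𝓝 (traversalTime (Q δ₀) (x₀ 0) y)) := fun y =>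
    ((continuous_traversalTime hQ hpos).tendsto (δ₀, x₀ 0, y)).comp
      (hδ.prodMk_nhds (h0.prodMk_nhds tendsto_const_nhds))
  have ht := traversalTime_solution (hc δ₀) (hpos δ₀) hx₀ t
  -- A level y lies below x(t) exactly when the time to reach y is less than t; this strict
  -- inequality persists because the time is continuous in the parameter and in the initial value.
  refine tendsto_order.2 ⟨fun y hy => ?_, fun y hy => ?_⟩
  · have := (strictMono_traversalTime (hc δ₀) (hpos δ₀) (x₀ 0)) hy
    rw [ht] at this
    filter_upwards [hx, (hT y).eventually_lt_const this] with i hi hlt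
    rwa [← traversalTime_solution (hc (δ i)) (hpos (δ i)) hi t,
      (strictMono_traversalTime (hc (δ i)) (hpos (δ i)) (x i 0)).lt_iff_lt] at hlt
  · have := (strictMono_traversalTime (hc δ₀) (hpos δ₀) (x₀ 0)) hy
    rw [ht] at this
    filter_upwards [hx, (hT y).eventually_const_lt this] with i hi hlt
    rwa [← traversalTime_solution (hc (δ i)) (hpos (δ i)) hi t,
      (strictMono_traversalTime (hc (δ i)) (hpos (δ i)) (x i 0)).lt_iff_lt] at hlt

end AutonomousEquation

/-! ### The family of profile equations and its dependence on δ -/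

section ProfileEquation

/-- The function `2 ∫₀ˢ e^{-δσ} (1 - e^{-σ}) dσ`. -/
noncomputable def profileForce (δ s : ℝ) : ℝ :=
  2 * ∫ σ in (0 : ℝ)..s, Real.exp (-(δ * σ)) * (1 - Real.exp (-σ))

theorem hasDerivAt_profileForce (δ s : ℝ) :
    HasDerivAt (profileForce δ) (2 * (Real.exp (-(δ * s)) * (1 - Real.exp (-s)))) s :=
  ((Continuous.integral_hasStrictDerivAt (by fun_prop) 0 s).hasDerivAt).const_mul 2

theorem contDiff_profileForce (δ : ℝ) : ContDiff ℝ ∞ (profileForce δ) := by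
  refine contDiff_infty_iff_deriv.2
    ⟨fun s => (hasDerivAt_profileForce δ s).differentiableAt, ?_⟩
  rw [funext fun s => (hasDerivAt_profileForce δ s).deriv]
  fun_prop

/-- The integral form makes continuity at δ = 0 evident; the closed form for δ > 0 is singular
there. -/
theorem continuous_profileForce : Continuous fun p : ℝ × ℝ => profileForce p.1 p.2 :=
  (intervalIntegral.continuous_parametric_intervalIntegral_of_continuous
    (f := fun (p : ℝ × ℝ) σ => Real.exp (-(p.1 * σ)) * (1 - Real.exp (-σ)))
    (by unfold Function.uncurry; fun_prop) (by fun_prop)).const_mul 2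

theorem profileForce_zero (δ : ℝ) : profileForce δ 0 = 0 := by simp [profileForce]

theorem profileForce_pos (δ : ℝ) {s : ℝ} (hs : 0 < s) : 0 < profileForce δ s := by
  refine mul_pos two_pos (intervalIntegral.intervalIntegral_pos_of_pos_on
    (Continuous.intervalIntegrable (by fun_prop) _ _) (fun σ hσ => ?_) hs)
  have : Real.exp (-σ) < 1 := Real.exp_lt_one_iff.2 (by linarith [hσ.1])
  exact mul_pos (Real.exp_pos _) (by linarith)

/-- The integrand is at most σ. After taking logarithms this bounds the speed by 1, so solutions
exist for all time. -/
theorem profileForce_le {δ s : ℝ} (hδ : 0 ≤ δ) (hs : 0 ≤ s) : profileForce δ s ≤ s ^ 2 := by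
  have h : ∫ σ in (0 : ℝ)..s, Real.exp (-(δ * σ)) * (1 - Real.exp (-σ)) ≤ ∫ σ in (0 : ℝ)..s, σ := by
    refine intervalIntegral.integral_mono_on hs (Continuous.intervalIntegrable (by fun_prop) _ _)
      (Continuous.intervalIntegrable (by fun_prop) _ _) fun σ hσ => ?_
    have h1 : Real.exp (-(δ * σ)) ≤ 1 := Real.exp_le_one_iff.2 (by nlinarith [hσ.1])
    have h2 : Real.exp (-σ) ≤ 1 := Real.exp_le_one_iff.2 (by linarith [hσ.1])
    have h3 := Real.add_one_le_exp (-σ)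
    calc Real.exp (-(δ * σ)) * (1 - Real.exp (-σ)) ≤ 1 * (1 - Real.exp (-σ)) :=
          mul_le_mul_of_nonneg_right h1 (by linarith)
      _ ≤ σ := by linarith
  rw [integral_id] at h
  rw [profileForce]
  linarith

theorem profileForce_eq_zero_left (s : ℝ) :
    profileForce 0 s = 2 * Real.exp (-s) - 2 + 2 * s := by
  have h : ∀ σ ∈ uIcc 0 s, HasDerivAt (fun σ => σ + Real.exp (-σ))
      (Real.exp (-(0 * σ)) * (1 - Real.exp (-σ))) σ := fun σ _ => by
    refine ((hasDerivAt_id σ).add (hasDerivAt_neg σ).exp).congr_deriv ?_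
    simp
    ring
  rw [profileForce, intervalIntegral.integral_eq_sub_of_hasDerivAt h
    (Continuous.intervalIntegrable (by fun_prop) _ _)]
  simp
  ring

theorem profileForce_eq {δ : ℝ} (hδ : 0 < δ) (s : ℝ) :
    profileForce δ s = 2 / (δ * (1 + δ)) - 2 / δ * Real.exp (-(δ * s)) +
      2 / (1 + δ) * Real.exp (-((1 + δ) * s)) := by
  have hδ' : 1 + δ ≠ 0 := by positivity
  have h : ∀ σ ∈ uIcc 0 s, HasDerivAt
      (fun σ => -δ⁻¹ * Real.exp (-(δ * σ)) + (1 + δ)⁻¹ * Real.exp (-((1 + δ) * σ)))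
      (Real.exp (-(δ * σ)) * (1 - Real.exp (-σ))) σ := fun σ _ => by
    have h1 : ∀ c : ℝ, HasDerivAt (fun σ => Real.exp (-(c * σ))) (Real.exp (-(c * σ)) * -c) σ :=
      fun c => by simpa using (((hasDerivAt_id σ).const_mul c).neg).exp
    refine (((h1 δ).const_mul (-δ⁻¹)).add ((h1 (1 + δ)).const_mul (1 + δ)⁻¹)).congr_deriv ?_
    have e : Real.exp (-((1 + δ) * σ)) = Real.exp (-(δ * σ)) * Real.exp (-σ) := by
      rw [← Real.exp_add]
      ring_nf
    rw [e]
    field_simp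
    ring
  rw [profileForce, intervalIntegral.integral_eq_sub_of_hasDerivAt h
    (Continuous.intervalIntegrable (by fun_prop) _ _)]
  simp
  field_simp
  ring

/-- `s : ℝ → (0, ∞)` solves `(s')² = 2 ∫₀ˢ e^{-δσ} (1 - e^{-σ}) dσ` with `s' > 0`. -/
structure IsProfileSolution (δ : ℝ) (s : ℝ → ℝ) : Prop where
  pos : ∀ t, 0 < s t
  differentiable : Differentiable ℝ s
  ode : ∀ t, deriv s t ^ 2 = profileForce δ (s t)
  deriv_pos : ∀ t, 0 < deriv s t

/-- The equation for `log s`. -/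
noncomputable def logProfileForce (δ r : ℝ) : ℝ :=
  Real.sqrt (profileForce δ (Real.exp r)) / Real.exp r

theorem logProfileForce_pos (δ r : ℝ) : 0 < logProfileForce δ r :=
  div_pos (Real.sqrt_pos.2 (profileForce_pos δ (Real.exp_pos r))) (Real.exp_pos r)

theorem logProfileForce_le {δ : ℝ} (hδ : 0 ≤ δ) (r : ℝ) : logProfileForce δ r ≤ 1 := by
  rw [logProfileForce, div_le_one (Real.exp_pos r)]
  exact Real.sqrt_le_iff.2 ⟨(Real.exp_pos r).le, profileForce_le hδ (Real.exp_pos r).le⟩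

theorem continuous_logProfileForce : Continuous logProfileForce.uncurry := by
  refine Continuous.div (Real.continuous_sqrt.comp (continuous_profileForce.comp
    (by fun_prop : Continuous fun p : ℝ × ℝ => (p.1, Real.exp p.2)))) (by fun_prop)
    fun p => (Real.exp_pos p.2).ne'

theorem contDiff_logProfileForce (δ : ℝ) : ContDiff ℝ ∞ (logProfileForce δ) :=
  (((contDiff_profileForce δ).comp Real.contDiff_exp).sqrt
    fun r => (profileForce_pos δ (Real.exp_pos r)).ne').div Real.contDiff_exp
    fun r => (Real.exp_pos r).ne'

theorem isProfileSolution_exp {δ : ℝ} {r : ℝ → ℝ}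
    (hr : ∀ t, HasDerivAt r (logProfileForce δ (r t)) t) :
    IsProfileSolution δ fun t => Real.exp (r t) := by
  have hd : ∀ t, HasDerivAt (fun t => Real.exp (r t))
      (Real.sqrt (profileForce δ (Real.exp (r t)))) t := fun t =>
    (hr t).exp.congr_deriv (mul_div_cancel₀ _ (Real.exp_pos _).ne')
  refine ⟨fun t => Real.exp_pos _, fun t => (hd t).differentiableAt, fun t => ?_, fun t => ?_⟩
  · rw [(hd t).deriv, Real.sq_sqrt (profileForce_pos δ (Real.exp_pos _)).le]
  · rw [(hd t).deriv]
    exact Real.sqrt_pos.2 (profileForce_pos δ (Real.exp_pos _))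

theorem exists_isProfileSolution {δ a : ℝ} (hδ : 0 ≤ δ) (ha : 0 < a) :
    ∃ s, IsProfileSolution δ s ∧ s 0 = a := by
  obtain ⟨r, hr0, hr⟩ := exists_solution (continuous_logProfileForce.comp
    (Continuous.prodMk_right δ)) (logProfileForce_pos δ) (logProfileForce_le hδ) (Real.log a)
  exact ⟨_, isProfileSolution_exp hr, by rw [hr0, Real.exp_log ha]⟩

namespace IsProfileSolution

variable {δ : ℝ} {s : ℝ → ℝ}

/-- The force vanishes at s = 0, and the logarithm moves this zero to -∞. The resulting equation has
a smooth positive right-hand side on all of ℝ. -/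
theorem hasDerivAt_log (hs : IsProfileSolution δ s) (t : ℝ) :
    HasDerivAt (fun t => Real.log (s t)) (logProfileForce δ (Real.log (s t))) t := by
  refine ((hs.differentiable t).hasDerivAt.log (hs.pos t).ne').congr_deriv ?_
  rw [logProfileForce, Real.exp_log (hs.pos t), ← hs.ode, Real.sqrt_sq (hs.deriv_pos t).le]

theorem unique {s' : ℝ → ℝ} (hs : IsProfileSolution δ s) (hs' : IsProfileSolution δ s')
    (h0 : s 0 = s' 0) : s = s' := by
  have := solution_unique (continuous_logProfileForce.comp (Continuous.prodMk_right δ))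
    (logProfileForce_pos δ) hs.hasDerivAt_log hs'.hasDerivAt_log (congrArg Real.log h0)
  funext t
  rw [← Real.exp_log (hs.pos t), ← Real.exp_log (hs'.pos t)]
  exact congrArg Real.exp (congrFun this t)

theorem contDiff (hs : IsProfileSolution δ s) : ContDiff ℝ ∞ s := by
  have h := (contDiff_solution (contDiff_logProfileForce δ) hs.hasDerivAt_log).exp
  rwa [funext fun t => Real.exp_log (hs.pos t)] at h

theorem tendsto_atTop (hs : IsProfileSolution δ s) : Tendsto s atTop atTop := by
  have h := Real.tendsto_exp_atTop.comp (tendsto_solution_atTop (continuous_logProfileForce.comp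
    (Continuous.prodMk_right δ)) (logProfileForce_pos δ) hs.hasDerivAt_log)
  exact h.congr fun t => Real.exp_log (hs.pos t)

theorem tendsto_atBot (hs : IsProfileSolution δ s) : Tendsto s atBot (𝓝 0) := by
  have h := Real.tendsto_exp_atBot.comp (tendsto_solution_atBot (continuous_logProfileForce.comp
    (Continuous.prodMk_right δ)) (logProfileForce_pos δ) hs.hasDerivAt_log)
  exact h.congr fun t => Real.exp_log (hs.pos t)

theorem tendsto_of_tendsto {ι : Type*} {l : Filter ι} {ε : ι → ℝ} {u : ι → ℝ → ℝ}
    (hs : IsProfileSolution δ s) (hu : ∀ᶠ i in l, IsProfileSolution (ε i) (u i))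
    (hε : Tendsto ε l (𝓝 δ)) (h0 : Tendsto (fun i => u i 0) l (𝓝 (s 0))) (t : ℝ) :
    Tendsto (fun i => u i t) l (𝓝 (s t)) := by
  have h := tendsto_solution continuous_logProfileForce logProfileForce_pos hε
    (x := fun i t => Real.log (u i t)) (hu.mono fun i hi => hi.hasDerivAt_log) hs.hasDerivAt_log
    (h0.log (hs.pos 0).ne') t
  have h' := (Real.continuous_exp.tendsto _).comp h
  rw [Real.exp_log (hs.pos t)] at h'
  exact h'.congr' (hu.mono fun i hi => Real.exp_log (hi.pos t))

end IsProfileSolution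

end ProfileEquation

/-! ### The profiles v and φ as solutions of the family -/

section BesseProfile

/-- The right-hand side of the equation for `(v')²`, in terms of `k = m + n - 1`. -/
noncomputable def besseForce (k x : ℝ) : ℝ :=
  (x ^ 2 - 1) / k + 2 * (k - 2) ^ ((k - 2) / 2) / k ^ ((k + 2) / 2) * x ^ (2 - k)

/-- The positive double zero of `besseForce k`. -/
noncomputable def besseZero (k : ℝ) : ℝ := Real.sqrt ((k - 2) / k)

theorem isBesseProfile_iff {n : ℕ} {m : ℝ} {v : ℝ → ℝ} :
    IsBesseProfile n m v ↔ (∀ t, 0 < v t) ∧ Differentiable ℝ v ∧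
      (∀ t, deriv v t ^ 2 = besseForce (m + n - 1) (v t)) ∧ v 0 = 1 ∧ ∀ t, 0 < deriv v t := by
  have h : ∀ x, besseForce (m + n - 1) x = (x ^ 2 - 1) / (m + n - 1) +
      2 * (m + n - 3) ^ ((m + n - 3) / 2) / (m + n - 1) ^ ((m + n + 1) / 2) *
        x ^ (3 - m - n) := by
    intro x
    rw [besseForce, show m + n - 1 - 2 = m + n - 3 by ring, show m + n - 1 + 2 = m + n + 1 by ring,
      show 2 - (m + n - 1) = 3 - m - n by ring]
  simp only [h]
  exact ⟨fun h => ⟨h.1, h.2, h.3, h.4, h.5⟩, fun h => ⟨h.1, h.2.1, h.2.2.1, h.2.2.2.1, h.2.2.2.2⟩⟩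

section Zero

variable {k : ℝ}

theorem besseZero_pos (hk : 2 < k) : 0 < besseZero k :=
  Real.sqrt_pos.2 (div_pos (by linarith) (by linarith))

theorem besseZero_sq (hk : 2 < k) : besseZero k ^ 2 = (k - 2) / k :=
  Real.sq_sqrt (div_nonneg (by linarith) (by linarith))

theorem besseZero_lt_one (hk : 2 < k) : besseZero k < 1 := by
  rw [besseZero, Real.sqrt_lt' one_pos, one_pow, div_lt_one (by linarith)]
  linarith

/-- With s measured logarithmically from the double zero z, normalising the constant by z^{2-k}
leaves exactly the closed form of the integral for δ = 2/(k-2). -/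
theorem besseForce_eq (hk : 2 < k) (s : ℝ) :
    besseForce k (besseZero k * Real.exp (s / (k - 2))) =
      (besseZero k * Real.exp (s / (k - 2)) / (k - 2)) ^ 2 * profileForce (2 / (k - 2)) s := by
  have h2 : 0 < k - 2 := by linarith
  have h0 : 0 < k := by linarith
  have e₁ : (besseZero k * Real.exp (s / (k - 2))) ^ (2 - k) =
      ((k - 2) / k) ^ ((2 - k) / 2) * Real.exp (-s) := by
    rw [Real.mul_rpow (besseZero_pos hk).le (Real.exp_pos _).le, besseZero, Real.sqrt_eq_rpow,
      ← Real.rpow_mul (by positivity), ← Real.exp_mul]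
    congr 2
    · ring
    · field_simp
      ring
  -- The coefficient times z^{2-k} is 2/k², which is (1 - z²)/k: the force vanishes at z.
  have e₂ : 2 * (k - 2) ^ ((k - 2) / 2) / k ^ ((k + 2) / 2) * ((k - 2) / k) ^ ((2 - k) / 2) =
      2 / k ^ 2 := by
    rw [Real.div_rpow h2.le h0.le, show (2 - k) / 2 = -((k - 2) / 2) by ring,
      Real.rpow_neg h2.le, Real.rpow_neg h0.le, show (k + 2) / 2 = (k - 2) / 2 + 2 by ring,
      Real.rpow_add h0, Real.rpow_two]
    have := Real.rpow_pos_of_pos h2 ((k - 2) / 2)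
    have := Real.rpow_pos_of_pos h0 ((k - 2) / 2)
    field_simp
  rw [besseForce, e₁, ← mul_assoc, e₂, profileForce_eq (by positivity), mul_pow, div_pow, mul_pow,
    besseZero_sq hk, ← Real.exp_nat_mul]
  have e₃ : Real.exp (-(2 / (k - 2) * s)) = (Real.exp ((2 : ℕ) * (s / (k - 2))))⁻¹ := by
    rw [← Real.exp_neg]
    congr 1
    push_cast
    ring
  have e₄ : Real.exp (-((1 + 2 / (k - 2)) * s)) =
      (Real.exp ((2 : ℕ) * (s / (k - 2))))⁻¹ * Real.exp (-s) := by
    rw [← Real.exp_neg, ← Real.exp_add]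
    congr 1
    push_cast
    ring
  rw [e₃, e₄]
  have := Real.exp_pos ((2 : ℕ) * (s / (k - 2)))
  field_simp
  ring

end Zero

variable {n : ℕ} {m k : ℝ} {v : ℝ → ℝ}

/-- The solution `s` of the profile equation that corresponds to `v`. -/
noncomputable def besseLog (k : ℝ) (v : ℝ → ℝ) (t : ℝ) : ℝ :=
  (k - 2) * (Real.log (v t) - Real.log (besseZero k))

theorem besseZero_mul_exp_besseLog (hk : 2 < k) {t : ℝ} (hv : 0 < v t) :
    besseZero k * Real.exp (besseLog k v t / (k - 2)) = v t := by
  have h2 : k - 2 ≠ 0 := by linarith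
  rw [besseLog, mul_div_cancel_left₀ _ h2, Real.exp_sub, Real.exp_log hv,
    Real.exp_log (besseZero_pos hk), mul_div_cancel₀ _ (besseZero_pos hk).ne']

theorem isBesseProfile_of_isProfileSolution (hm : m + n - 1 = k) (hk : 2 < k) {s : ℝ → ℝ}
    (hs : IsProfileSolution (2 / (k - 2)) s) (h0 : s 0 = -((k - 2) * Real.log (besseZero k))) :
    IsBesseProfile n m fun t => besseZero k * Real.exp (s t / (k - 2)) := by
  have h2 : 0 < k - 2 := by linarith
  have hb := besseZero_pos hk
  have hd : ∀ t, HasDerivAt (fun t => besseZero k * Real.exp (s t / (k - 2)))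
      (besseZero k * Real.exp (s t / (k - 2)) / (k - 2) * deriv s t) t := fun t => by
    refine ((((hs.differentiable t).hasDerivAt.div_const (k - 2)).exp).const_mul
      (besseZero k)).congr_deriv ?_
    ring
  refine isBesseProfile_iff.2 ⟨fun t => by positivity, fun t => (hd t).differentiableAt,
    fun t => ?_, ?_, fun t => ?_⟩
  · rw [(hd t).deriv, mul_pow, hs.ode, hm, besseForce_eq hk]
  · rw [h0, neg_div, mul_div_cancel_left₀ _ h2.ne', Real.exp_neg, Real.exp_log hb,
      mul_inv_cancel₀ hb.ne']
  · rw [(hd t).deriv]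
    have := hs.deriv_pos t
    positivity

namespace IsBesseProfile

/-- At a point where v = z the equation would give v' = 0. As v(0) = 1 > z, the intermediate value
theorem excludes v ≤ z. -/
theorem besseZero_lt (hv : IsBesseProfile n m v) (hm : m + n - 1 = k) (hk : 2 < k) (t : ℝ) :
    besseZero k < v t := by
  obtain ⟨h1, h2, h3, h4, h5⟩ := isBesseProfile_iff.1 hv
  have hne : ∀ t, v t ≠ besseZero k := by
    intro t ht
    have h := besseForce_eq hk 0
    rw [profileForce_zero, mul_zero, zero_div, Real.exp_zero, mul_one, ← ht, ← hm, ← h3] at h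
    exact (pow_pos (h5 t) 2).ne' h
  by_contra! hcon
  obtain ⟨r, hr⟩ := mem_range_of_exists_le_of_exists_ge h2.continuous ⟨t, hcon⟩
    ⟨0, h4 ▸ (besseZero_lt_one hk).le⟩
  exact hne r hr

theorem isProfileSolution (hv : IsBesseProfile n m v) (hm : m + n - 1 = k) (hk : 2 < k) :
    IsProfileSolution (2 / (k - 2)) (besseLog k v) := by
  have hlt := hv.besseZero_lt hm hk
  obtain ⟨h1, h2, h3, h4, h5⟩ := isBesseProfile_iff.1 hv
  have hk2 : 0 < k - 2 := by linarith
  have hd : ∀ t, HasDerivAt (besseLog k v) ((k - 2) * (deriv v t / v t)) t := fun t =>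
    (((h2 t).hasDerivAt.log (h1 t).ne').sub_const _).const_mul _
  refine ⟨fun t => mul_pos hk2 (sub_pos.2 (Real.log_lt_log (besseZero_pos hk) (hlt t))),
    fun t => (hd t).differentiableAt, fun t => ?_, fun t => ?_⟩
  · have h := besseForce_eq hk (besseLog k v t)
    rw [besseZero_mul_exp_besseLog hk (h1 t), ← hm, ← h3, hm] at h
    rw [(hd t).deriv, mul_pow, div_pow, h]
    have := h1 t
    field_simp
  · rw [(hd t).deriv]
    exact mul_pos hk2 (div_pos (h5 t) (h1 t))

theorem besseLog_zero (hv : IsBesseProfile n m v) :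
    besseLog k v 0 = -((k - 2) * Real.log (besseZero k)) := by
  rw [besseLog, hv.initial, Real.log_one]
  ring

theorem unique {w : ℝ → ℝ} (hv : IsBesseProfile n m v) (hw : IsBesseProfile n m w)
    (hm : m + n - 1 = k) (hk : 2 < k) : v = w := by
  have h := (hv.isProfileSolution hm hk).unique (hw.isProfileSolution hm hk)
    (hv.besseLog_zero.trans hw.besseLog_zero.symm)
  funext t
  rw [← besseZero_mul_exp_besseLog hk (hv.pos t), h, besseZero_mul_exp_besseLog hk (hw.pos t)]

theorem contDiff (hv : IsBesseProfile n m v) (hm : m + n - 1 = k) (hk : 2 < k) :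
    ContDiff ℝ ∞ v := by
  have h : ContDiff ℝ ∞ fun t => besseZero k * Real.exp (besseLog k v t / (k - 2)) :=
    contDiff_const.mul (((hv.isProfileSolution hm hk).contDiff.div_const _).exp)
  rwa [funext fun t => besseZero_mul_exp_besseLog hk (hv.pos t)] at h

theorem tendsto_atTop (hv : IsBesseProfile n m v) (hm : m + n - 1 = k) (hk : 2 < k) :
    Tendsto v atTop atTop := by
  have h : Tendsto (fun t => besseZero k * Real.exp (besseLog k v t / (k - 2))) atTop atTop :=
    (Real.tendsto_exp_atTop.comp ((hv.isProfileSolution hm hk).tendsto_atTop.atTop_div_const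
      (by linarith))).const_mul_atTop (besseZero_pos hk)
  rwa [funext fun t => besseZero_mul_exp_besseLog hk (hv.pos t)] at h

end IsBesseProfile

theorem existsUnique_isBesseProfile (hm : m + n - 1 = k) (hk : 2 < k) :
    ∃! v : ℝ → ℝ, IsBesseProfile n m v := by
  have hk2 : 0 < k - 2 := by linarith
  -- The initial value encodes v(0) = 1; it is positive because z < 1.
  obtain ⟨s, hs, h0⟩ := exists_isProfileSolution (δ := 2 / (k - 2))
    (a := -((k - 2) * Real.log (besseZero k))) (by positivity)
    (neg_pos.2 (mul_neg_of_pos_of_neg hk2 (Real.log_neg (besseZero_pos hk) (besseZero_lt_one hk))))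
  have hv := isBesseProfile_of_isProfileSolution hm hk hs h0
  exact ⟨_, hv, fun w hw => hw.unique hv hm hk⟩

/-- For s = 1 - φ the force at δ = 0 is 2e^{-s} - 2 + 2s = 2e^{φ-1} - 2φ. -/
theorem isBesseProfileInfty_iff {φ : ℝ → ℝ} :
    IsBesseProfileInfty φ ↔ IsProfileSolution 0 (fun t => 1 - φ t) ∧ φ 0 = 0 := by
  have hd : Differentiable ℝ (fun t => 1 - φ t) ↔ Differentiable ℝ φ := by
    refine ⟨fun h => ?_, fun h => h.const_sub 1⟩
    simpa using h.const_sub 1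
  have hd' : ∀ t, deriv (fun t => 1 - φ t) t = -deriv φ t := fun t => deriv_const_sub 1
  have hF : ∀ t, profileForce 0 (1 - φ t) = 2 * Real.exp (φ t - 1) - 2 * φ t := fun t => by
    rw [profileForce_eq_zero_left, neg_sub]
    ring
  constructor
  · intro h
    exact ⟨⟨fun t => sub_pos.2 (h.lt_one t), hd.2 h.differentiable, fun t => by
      rw [hd', neg_sq, h.ode, hF], fun t => by
      rw [hd']
      exact neg_pos.2 (h.deriv_neg t)⟩, h.initial⟩
  · rintro ⟨h, h0⟩
    exact ⟨fun t => sub_pos.1 (h.pos t), hd.1 h.differentiable, fun t => by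
      rw [← hF, ← h.ode, hd', neg_sq], h0, fun t => by
      have := h.deriv_pos t
      rw [hd'] at this
      linarith⟩

theorem existsUnique_isBesseProfileInfty : ∃! φ : ℝ → ℝ, IsBesseProfileInfty φ := by
  obtain ⟨s, hs, h0⟩ := exists_isProfileSolution (le_refl (0 : ℝ)) one_pos
  have hφ : IsBesseProfileInfty fun t => 1 - s t :=
    isBesseProfileInfty_iff.2 ⟨by simpa using hs, by simp [h0]⟩
  refine ⟨_, hφ, fun ψ hψ => ?_⟩
  obtain ⟨h1, h2⟩ := isBesseProfileInfty_iff.1 hψ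
  have := h1.unique hs (by simp [h0, h2])
  funext t
  have : 1 - ψ t = s t := congrFun this t
  linarith

namespace IsBesseProfileInfty

variable {φ : ℝ → ℝ}

theorem contDiff (hφ : IsBesseProfileInfty φ) : ContDiff ℝ ∞ φ := by
  have h := contDiff_const (c := (1 : ℝ)).sub (isBesseProfileInfty_iff.1 hφ).1.contDiff
  simpa using h

theorem tendsto_atBot (hφ : IsBesseProfileInfty φ) : Tendsto φ atBot (𝓝 1) := by
  have h := (isBesseProfileInfty_iff.1 hφ).1.tendsto_atBot.const_sub 1
  simpa using h

/-- φ tends to 1, a zero of 2e^{φ-1} - 2φ. Hence the circles of the soliton shrink as t → -∞. -/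
theorem tendsto_deriv_atBot (hφ : IsBesseProfileInfty φ) : Tendsto (deriv φ) atBot (𝓝 0) := by
  have h : Tendsto (fun t => deriv φ t ^ 2) atBot (𝓝 0) := by
    rw [funext hφ.ode]
    have h1 : Tendsto (fun x => 2 * Real.exp (x - 1) - 2 * x) (𝓝 1) (𝓝 (2 * Real.exp (1 - 1) - 2 * 1)) :=
      Continuous.tendsto (by fun_prop) 1
    simpa [Function.comp_def] using h1.comp hφ.tendsto_atBot
  refine tendsto_zero_iff_abs_tendsto_zero _ |>.2 ?_
  simpa [Function.comp_def, Real.sqrt_sq_eq_abs] using h.sqrt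

/-- Differentiating the first-order equation and cancelling 2φ' ≠ 0. -/
theorem deriv_deriv (hφ : IsBesseProfileInfty φ) (t : ℝ) :
    deriv (deriv φ) t = Real.exp (φ t - 1) - 1 := by
  have h1 := (hφ.differentiable t).hasDerivAt
  have hd : ContDiff ℝ ∞ (deriv φ) := hφ.contDiff.deriv'
  have h2 := (hd.differentiable (by simp) t).hasDerivAt.pow 2
  have h3 := ((h1.sub_const 1).exp.const_mul 2).sub (h1.const_mul 2)
  have h4 := h2.unique (h3.congr_of_eventuallyEq (Eventually.of_forall hφ.ode))
  have h5 := (hφ.deriv_neg t).ne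
  have : 2 * deriv φ t * (deriv (deriv φ) t - (Real.exp (φ t - 1) - 1)) = 0 := by
    norm_num at h4
    linear_combination h4
  have h6 := (mul_eq_zero.1 this).resolve_left (mul_ne_zero two_ne_zero h5)
  linarith

theorem deriv_deriv_deriv (hφ : IsBesseProfileInfty φ) (t : ℝ) :
    deriv (deriv (deriv φ)) t = Real.exp (φ t - 1) * deriv φ t := by
  rw [funext hφ.deriv_deriv]
  exact (((hφ.differentiable t).hasDerivAt.sub_const 1).exp.sub_const 1).deriv

end IsBesseProfileInfty

end BesseProfile

/-! ### Derivatives of v and its asymptotics as t → ∞ -/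

section BesseAsymptotics

variable {n : ℕ} {m k : ℝ} {v : ℝ → ℝ}

theorem hasDerivAt_besseForce {x : ℝ} (hx : 0 < x) :
    HasDerivAt (besseForce k) (2 * (x / k - (k - 2) / 2 *
      (2 * (k - 2) ^ ((k - 2) / 2) / k ^ ((k + 2) / 2) * x ^ (1 - k)))) x := by
  have h1 := (((hasDerivAt_id x).pow 2).sub_const 1).div_const k
  have h2 := (Real.hasDerivAt_rpow_const (p := 2 - k) (Or.inl hx.ne')).const_mul
    (2 * (k - 2) ^ ((k - 2) / 2) / k ^ ((k + 2) / 2))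
  refine (h1.add h2).congr_deriv ?_
  rw [show 2 - k - 1 = 1 - k by ring]
  simp
  ring

/-- The coefficient `c` such that `(v')² = (v² - 1)/k + c v`. -/
noncomputable def besseCoeff (k x : ℝ) : ℝ :=
  2 * (k - 2) ^ ((k - 2) / 2) / k ^ ((k + 2) / 2) * x ^ (1 - k)

theorem besseForce_eq_besseCoeff {x : ℝ} (hx : 0 < x) :
    besseForce k x = (x ^ 2 - 1) / k + besseCoeff k x * x := by
  rw [besseForce, besseCoeff, show 2 - k = 1 - k + 1 by ring, Real.rpow_add_one hx.ne', mul_assoc]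

namespace IsBesseProfile

theorem deriv_sq (hv : IsBesseProfile n m v) (hm : m + n - 1 = k) (t : ℝ) :
    deriv v t ^ 2 = (v t ^ 2 - 1) / k + besseCoeff k (v t) * v t := by
  rw [(isBesseProfile_iff.1 hv).2.2.1, hm, besseForce_eq_besseCoeff (hv.pos t)]

/-- Differentiating the equation for (v')² and cancelling 2v' ≠ 0. -/
theorem deriv_deriv (hv : IsBesseProfile n m v) (hm : m + n - 1 = k) (hk : 2 < k) (t : ℝ) :
    deriv (deriv v) t = v t / k - (k - 2) / 2 * besseCoeff k (v t) := by
  have h1 := (hv.differentiable t).hasDerivAt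
  have hd : ContDiff ℝ ∞ (deriv v) := (hv.contDiff hm hk).deriv'
  have h2 := (hd.differentiable (by simp) t).hasDerivAt.pow 2
  have h3 := (hasDerivAt_besseForce (k := k) (hv.pos t)).comp t h1
  have h4 := h2.unique (h3.congr_of_eventuallyEq (Eventually.of_forall fun t =>
    hm ▸ (isBesseProfile_iff.1 hv).2.2.1 t))
  have h5 := (hv.deriv_pos t).ne'
  rw [← besseCoeff] at h4
  have : 2 * deriv v t * (deriv (deriv v) t - (v t / k - (k - 2) / 2 * besseCoeff k (v t))) = 0 := by
    norm_num at h4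
    linear_combination h4
  have h6 := (mul_eq_zero.1 this).resolve_left (mul_ne_zero two_ne_zero h5)
  linarith

theorem deriv_deriv_deriv (hv : IsBesseProfile n m v) (hm : m + n - 1 = k) (hk : 2 < k) (t : ℝ) :
    deriv (deriv (deriv v)) t =
      deriv v t * (1 / k + (k - 2) * (k - 1) / 2 * (besseCoeff k (v t) / v t)) := by
  rw [funext (hv.deriv_deriv hm hk)]
  have h1 := (hv.differentiable t).hasDerivAt
  have h2 := ((h1.rpow_const (p := 1 - k) (Or.inl (hv.pos t).ne')).const_mul
    (2 * (k - 2) ^ ((k - 2) / 2) / k ^ ((k + 2) / 2)))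
  refine ((h1.div_const k).sub (h2.const_mul ((k - 2) / 2))).deriv.trans ?_
  rw [besseCoeff, Real.rpow_sub_one (hv.pos t).ne']
  ring

/-- This product is a constant times v^{2-k}, and k > 2. -/
theorem tendsto_besseCoeff_mul (hv : IsBesseProfile n m v) (hm : m + n - 1 = k) (hk : 2 < k) :
    Tendsto (fun t => besseCoeff k (v t) * v t) atTop (𝓝 0) := by
  have h := ((tendsto_rpow_neg_atTop (by linarith : 0 < k - 2)).comp
    (hv.tendsto_atTop hm hk)).const_mul (2 * (k - 2) ^ ((k - 2) / 2) / k ^ ((k + 2) / 2))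
  rw [mul_zero] at h
  refine h.congr fun t => ?_
  rw [besseCoeff, mul_assoc, ← Real.rpow_add_one (hv.pos t).ne']
  simp only [Function.comp]
  congr 2
  ring

theorem tendsto_inv_sq (hv : IsBesseProfile n m v) (hm : m + n - 1 = k) (hk : 2 < k) :
    Tendsto (fun t => (v t ^ 2)⁻¹) atTop (𝓝 0) :=
  ((tendsto_pow_atTop two_ne_zero).comp (hv.tendsto_atTop hm hk)).inv_tendsto_atTop

/-- (v'/v)² = 1/k + (cv - 1/k)v⁻² with cv → 0. -/
theorem tendsto_deriv_div (hv : IsBesseProfile n m v) (hm : m + n - 1 = k) (hk : 2 < k) :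
    Tendsto (fun t => deriv v t / v t) atTop (𝓝 (1 / Real.sqrt k)) := by
  have h : Tendsto (fun t => 1 / k + (besseCoeff k (v t) * v t - 1 / k) * (v t ^ 2)⁻¹) atTop
      (𝓝 (1 / k + (0 - 1 / k) * 0)) :=
    tendsto_const_nhds.add (((hv.tendsto_besseCoeff_mul hm hk).sub_const _).mul
      (hv.tendsto_inv_sq hm hk))
  rw [mul_zero, add_zero] at h
  have h' := h.sqrt
  rw [Real.sqrt_div zero_le_one, Real.sqrt_one] at h'
  refine h'.congr fun t => ?_
  rw [Real.sqrt_eq_iff_eq_sq _ (div_nonneg (hv.deriv_pos t).le (hv.pos t).le), div_pow,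
    hv.deriv_sq hm]
  · have := hv.pos t
    field_simp
    ring
  · have := sq_nonneg (deriv v t / v t)
    rw [div_pow, hv.deriv_sq hm] at this
    refine this.trans_eq ?_
    have := hv.pos t
    field_simp
    ring

/-- `v² (v'/v - k^{-1/2})` tends to `-k^{-1/2}/2`. -/
theorem tendsto_sq_mul_deriv_div (hv : IsBesseProfile n m v) (hm : m + n - 1 = k) (hk : 2 < k) :
    Tendsto (fun t => v t ^ 2 * (deriv v t / v t - 1 / Real.sqrt k)) atTop
      (𝓝 (-(1 / (2 * Real.sqrt k)))) := by
  have hk0 : 0 < k := by linarith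
  have hs := Real.sqrt_pos.2 hk0
  -- Difference of squares: v²((v'/v)² - 1/k) = cv - 1/k, divided by v'/v + 1/√k.
  have h : Tendsto (fun t => (besseCoeff k (v t) * v t - 1 / k) /
      (deriv v t / v t + 1 / Real.sqrt k)) atTop
      (𝓝 ((0 - 1 / k) / (1 / Real.sqrt k + 1 / Real.sqrt k))) :=
    ((hv.tendsto_besseCoeff_mul hm hk).sub_const _).div
      ((hv.tendsto_deriv_div hm hk).add_const _) (by positivity)
  have e : (0 - 1 / k) / (1 / Real.sqrt k + 1 / Real.sqrt k) = -(1 / (2 * Real.sqrt k)) := by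
    nth_rewrite 1 [← Real.sq_sqrt hk0.le]
    field_simp
    ring
  rw [e] at h
  refine h.congr fun t => ?_
  have h1 := hv.pos t
  have h2 := hv.deriv_pos t
  have h3 : 0 < deriv v t / v t + 1 / Real.sqrt k := by positivity
  rw [div_eq_iff h3.ne']
  have h4 := hv.deriv_sq hm t
  have h5 : (1 / Real.sqrt k) ^ 2 = 1 / k := by
    rw [div_pow, Real.sq_sqrt hk0.le, one_pow]
  have h6 : v t ^ 2 * (deriv v t / v t) ^ 2 = deriv v t ^ 2 := by
    field_simp
  linear_combination v t ^ 2 * h5 - h6 - h4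

/-- `v² (H - √k)` tends to `-(k - 2) / (2 √k)`, where `H` is the weighted mean curvature. -/
theorem tendsto_sq_mul_meanCurvature (hv : IsBesseProfile n m v) (hm : m + n - 1 = k)
    (hk : 2 < k) :
    Tendsto (fun t => v t ^ 2 * (deriv (deriv v) t / deriv v t + (k - 1) * (deriv v t / v t) -
      Real.sqrt k)) atTop (𝓝 (-((k - 2) / (2 * Real.sqrt k)))) := by
  have hk0 : 0 < k := by linarith
  have hs := Real.sqrt_pos.2 hk0
  have h1 := hv.tendsto_sq_mul_deriv_div hm hk
  have h2 := hv.tendsto_deriv_div hm hk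
  have h3 := hv.tendsto_besseCoeff_mul hm hk
  -- With p = v'/v one has H - √k = (p - 1/√k)(k - 1 - 1/(p√k)) - (k-2)c/(2vp).
  have h : Tendsto (fun t => (v t ^ 2 * (deriv v t / v t - 1 / Real.sqrt k)) *
      ((k - 1) - 1 / Real.sqrt k / (deriv v t / v t)) -
      (k - 2) / 2 * (besseCoeff k (v t) * v t) / (deriv v t / v t)) atTop
      (𝓝 (-(1 / (2 * Real.sqrt k)) * ((k - 1) - 1 / Real.sqrt k / (1 / Real.sqrt k)) -
        (k - 2) / 2 * 0 / (1 / Real.sqrt k))) :=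
    (h1.mul ((tendsto_const_nhds.div h2 (by positivity)).const_sub _)).sub
      ((h3.const_mul _).div h2 (by positivity))
  have e : -(1 / (2 * Real.sqrt k)) * ((k - 1) - 1 / Real.sqrt k / (1 / Real.sqrt k)) -
        (k - 2) / 2 * 0 / (1 / Real.sqrt k) = -((k - 2) / (2 * Real.sqrt k)) := by
    field_simp
    ring
  rw [e] at h
  refine h.congr fun t => ?_
  have h4 := hv.pos t
  have h5 := hv.deriv_pos t
  rw [hv.deriv_deriv hm hk]
  have e1 : v t / k = v t / Real.sqrt k ^ 2 := by rw [Real.sq_sqrt hk0.le]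
  have e2 : k = Real.sqrt k ^ 2 := (Real.sq_sqrt hk0.le).symm
  rw [e1]
  generalize besseCoeff k (v t) = c
  generalize Real.sqrt k = r at *
  subst e2
  field_simp
  ring

/-- `v⁻² e^{2t/√k}` converges to a positive limit as `t → ∞`. -/
theorem exists_tendsto_mul_exp (hv : IsBesseProfile n m v) (hm : m + n - 1 = k) (hk : 2 < k) :
    ∃ L : ℝ, 0 < L ∧ Tendsto (fun t => (v t ^ 2)⁻¹ * Real.exp (2 * t / Real.sqrt k)) atTop (𝓝 L) := by
  have hk0 : 0 < k := by linarith
  have hs := Real.sqrt_pos.2 hk0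
  have hdl : ∀ t, HasDerivAt (fun t => Real.log (v t) - t / Real.sqrt k)
      (deriv v t / v t - 1 / Real.sqrt k) t := fun t =>
    ((hv.differentiable t).hasDerivAt.log (hv.pos t).ne').sub ((hasDerivAt_id t).div_const _)
  have hdi : ∀ t, HasDerivAt (fun t => (v t ^ 2)⁻¹) (-2 * (v t ^ 2)⁻¹ * (deriv v t / v t)) t :=
    fun t => by
      refine (((hv.differentiable t).hasDerivAt.pow 2).inv (pow_pos (hv.pos t) 2).ne').congr_deriv ?_
      have := hv.pos t
      field_simp
      norm_num
      ring
  -- Beyond T, the quantity v²(v'/v - 1/√k), whose limit is -1/(2√k), lies between -1/√k and 0, and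
  -- v'/v > 1/(2√k).
  obtain ⟨T, hT⟩ := eventually_atTop.1
    (((hv.tendsto_sq_mul_deriv_div hm hk).eventually_lt_const
      (neg_lt_zero.2 (by positivity : 0 < 1 / (2 * Real.sqrt k)))).and
    (((hv.tendsto_sq_mul_deriv_div hm hk).eventually_const_lt
      (neg_lt_neg (by gcongr; linarith : 1 / (2 * Real.sqrt k) < 1 / (1 * Real.sqrt k)))).and
    ((hv.tendsto_deriv_div hm hk).eventually_const_lt
      ((by gcongr; linarith : 1 / (2 * Real.sqrt k) < 1 / (1 * Real.sqrt k)).trans_eq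
        (by rw [one_mul])))))
  have hanti : AntitoneOn (fun t => Real.log (v t) - t / Real.sqrt k) (Ici T) := by
    refine antitoneOn_of_hasDerivWithinAt_nonpos (convex_Ici T)
      (fun t _ => (hdl t).continuousAt.continuousWithinAt)
      (fun t _ => (hdl t).hasDerivWithinAt) fun t ht => ?_
    rw [interior_Ici] at ht
    have h1 := (hT t ht.le).1
    have h2 := pow_pos (hv.pos t) 2
    by_contra! hcon
    nlinarith [mul_pos h2 hcon]
  -- Subtracting v⁻² makes the function increasing: its derivative is v⁻²(v²(v'/v - 1/√k) + 2v'/v),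
  -- and beyond T the second summand outweighs the first. Hence log v - t/√k is decreasing and
  -- bounded below, so it converges.
  have hmono : MonotoneOn (fun t => Real.log (v t) - t / Real.sqrt k - (v t ^ 2)⁻¹) (Ici T) := by
    refine monotoneOn_of_hasDerivWithinAt_nonneg (convex_Ici T)
      (fun t _ => ((hdl t).sub (hdi t)).continuousAt.continuousWithinAt)
      (fun t _ => ((hdl t).sub (hdi t)).hasDerivWithinAt) fun t ht => ?_
    rw [interior_Ici] at ht
    obtain ⟨-, h1, h2⟩ := hT t ht.le
    have h3 := pow_pos (hv.pos t) 2
    have h4 : deriv v t / v t - 1 / Real.sqrt k - -2 * (v t ^ 2)⁻¹ * (deriv v t / v t) =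
        (v t ^ 2)⁻¹ * (v t ^ 2 * (deriv v t / v t - 1 / Real.sqrt k) + 2 * (deriv v t / v t)) := by
      have h6 := hv.pos t
      field_simp
      ring
    rw [h4]
    refine mul_nonneg (inv_pos.2 h3).le ?_
    have h5 : 1 / (1 * Real.sqrt k) = 2 * (1 / (2 * Real.sqrt k)) := by
      field_simp
    linarith
  obtain ⟨l, hl⟩ : ∃ l, Tendsto (fun t => Real.log (v t) - t / Real.sqrt k) atTop (𝓝 l) := by
    have ha : Antitone fun t => Real.log (v (max t T)) - max t T / Real.sqrt k := fun a b hab =>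
      hanti (le_max_right a T) (le_max_right b T) (max_le_max_right T hab)
    have hb : BddBelow (range fun t => Real.log (v (max t T)) - max t T / Real.sqrt k) := by
      refine ⟨Real.log (v T) - T / Real.sqrt k - (v T ^ 2)⁻¹, ?_⟩
      rintro _ ⟨t, rfl⟩
      have h1 := hmono self_mem_Ici (le_max_right t T) (le_max_right t T)
      have h2 := inv_pos.2 (pow_pos (hv.pos (max t T)) 2)
      simp only at h1 ⊢
      linarith
    refine ⟨_, (tendsto_atTop_ciInf ha hb).congr' ?_⟩
    filter_upwards [eventually_ge_atTop T] with t ht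
    rw [max_eq_left ht]
  refine ⟨Real.exp (-2 * l), Real.exp_pos _,
    ((Real.continuous_exp.tendsto _).comp (hl.const_mul (-2))).congr fun t => ?_⟩
  simp only [Function.comp]
  rw [show -2 * (Real.log (v t) - t / Real.sqrt k) =
    -((2 : ℕ) * Real.log (v t)) + 2 * t / Real.sqrt k by push_cast; ring, Real.exp_add,
    Real.exp_neg, Real.exp_nat_mul, Real.exp_log (hv.pos t)]

end IsBesseProfile

end BesseAsymptotics

/-! ### The limit m → ∞ -/

section BesseLimit

/-- With κ = k - 2, the logarithmic profile u_m solves the family with δ = 2/κ → 0, so u_m(t) → 1 -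
φ(t) once the initial values converge. The three limits follow from log v_m = (u_m(t) - u_m(0))/κ
and from the profile equation. -/
theorem tendsto_besseProfile_atTop {n : ℕ} (hn : 4 ≤ n) {φ : ℝ → ℝ} (hφ : IsBesseProfileInfty φ)
    {v : ℝ → ℝ → ℝ} (hv : ∀ m : ℝ, 0 ≤ m → IsBesseProfile n m (v m)) (t : ℝ) :
    Tendsto (fun m : ℝ => ((m + n - 1) * deriv (v m) t) ^ 2) atTop (𝓝 (deriv φ t ^ 2)) ∧
      Tendsto (fun m : ℝ => v m t) atTop (𝓝 1) ∧
      Tendsto (fun m : ℝ => v m t ^ m) atTop (𝓝 (Real.exp (-φ t))) := by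
  have hn' : (4 : ℝ) ≤ n := by exact_mod_cast hn
  have hk : ∀ m : ℝ, 0 ≤ m → 2 < m + n - 1 := fun m hm => by linarith
  obtain ⟨hs, hφ0⟩ := isBesseProfileInfty_iff.1 hφ
  set κ : ℝ → ℝ := fun m => m + n - 1 - 2 with hκ
  have hκt : Tendsto κ atTop atTop :=
    (tendsto_atTop_add_const_right atTop (n - 3 : ℝ) tendsto_id).congr fun m => by
      simp only [hκ, id]
      ring
  have hκ0 : ∀ m : ℝ, 0 ≤ m → 0 < κ m := fun m hm => sub_pos.2 (hk m hm)
  set u : ℝ → ℝ → ℝ := fun m => besseLog (m + n - 1) (v m) with hu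
  have hδ : Tendsto (fun m => 2 / κ m) atTop (𝓝 0) := hκt.const_div_atTop 2
  have hu' : ∀ᶠ m in atTop, IsProfileSolution (2 / κ m) (u m) := by
    filter_upwards [eventually_ge_atTop 0] with m hm
    exact (hv m hm).isProfileSolution rfl (hk m hm)
  -- The initial value is -κ log z = (κ/2)log(1 + 2/κ) → 1.
  have hu0 : Tendsto (fun m => u m 0) atTop (𝓝 1) := by
    have h := ((Real.tendsto_mul_log_one_add_div_atTop 2).comp hκt).div_const 2
    rw [div_self two_ne_zero] at h
    refine h.congr' ?_
    filter_upwards [eventually_ge_atTop 0] with m hm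
    have h1 := hκ0 m hm
    have h2 : 1 + 2 / κ m = ((m + n - 1 - 2) / (m + n - 1))⁻¹ := by
      have h3 := hk m hm
      have h4 : m + n - 1 ≠ 0 := by linarith
      rw [inv_div]
      change 1 + 2 / κ m = (m + n - 1) / κ m
      rw [eq_div_iff h1.ne', add_mul, div_mul_cancel₀ _ h1.ne']
      simp only [hκ]
      ring
    simp only [Function.comp, hu]
    rw [(hv m hm).besseLog_zero, besseZero, Real.log_sqrt (div_nonneg h1.le (by
      linarith [hk m hm])), h2, Real.log_inv]
    simp only [hκ]
    ring
  have hut : Tendsto (fun m => u m t) atTop (𝓝 (1 - φ t)) :=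
    hs.tendsto_of_tendsto hu' hδ (by simpa [hφ0] using hu0) t
  have hlog : ∀ m : ℝ, 0 ≤ m → Real.log (v m t) = (u m t - u m 0) / κ m := fun m hm => by
    have h1 := (hκ0 m hm).ne'
    rw [eq_div_iff h1]
    simp only [hu, besseLog, (hv m hm).initial, Real.log_one]
    ring
  have hlog0 : Tendsto (fun m => Real.log (v m t)) atTop (𝓝 0) := by
    have h := (hut.sub hu0).div_atTop hκt
    refine h.congr' ?_
    filter_upwards [eventually_ge_atTop 0] with m hm
    exact (hlog m hm).symm
  have hv1 : Tendsto (fun m : ℝ => v m t) atTop (𝓝 1) := by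
    have h := (Real.continuous_exp.tendsto _).comp hlog0
    rw [Real.exp_zero] at h
    refine h.congr' ?_
    filter_upwards [eventually_ge_atTop 0] with m hm
    exact Real.exp_log ((hv m hm).pos t)
  have hratio : ∀ c : ℝ, Tendsto (fun m => (κ m + c) / κ m) atTop (𝓝 1) := fun c => by
    have h := (hκt.const_div_atTop c).const_add 1
    rw [add_zero] at h
    refine h.congr' ?_
    filter_upwards [eventually_ge_atTop 0] with m hm
    rw [add_div, div_self (hκ0 m hm).ne']
  refine ⟨?_, hv1, ?_⟩
  · have hF := (continuous_profileForce.tendsto (0, 1 - φ t)).comp (hδ.prodMk_nhds hut)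
    have h := (((hratio 2).mul hv1).pow 2).mul hF
    rw [mul_one, one_pow, one_mul, ← hs.ode t, deriv_const_sub, neg_sq] at h
    refine h.congr' ?_
    filter_upwards [eventually_ge_atTop 0] with m hm
    have h1 := besseForce_eq (hk m hm) (u m t)
    have h2 := hκ0 m hm
    simp only [hu] at h1
    rw [besseZero_mul_exp_besseLog (hk m hm) ((hv m hm).pos t),
      ← (isBesseProfile_iff.1 (hv m hm)).2.2.1] at h1
    rw [mul_pow (m + n - 1 : ℝ), h1]
    have h3 : κ m + 2 = m + n - 1 := by
      simp only [hκ]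
      ring
    change ((κ m + 2) / κ m * v m t) ^ 2 * profileForce (2 / κ m) (u m t) =
      (m + n - 1) ^ 2 * ((v m t / κ m) ^ 2 * profileForce (2 / κ m) (u m t))
    rw [h3]
    ring
  -- Here m = κ - (n-3), so v^m = exp((m/κ)(u_m(t) - u_m(0))), and the exponent tends to (1 - φ(t))
  -- - 1.
  · have h := (Real.continuous_exp.tendsto _).comp ((hratio (-(n - 3))).mul (hut.sub hu0))
    rw [one_mul, sub_sub_cancel_left] at h
    refine h.congr' ?_
    filter_upwards [eventually_ge_atTop 0] with m hm
    rw [Real.rpow_def_of_pos ((hv m hm).pos t), hlog m hm]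
    simp only [Function.comp]
    congr 1
    simp only [hκ]
    ring

end BesseLimit

/-! ### Capped mean curvature and assembly of both cases -/

section MainTheorem

theorem SmoothMetric.cappedMeanCurvature_eq {E H M : Type*} [NormedAddCommGroup E]
    [NormedSpace ℝ E] [TopologicalSpace H] {I : ModelWithCorners ℝ E H} [TopologicalSpace M]
    [ChartedSpace H M] [IsManifold I ∞ M] (g : SmoothMetric I M) {φ f : M → ℝ} {F : ℝ → ℝ}
    (hF : ∀ x, g.levelSetMeanCurvature φ f x = F (f x)) (hf : Function.Surjective f) (c t : ℝ) :
    g.cappedMeanCurvature φ f c t = min (F t) c := by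
  obtain ⟨x, hx⟩ := hf t
  have : Nonempty {x : M // f x = t} := ⟨⟨x, hx⟩⟩
  have h : ∀ x : {x : M // f x = t}, min (g.levelSetMeanCurvature φ f x) c = min (F t) c :=
    fun x => by rw [hF, x.2]
  rw [SmoothMetric.cappedMeanCurvature, iInf_congr h, ciInf_const]

/-- The limit is the product of (k-2)/(2√k) = lim v²(√k - H) with lim v⁻²e^{2t/√k}. The cap is
harmless: √k - min(H, √k) is the positive part of √k - H, whose rescaled limit is already positive.
-/
theorem IsBesseProfile.exists_tendsto_capped {n : ℕ} {m k : ℝ} {v : ℝ → ℝ}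
    (hv : IsBesseProfile n m v) (hm : m + n - 1 = k) (hk : 2 < k) :
    ∃ A : ℝ, 0 < A ∧ Tendsto (fun t : ℝ => (Real.sqrt k - min (deriv (deriv v) t / deriv v t +
      (k - 1) * (deriv v t / v t)) (Real.sqrt k)) * Real.exp (2 * t / Real.sqrt k)) atTop (𝓝 A) := by
  have hs : 0 < Real.sqrt k := Real.sqrt_pos.2 (by linarith)
  have hA : 0 < (k - 2) / (2 * Real.sqrt k) := div_pos (by linarith) (by positivity)
  obtain ⟨L, hL, hLt⟩ := hv.exists_tendsto_mul_exp hm hk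
  refine ⟨_, mul_pos hA hL, ?_⟩
  have h1 := (hv.tendsto_sq_mul_meanCurvature hm hk).neg.max (tendsto_const_nhds (x := (0 : ℝ)))
  rw [neg_neg, max_eq_left hA.le] at h1
  refine (h1.mul hLt).congr fun t => ?_
  have h2 : 0 < v t ^ 2 := pow_pos (hv.pos t) 2
  generalize deriv (deriv v) t / deriv v t + (k - 1) * (deriv v t / v t) = F
  have h3 : max (-(v t ^ 2 * (F - Real.sqrt k))) 0 = v t ^ 2 * (Real.sqrt k - min F (Real.sqrt k)) := by
    rcases le_total F (Real.sqrt k) with h | h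
    · rw [min_eq_left h, max_eq_left (by nlinarith)]
      ring
    · rw [min_eq_right h, max_eq_right (by nlinarith)]
      ring
  rw [h3]
  have h4 := hv.pos t
  field_simp

theorem IsBesseProfile.isLittleO_meanCurvature {n : ℕ} {m k : ℝ} {v : ℝ → ℝ}
    (hv : IsBesseProfile n m v) (hm : m + n - 1 = k) (hk : 2 < k) :
    (fun t : ℝ => deriv (deriv v) t / deriv v t + (k - 1) * (deriv v t / v t) -
      (Real.sqrt k - (k - 2) / (2 * Real.sqrt k) * (v t ^ 2)⁻¹)) =o[atTop]
        fun t : ℝ => (v t ^ 2)⁻¹ := by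
  have h2 : ∀ t, 0 < v t ^ 2 := fun t => pow_pos (hv.pos t) 2
  refine (isLittleO_iff_tendsto fun t ht => absurd ht (inv_pos.2 (h2 t)).ne').2 ?_
  have h1 := (hv.tendsto_sq_mul_meanCurvature hm hk).add_const ((k - 2) / (2 * Real.sqrt k))
  rw [neg_add_cancel] at h1
  refine h1.congr fun t => ?_
  have h3 := hv.pos t
  rw [div_inv_eq_mul]
  field_simp
  ring

theorem tendsto_ofReal_abs_sub_atTop (a : ℝ) :
    Tendsto (fun t : ℝ => ENNReal.ofReal |a - t|) atTop (𝓝 ⊤) := by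
  refine ENNReal.tendsto_ofReal_nhds_top.2 (tendsto_atTop_mono (fun t => neg_le_abs (a - t)) ?_)
  simpa [sub_eq_add_neg] using tendsto_atTop_add_const_right atTop (-a) tendsto_id

/-- For t ≥ a, replacing t by the distance t - a only multiplies the limit by e^{-2a/c}. -/
theorem tendsto_mul_exp_abs_sub {F : ℝ → ℝ} {A c : ℝ}
    (h : Tendsto (fun t => F t * Real.exp (2 * t / c)) atTop (𝓝 A)) (a : ℝ) :
    Tendsto (fun t => F t * Real.exp (2 * (ENNReal.ofReal |a - t|).toReal / c)) atTop
      (𝓝 (A * Real.exp (-(2 * a / c)))) := by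
  refine (h.mul_const _).congr' ?_
  filter_upwards [eventually_ge_atTop a] with t ht
  rw [ENNReal.toReal_ofReal (abs_nonneg _), abs_of_nonpos (by linarith), mul_assoc, ← Real.exp_add]
  congr 2
  ring

open scoped NNReal in
theorem besse_finite {n : ℕ} (hn : 4 ≤ n)
    (N : Type u) [TopologicalSpace N] [T2Space N]
    [ChartedSpace (EuclideanSpace ℝ (Fin (n - 2))) N] [IsManifold (𝓡 (n - 2)) ∞ N] [Nonempty N]
    (h : SmoothMetric (𝓡 (n - 2)) N) (hcomplete : h.IsComplete) {m : ℝ} (hm : 0 ≤ m)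
    {v : ℝ → ℝ} (hv : IsBesseProfile n m v)
    (hric : ∀ (p : N) (X : TangentSpace (𝓡 (n - 2)) p),
      -((m + n - 3) / (m + n - 1)) * h.inner p X X ≤ h.ricci p X X) :
    ∃ g : SmoothMetric (lineCircleModel (n - 2)) (ℝ × Circle × N),
      IsLineCircleWarpedMetric (fun t => (m + n - 1) * deriv v t) v h g ∧
      g.IsComplete ∧
      (∀ (x : ℝ × Circle × N) (X : TangentSpace (lineCircleModel (n - 2)) x),
        -(g.inner x X X) ≤
          g.bakryEmeryRicci (fun q => -m * Real.log (v q.1)) (ENNReal.ofReal m) x X X) ∧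
      ((∀ (p : N) (X Y : TangentSpace (𝓡 (n - 2)) p),
          h.ricci p X Y = -((m + n - 3) / (m + n - 1)) * h.inner p X Y) →
        ∀ (x : ℝ × Circle × N) (X Y : TangentSpace (lineCircleModel (n - 2)) x),
          g.bakryEmeryRicci (fun q => -m * Real.log (v q.1)) (ENNReal.ofReal m) x X Y =
            -(g.inner x X Y)) ∧
      (∀ x : ℝ × Circle × N,
        g.levelSetMeanCurvature (fun q => -m * Real.log (v q.1)) (fun q => q.1) x =
          deriv (deriv v) x.1 / deriv v x.1 + (m + n - 2) * (deriv v x.1 / v x.1)) ∧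
      (∀ y : Circle × N,
        (fun t : ℝ =>
          g.levelSetMeanCurvature (fun q => -m * Real.log (v q.1)) (fun q => q.1) (t, y) -
            (Real.sqrt (m + n - 1) -
              (m + n - 3) / (2 * Real.sqrt (m + n - 1)) * (v t ^ 2)⁻¹))
          =o[atTop] fun t : ℝ => (v t ^ 2)⁻¹) ∧
      (∃ A : ℝ, 0 < A ∧
        Tendsto (fun t : ℝ =>
          (Real.sqrt (m + n - 1) -
            g.cappedMeanCurvature (fun q => -m * Real.log (v q.1)) (fun q => q.1)
              (Real.sqrt (m + n - 1)) t) *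
          Real.exp (2 * t / Real.sqrt (m + n - 1))) atTop (𝓝 A)) ∧
      (CompactSpace N → ConnectedSpace N →
        numberOfEnds (ℝ × Circle × N) = 2 ∧
        (∀ t : ℝ, IsCompact {x : ℝ × Circle × N | x.1 = t} ∧
          ∃ U V : Set (ℝ × Circle × N), IsOpen U ∧ IsOpen V ∧ IsConnected U ∧
            IsConnected V ∧ Disjoint U V ∧ U ∪ V = {x : ℝ × Circle × N | x.1 = t}ᶜ) ∧
        (∀ o : ℝ × Circle × N,
          Tendsto (fun t : ℝ => g.edistSet o {x | x.1 = t}) atTop (𝓝 ⊤) ∧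
          ∃ A : ℝ, 0 < A ∧
            Tendsto (fun t : ℝ =>
              (Real.sqrt (m + n - 1) -
                g.cappedMeanCurvature (fun q => -m * Real.log (v q.1)) (fun q => q.1)
                  (Real.sqrt (m + n - 1)) t) *
              Real.exp (2 * (g.edistSet o {x | x.1 = t}).toReal / Real.sqrt (m + n - 1)))
              atTop (𝓝 A)) ∧
        (∀ (N' : Type w) [TopologicalSpace N'] [T2Space N'] [SecondCountableTopology N']
          [CompactSpace N'] [ChartedSpace (EuclideanSpace ℝ (Fin (n - 1))) N']
          [IsManifold (𝓡 (n - 1)) ∞ N'] (h' : SmoothMetric (𝓡 (n - 1)) N')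
          (g' : SmoothMetric (lineModel (n - 1)) (ℝ × N')),
          (∀ (p : N') (X : TangentSpace (𝓡 (n - 1)) p), 0 ≤ h'.ricci p X X) →
          IsLineWarpedMetric (fun t => Real.exp (t / Real.sqrt (m + n - 1))) h' g' →
          ¬ g.IsIsometricTo g')) := by
  have hn' : (4 : ℝ) ≤ n := by exact_mod_cast hn
  have hd : ((n - 2 : ℕ) : ℝ) = n - 2 := by
    rw [Nat.cast_sub (by omega)]
    norm_num
  have hk : 2 < m + n - 1 := by linarith
  have hk0 : m + n - 1 ≠ 0 := by linarith
  have hvs := hv.contDiff rfl hk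
  have hvs' : ContDiff ℝ ∞ (deriv v) := hvs.deriv'
  -- A locally compact Hausdorff space is regular, as needed for the Riemannian distance to induce
  -- the topology.
  have : LocallyCompactSpace N := Manifold.locallyCompact_of_finiteDimensional (𝓡 (n - 2))
  set g := warpedMetric (α := fun t => (m + n - 1) * deriv v t) (β := v)
    (contDiff_const.mul hvs') hvs (fun t => mul_ne_zero hk0 (hv.deriv_pos t).ne')
    (fun t => (hv.pos t).ne') circleMetric h with hgdef
  have hg : IsWarpedMetric (fun t => (m + n - 1) * deriv v t) v circleMetric h g :=
    isWarpedMetric_warpedMetric _ _ _ _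
  -- The double zero z is a uniform positive lower bound for v; it serves completeness and the
  -- collapsing argument.
  have hb : (0 : ℝ≥0) < ⟨besseZero (m + n - 1), (besseZero_pos hk).le⟩ := besseZero_pos hk
  have hβ : ∀ t, ((⟨besseZero (m + n - 1), (besseZero_pos hk).le⟩ : ℝ≥0) : ℝ) ≤ v t := fun t =>
    (hv.besseZero_lt rfl hk t).le
  have hBE := fun x => hg.bakryEmeryRicci_besse (m := m) (by rw [hd]; ring) hk0 hm hvs hv.pos
    hv.deriv_pos x (hv.deriv_sq rfl x.1) (hv.deriv_deriv rfl hk x.1)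
    (hv.deriv_deriv_deriv rfl hk x.1)
  have h3 : m + n - 1 - 2 = m + n - 3 := by ring
  have h2 : m + n - 1 - 1 = m + n - 2 := by ring
  rw [h3] at hBE
  have hH : ∀ x : ℝ × Circle × N,
      g.levelSetMeanCurvature (fun q => -m * Real.log (v q.1)) (fun q => q.1) x =
        deriv (deriv v) x.1 / deriv v x.1 + (m + n - 2) * (deriv v x.1 / v x.1) := fun x => by
    rw [hg.levelSetMeanCurvature_besse hk0 hvs hv.pos hv.deriv_pos, hd, add_sub_assoc]
  have hc := fun t => g.cappedMeanCurvature_eq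
    (F := fun t => deriv (deriv v) t / deriv v t + (m + n - 2) * (deriv v t / v t)) hH
    Prod.fst_surjective (Real.sqrt (m + n - 1)) t
  have hcap := hv.exists_tendsto_capped rfl hk
  rw [h2] at hcap
  refine ⟨g, isLineCircleWarpedMetric_of_isWarpedMetric hg, hg.isComplete hb hβ hcomplete,
    fun x X => ?_, fun hE x X Y => ?_, hH, fun y => ?_, ?_, fun hN hN' => ⟨numberOfEnds_real_prod,
    fun t => ⟨?_, exists_isOpen_isConnected_compl_slice t⟩, fun o => ⟨?_, ?_⟩, ?_⟩⟩
  · have h1 := hric x.2.2 (X : ℝ × EuclideanSpace ℝ (Fin 1) × EuclideanSpace ℝ (Fin (n - 2))).2.2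
    refine le_of_le_of_eq ?_ (hBE x X X).symm
    rw [neg_mul] at h1
    exact le_add_of_nonneg_right (by linarith)
  · have aux : ∀ a b c r : ℝ, r = -c * b → -a + (r + c * b) = -a := fun a b c r hr => by
      rw [hr]
      ring
    exact (hBE x X Y).trans (aux _ _ _ _ (hE x.2.2 _ _))
  · have h1 := hv.isLittleO_meanCurvature rfl hk
    rw [h2, h3] at h1
    exact h1.congr_left fun t => by rw [hH]
  · obtain ⟨A, hA, hAt⟩ := hcap
    exact ⟨A, hA, hAt.congr fun t => by rw [hc]⟩
  · exact isCompact_fst_preimage (isCompact_singleton (x := t))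
  · simp_rw [hg.edistSet_eq]
    exact tendsto_ofReal_abs_sub_atTop o.1
  · obtain ⟨A, hA, hAt⟩ := hcap
    refine ⟨_, mul_pos hA (Real.exp_pos _), (tendsto_mul_exp_abs_sub hAt o.1).congr fun t => ?_⟩
    rw [hg.edistSet_eq, hc]
  · intro N' _ _ _ _ _ _ h' g' _ hg'
    -- The collapsing argument needs two distinct points of N, which exist because n - 2 > 0.
    have : Nontrivial (EuclideanSpace ℝ (Fin (n - 2))) :=
      Module.nontrivial_of_finrank_pos (R := ℝ) (by rw [finrank_euclideanSpace_fin]; omega)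
    have : Nontrivial N := nontrivial_of_chartedSpace (EuclideanSpace ℝ (Fin (n - 2))) N
    exact not_isIsometricTo_of_collapsing hg hb hβ hg' (fun t => (Real.exp_pos _).ne')
      (Real.tendsto_exp_atBot.comp (tendsto_id.atBot_div_const (Real.sqrt_pos.2 (by linarith))))

theorem besse_infinite {n : ℕ} (hn : 4 ≤ n)
    (N : Type u) [TopologicalSpace N] [T2Space N]
    [ChartedSpace (EuclideanSpace ℝ (Fin (n - 2))) N] [IsManifold (𝓡 (n - 2)) ∞ N] [Nonempty N]
    (h : SmoothMetric (𝓡 (n - 2)) N) (hcomplete : h.IsComplete)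
    {φ : ℝ → ℝ} (hφ : IsBesseProfileInfty φ)
    (hric : ∀ (p : N) (X : TangentSpace (𝓡 (n - 2)) p), -(h.inner p X X) ≤ h.ricci p X X) :
    ∃ g : SmoothMetric (lineCircleModel (n - 2)) (ℝ × Circle × N),
      IsLineCircleWarpedMetric (deriv φ) (fun _ => 1) h g ∧
      g.IsComplete ∧
      (∀ (x : ℝ × Circle × N) (X : TangentSpace (lineCircleModel (n - 2)) x),
        -(g.inner x X X) ≤ g.bakryEmeryRicci (fun q => φ q.1) ⊤ x X X) ∧
      (∀ x : ℝ × Circle × N,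
        g.levelSetMeanCurvature (fun q => φ q.1) (fun q => q.1) x =
          deriv (deriv φ) x.1 / deriv φ x.1 - deriv φ x.1) ∧
      ((∀ (p : N) (X Y : TangentSpace (𝓡 (n - 2)) p), h.ricci p X Y = -(h.inner p X Y)) →
        ContMDiff (lineCircleModel (n - 2)) 𝓘(ℝ, ℝ) ∞
          (fun q : ℝ × Circle × N => φ q.1) ∧
        (∀ (x : ℝ × Circle × N) (X Y : TangentSpace (lineCircleModel (n - 2)) x),
          g.bakryEmeryRicci (fun q => φ q.1) ⊤ x X Y = -(g.inner x X Y)) ∧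
        (∀ x : ℝ × Circle × N, g.scalar x = 2 - n - 2 * Real.exp (φ x.1 - 1)) ∧
        (∀ x : ℝ × Circle × N, -(n : ℝ) < g.scalar x) ∧
        Tendsto g.scalar (comap (fun x : ℝ × Circle × N => x.1) atBot) (𝓝 (-(n : ℝ))) ∧
        (CompactSpace N → ConnectedSpace N →
          numberOfEnds (ℝ × Circle × N) = 2 ∧
          (∀ (N' : Type w) [TopologicalSpace N'] [T2Space N'] [SecondCountableTopology N']
            [CompactSpace N'] [ChartedSpace (EuclideanSpace ℝ (Fin (n - 1))) N']
            [IsManifold (𝓡 (n - 1)) ∞ N'] (h' : SmoothMetric (𝓡 (n - 1)) N')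
            (g' : SmoothMetric (lineModel (n - 1)) (ℝ × N')),
            (∀ (p : N') (X Y : TangentSpace (𝓡 (n - 1)) p),
              h'.ricci p X Y = -(h'.inner p X Y)) →
            IsLineWarpedMetric (fun _ => 1) h' g' →
            ¬ g.IsIsometricTo g'))) := by
  have hd : ((n - 2 : ℕ) : ℝ) = n - 2 := by
    rw [Nat.cast_sub (by omega)]
    norm_num
  have hφs := hφ.contDiff
  have hφ0 : ∀ t, deriv φ t ≠ 0 := fun t => (hφ.deriv_neg t).ne
  have : LocallyCompactSpace N := Manifold.locallyCompact_of_finiteDimensional (𝓡 (n - 2))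
  set g := warpedMetric (α := deriv φ) (β := fun _ => 1) hφs.deriv' contDiff_const hφ0
    (fun _ => one_ne_zero) circleMetric h with hgdef
  have hg : IsWarpedMetric (deriv φ) (fun _ => 1) circleMetric h g :=
    isWarpedMetric_warpedMetric _ _ _ _
  have hBE := fun x => hg.bakryEmeryRicci_soliton hφs hφ0 x (hφ.deriv_deriv x.1)
    (hφ.deriv_deriv_deriv x.1)
  refine ⟨g, isLineCircleWarpedMetric_of_isWarpedMetric hg,
    hg.isComplete one_pos (fun _ => le_rfl) hcomplete, fun x X => ?_,
    hg.levelSetMeanCurvature_soliton hφs hφ0, fun hE => ?_⟩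
  · have h1 := hric x.2.2 (X : ℝ × EuclideanSpace ℝ (Fin 1) × EuclideanSpace ℝ (Fin (n - 2))).2.2
    refine le_of_le_of_eq ?_ (hBE x X X).symm
    exact le_add_of_nonneg_right (by rw [one_mul]; linarith)
  have hscal : ∀ x : ℝ × Circle × N, g.scalar x = 2 - n - 2 * Real.exp (φ x.1 - 1) := fun x => by
    rw [hg.scalar_soliton hφs hφ0 x (hφ.deriv_deriv_deriv x.1) hE, hd]
    ring
  refine ⟨hφs.contMDiff.comp contMDiff_fst, fun x X Y => ?_, hscal, fun x => ?_, ?_,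
    fun hN hN' => ⟨numberOfEnds_real_prod, ?_⟩⟩
  · have aux : ∀ a b r : ℝ, r = -b → -a + (r + 1 * b) = -a := fun a b r hr => by
      rw [hr]
      ring
    exact (hBE x X Y).trans (aux _ _ _ (hE x.2.2 _ _))
  · rw [hscal]
    have : Real.exp (φ x.1 - 1) < 1 := Real.exp_lt_one_iff.2 (sub_neg.2 (hφ.lt_one x.1))
    linarith
  -- As t → -∞, φ → 1 and so R → 2 - n - 2 = -n.
  · rw [funext hscal]
    have h1 : Tendsto (fun y : ℝ => 2 - n - 2 * Real.exp (y - 1)) (𝓝 1)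
        (𝓝 (2 - n - 2 * Real.exp (1 - 1))) := Continuous.tendsto (by fun_prop) 1
    have h2 : (2 - n - 2 * Real.exp (1 - 1) : ℝ) = -n := by
      simp
    rw [h2] at h1
    exact h1.comp (hφ.tendsto_atBot.comp tendsto_comap)
  · intro N' _ _ _ _ _ _ h' g' _ hg'
    exact not_isIsometricTo_of_short_circles hg hφ0 hφ.tendsto_deriv_atBot hg'

end MainTheorem

theorem mainTheorem7 (n : ℕ) (hn : 4 ≤ n)
    (N : Type u) [TopologicalSpace N] [T2Space N] [SecondCountableTopology N]
    [ChartedSpace (EuclideanSpace ℝ (Fin (n - 2))) N] [IsManifold (𝓡 (n - 2)) ∞ N] [Nonempty N]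
    (h : SmoothMetric (𝓡 (n - 2)) N) (hcomplete : h.IsComplete) :
    -- the case of finite `m`
    (∀ m : ℝ, 0 ≤ m →
      (∃! v : ℝ → ℝ, IsBesseProfile n m v) ∧
      ∀ v : ℝ → ℝ, IsBesseProfile n m v →
        ContDiff ℝ ∞ v ∧
        ((∀ (p : N) (X : TangentSpace (𝓡 (n - 2)) p),
            -((m + n - 3) / (m + n - 1)) * h.inner p X X ≤ h.ricci p X X) →
          ∃ g : SmoothMetric (lineCircleModel (n - 2)) (ℝ × Circle × N),
            IsLineCircleWarpedMetric (fun t => (m + n - 1) * deriv v t) v h g ∧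
            g.IsComplete ∧
            -- the curvature bound, with equality if it holds on `N`
            (∀ (x : ℝ × Circle × N) (X : TangentSpace (lineCircleModel (n - 2)) x),
              -(g.inner x X X) ≤
                g.bakryEmeryRicci (fun q => -m * Real.log (v q.1)) (ENNReal.ofReal m) x X X) ∧
            ((∀ (p : N) (X Y : TangentSpace (𝓡 (n - 2)) p),
                h.ricci p X Y = -((m + n - 3) / (m + n - 1)) * h.inner p X Y) →
              ∀ (x : ℝ × Circle × N) (X Y : TangentSpace (lineCircleModel (n - 2)) x),
                g.bakryEmeryRicci (fun q => -m * Real.log (v q.1)) (ENNReal.ofReal m) x X Y =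
                  -(g.inner x X Y)) ∧
            -- the weighted mean curvature of the level sets of `t`
            (∀ x : ℝ × Circle × N,
              g.levelSetMeanCurvature (fun q => -m * Real.log (v q.1)) (fun q => q.1) x =
                deriv (deriv v) x.1 / deriv v x.1 + (m + n - 2) * (deriv v x.1 / v x.1)) ∧
            (∀ y : Circle × N,
              (fun t : ℝ =>
                g.levelSetMeanCurvature (fun q => -m * Real.log (v q.1)) (fun q => q.1) (t, y) -
                  (Real.sqrt (m + n - 1) -
                    (m + n - 3) / (2 * Real.sqrt (m + n - 1)) * (v t ^ 2)⁻¹))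
                =o[atTop] fun t : ℝ => (v t ^ 2)⁻¹) ∧
            (∃ A : ℝ, 0 < A ∧
              Tendsto (fun t : ℝ =>
                (Real.sqrt (m + n - 1) -
                  g.cappedMeanCurvature (fun q => -m * Real.log (v q.1)) (fun q => q.1)
                    (Real.sqrt (m + n - 1)) t) *
                Real.exp (2 * t / Real.sqrt (m + n - 1))) atTop (𝓝 A)) ∧
            -- sharpness of the decay hypothesis of the splitting theorem
            (CompactSpace N → ConnectedSpace N →
              numberOfEnds (ℝ × Circle × N) = 2 ∧
              (∀ t : ℝ, IsCompact {x : ℝ × Circle × N | x.1 = t} ∧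
                ∃ U V : Set (ℝ × Circle × N), IsOpen U ∧ IsOpen V ∧ IsConnected U ∧
                  IsConnected V ∧ Disjoint U V ∧ U ∪ V = {x : ℝ × Circle × N | x.1 = t}ᶜ) ∧
              (∀ o : ℝ × Circle × N,
                Tendsto (fun t : ℝ => g.edistSet o {x | x.1 = t}) atTop (𝓝 ⊤) ∧
                ∃ A : ℝ, 0 < A ∧
                  Tendsto (fun t : ℝ =>
                    (Real.sqrt (m + n - 1) -
                      g.cappedMeanCurvature (fun q => -m * Real.log (v q.1)) (fun q => q.1)
                        (Real.sqrt (m + n - 1)) t) *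
                    Real.exp (2 * (g.edistSet o {x | x.1 = t}).toReal / Real.sqrt (m + n - 1)))
                    atTop (𝓝 A)) ∧
              (∀ (N' : Type w) [TopologicalSpace N'] [T2Space N'] [SecondCountableTopology N']
                [CompactSpace N'] [ChartedSpace (EuclideanSpace ℝ (Fin (n - 1))) N']
                [IsManifold (𝓡 (n - 1)) ∞ N'] (h' : SmoothMetric (𝓡 (n - 1)) N')
                (g' : SmoothMetric (lineModel (n - 1)) (ℝ × N')),
                (∀ (p : N') (X : TangentSpace (𝓡 (n - 1)) p), 0 ≤ h'.ricci p X X) →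
                IsLineWarpedMetric (fun t => Real.exp (t / Real.sqrt (m + n - 1))) h' g' →
                ¬ g.IsIsometricTo g')))) ∧
    -- the case `m = ∞`
    (∃! φ : ℝ → ℝ, IsBesseProfileInfty φ) ∧
    ∀ φ : ℝ → ℝ, IsBesseProfileInfty φ →
      ContDiff ℝ ∞ φ ∧
      -- it is the limit of the metrics and measures for finite `m`
      (∀ v : ℝ → ℝ → ℝ, (∀ m : ℝ, 0 ≤ m → IsBesseProfile n m (v m)) → ∀ t : ℝ,
        Tendsto (fun m : ℝ => ((m + n - 1) * deriv (v m) t) ^ 2) atTop (𝓝 (deriv φ t ^ 2)) ∧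
        Tendsto (fun m : ℝ => v m t) atTop (𝓝 1) ∧
        Tendsto (fun m : ℝ => v m t ^ m) atTop (𝓝 (Real.exp (-φ t)))) ∧
      ((∀ (p : N) (X : TangentSpace (𝓡 (n - 2)) p), -(h.inner p X X) ≤ h.ricci p X X) →
        ∃ g : SmoothMetric (lineCircleModel (n - 2)) (ℝ × Circle × N),
          IsLineCircleWarpedMetric (deriv φ) (fun _ => 1) h g ∧
          g.IsComplete ∧
          (∀ (x : ℝ × Circle × N) (X : TangentSpace (lineCircleModel (n - 2)) x),
            -(g.inner x X X) ≤ g.bakryEmeryRicci (fun q => φ q.1) ⊤ x X X) ∧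
          (∀ x : ℝ × Circle × N,
            g.levelSetMeanCurvature (fun q => φ q.1) (fun q => q.1) x =
              deriv (deriv φ) x.1 / deriv φ x.1 - deriv φ x.1) ∧
          -- for `Ric_h = -h`: an expanding gradient Ricci soliton
          ((∀ (p : N) (X Y : TangentSpace (𝓡 (n - 2)) p), h.ricci p X Y = -(h.inner p X Y)) →
            ContMDiff (lineCircleModel (n - 2)) 𝓘(ℝ, ℝ) ∞
              (fun q : ℝ × Circle × N => φ q.1) ∧
            (∀ (x : ℝ × Circle × N) (X Y : TangentSpace (lineCircleModel (n - 2)) x),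
              g.bakryEmeryRicci (fun q => φ q.1) ⊤ x X Y = -(g.inner x X Y)) ∧
            (∀ x : ℝ × Circle × N, g.scalar x = 2 - n - 2 * Real.exp (φ x.1 - 1)) ∧
            (∀ x : ℝ × Circle × N, -(n : ℝ) < g.scalar x) ∧
            Tendsto g.scalar (comap (fun x : ℝ × Circle × N => x.1) atBot) (𝓝 (-(n : ℝ))) ∧
            -- with two ends, which is not a product, for compact `N`
            (CompactSpace N → ConnectedSpace N →
              numberOfEnds (ℝ × Circle × N) = 2 ∧
              (∀ (N' : Type w) [TopologicalSpace N'] [T2Space N'] [SecondCountableTopology N']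
                [CompactSpace N'] [ChartedSpace (EuclideanSpace ℝ (Fin (n - 1))) N']
                [IsManifold (𝓡 (n - 1)) ∞ N'] (h' : SmoothMetric (𝓡 (n - 1)) N')
                (g' : SmoothMetric (lineModel (n - 1)) (ℝ × N')),
                (∀ (p : N') (X Y : TangentSpace (𝓡 (n - 1)) p),
                  h'.ricci p X Y = -(h'.inner p X Y)) →
                IsLineWarpedMetric (fun _ => 1) h' g' →
                ¬ g.IsIsometricTo g')))) := by
  have hn' : (4 : ℝ) ≤ n := by exact_mod_cast hn
  refine ⟨fun m hm => ⟨existsUnique_isBesseProfile rfl (by linarith), fun v hv =>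
    ⟨hv.contDiff rfl (by linarith), fun hric => besse_finite hn N h hcomplete hm hv hric⟩⟩,
    existsUnique_isBesseProfileInfty, fun φ hφ => ⟨hφ.contDiff,
      fun v hv t => tendsto_besseProfile_atTop hn hφ hv t,
      fun hric => besse_infinite hn N h hcomplete hφ hric⟩⟩
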